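/- Let $d\ge 0$ be an integer and let $\beta, C, \lambda, R>0$ be real. Let $\Lambda\subset\mathbb Z^d$ be finite, $\lambda_i\in[0,\lambda]$ for $i\in\Lambda$, and let $H:\{-1,1\}^\Lambda\to\mathbb R$. Write $\nabla_iH(\sigma)=H(\sigma^i)-H(\sigma)$, where $\sigma^i$ is $\sigma$ with the $i$-th spin flipped. Assume that $|\nabla_iH(\sigma)|\le C$ for all $i\in\Lambda$ and all $\sigma$, and that $\nabla_iH(\sigma)=\nabla_iH(\tau)$ whenever $\sigma_j=\tau_j$ for all $j\in\Lambda$ with $|j-i|\le R$ (Euclidean distance). Let $\Sigma$ be the set of finite subsets of the circle $[0,\beta)$, with the $\sigma$-algebra generated by the numbers of points in Borel sets, and let $\hat S=(\Sigma\times\Sigma\times\{-1,1\})^\Lambda$. A triple $(v,w,s)\in\Sigma\times\Sigma\times\{-1,1\}$ encodes a right-continuous piecewise constant function $[0,\beta)\to\{-1,1\}$: if $v\cup w=\emptyset$ it is constantly $s$; otherwise its value at $t$ is $1$ or $-1$ according to whether the first point of $v\cup w$ strictly after $t$ (cyclically) belongs to $v$ or to $w$ (a point of $v\cap w$ counts as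 a point of $v$). For $\omega=(\xi,\eta,\rho)\in\hat S$ let $\sigma(t)\in\{-1,1\}^\Lambda$ be the resulting configuration at time $t$ and put $\hat H(\omega)=\int_0^\beta H(\sigma(t))\,dt$. Let $\hat P_i$ be the law of the Poisson point process on $[0,\beta)$ of intensity $\lambda_i/2$, and let $$\hat\pi(d\xi,d\eta,\rho)=\frac1Z\,e^{\hat H(\xi,\eta,\rho)}\prod_{i\in\Lambda}\hat P_i(d\xi_i)\hat P_i(d\eta_i),$$ where $Z$ is the normalization. For $i\in\Lambda$, $k\in\{1,2\}$, $x\in[0,\beta)$ let $\gamma^x_{+,k,i}$ and $\gamma^x_{-,k,i}$ be the maps $\hat S\to\hat S$ that add the point $x$ to, respectively remove it from, $\xi_i$ (if $k=1$) or $\eta_i$ (if $k=2$), and let $\gamma_{0,i}$ be the map that changes the sign of $\rho_i$. Let $G$ be the set of all these maps, $\nabla_\gamma f=f\circ\gamma-f$, and let $c(\omega,d\gamma)$ be the measure on $G$ with $$\int l(\gamma)\,c(\omega,d\gamma)=\sum_{i}\sum_{k}\frac{\lambda_i}2\int_0^\beta e^{\nabla_{\gamma^x_{+,k,i}}\hat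 H(\omega)}\,l(\gamma^x_{+,k,i})\,dx+\sum_i\sum_{x\in\xi_i}l(\gamma^x_{-,1,i})+\sum_i\sum_{x\in\eta_i}l(\gamma^x_{-,2,i})+\sum_i e^{\frac12\nabla_{\gamma_{0,i}}\hat H(\omega)}\,l(\gamma_{0,i}).$$ Let $\mathcal Lf(\omega)=\int c(\omega,d\gamma)\,\nabla_\gamma f(\omega)$ for $f$ bounded and measurable. Then $\hat\pi$ is a probability measure and the following hold. (1) $\mathcal L$ is reversible with respect to $\hat\pi$. The action $(\omega,\gamma)\mapsto\gamma(\omega)$ and the rates $\omega\mapsto c(\omega,\cdot)$ are measurable. The map $\gamma\mapsto\gamma^{-1}$ on $G$ that exchanges $\gamma^x_{+,k,i}$ with $\gamma^x_{-,k,i}$ and fixes $\gamma_{0,i}$ is a measurable bijection, and for $\hat\pi(d\omega)c(\omega,d\gamma)$-almost every $(\omega,\gamma)$ the element $\gamma^{-1}$ is the unique $\delta\in G$ with $\delta(\gamma(\omega))=\omega$. For every measurable $\Psi:\hat S\times G\to[0,\infty]$, $$\int\Psi(\omega,\gamma)\,c(\omega,d\gamma)\hat\pi(d\omega)=\int\Psi(\gamma(\omega),\gamma^{-1})\,c(\omega,d\gamma)\hat\pi(d\omega).$$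 Moreover $\mathcal L$ maps bounded measurable functions into $L^2(\hat\pi)$, and its closure in $L^2(\hat\pi)$, again denoted by $\mathcal L$, is self-adjoint. (2) Let $\mathrm{gap}(\mathcal L)\in[0,\infty]$ be the supremum of all $k\in\mathbb R$ such that $k\,\mathrm{Var}_{\hat\pi}(f)\le-\hat\pi[f\,\mathcal Lf]$ for all $f$ in the domain of $\mathcal L$. Then $$\mathrm{gap}(\mathcal L)\ \ge\ e^{-2\beta C}-5\max(1,\beta\lambda)(2R)^d\left(e^{3\beta C}-1\right).$$ In particular the bound does not depend on $\Lambda$. -/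

import Mathlib

open MeasureTheory ProbabilityTheory Filter Topology
open scoped ENNReal

noncomputable section

/-! ## Jump generators on a general state space

`S` is the state space, `G` a set of moves acting on `S` through `act : G → S → S`, `inv` the
candidate inversion of moves, `c η` the measure of jump rates out of the state `η`, and `π` a
measure on `S`. -/

namespace JumpGen

variable {S G : Type*}

/-- `𝓛 f (η) = ∫ (f (γ η) - f η) c(η, dγ)`. -/
def gen [MeasurableSpace G] (act : G → S → S) (c : S → Measure G) (f : S → ℝ) (η : S) : ℝ :=
  ∫ γ, (f (act γ η) - f η) ∂(c η)

/-- Bounded measurable real functions. -/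
def BddMeas [MeasurableSpace S] (f : S → ℝ) : Prop :=
  Measurable f ∧ ∃ M : ℝ, ∀ η, |f η| ≤ M

/-- Reversibility: `γ⁻¹` is the unique move that undoes `γ`, almost surely with respect to
`π(dη) c(η, dγ)`; inversion is a measurable bijection; and detailed balance holds. The first two
fields are the measurability of the action and of the rates. -/
structure Reversible [MeasurableSpace S] [MeasurableSpace G]
    (act : G → S → S) (inv : G → G) (c : S → Measure G) (π : Measure S) : Prop where
  measurable_act : Measurable fun p : S × G => act p.2 p.1
  measurable_rates : Measurable c
  measurable_inv : Measurable inv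
  bijective_inv : Function.Bijective inv
  inv_unique : ∀ᵐ η ∂π, ∀ᵐ γ ∂(c η), ∀ δ : G, act δ (act γ η) = η ↔ δ = inv γ
  detailed_balance : ∀ Ψ : S × G → ℝ≥0∞, Measurable Ψ →
    ∫⁻ η, ∫⁻ γ, Ψ (η, γ) ∂(c η) ∂π = ∫⁻ η, ∫⁻ γ, Ψ (act γ η, inv γ) ∂(c η) ∂π

/-- The graph of the closure in `L²(π)` of an operator `L` given on bounded measurable functions:
`InGraph L π f g` says that `f` lies in the domain of the closure and that its image is `g`.
Bounded measurable functions are a core by construction. -/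
def InGraph [MeasurableSpace S] (L : (S → ℝ) → S → ℝ) (π : Measure S) (f g : S → ℝ) : Prop :=
  MemLp f 2 π ∧ MemLp g 2 π ∧ ∃ u : ℕ → S → ℝ, (∀ n, BddMeas (u n)) ∧
    Tendsto (fun n => eLpNorm (u n - f) 2 π) atTop (𝓝 0) ∧
    Tendsto (fun n => eLpNorm (L (u n) - g) 2 π) atTop (𝓝 0)

/-- `L` maps bounded measurable functions to `L²(π)` and its closure is self-adjoint: the graph
of the closure equals the graph of the adjoint. -/
def SelfAdjointClosure [MeasurableSpace S] (L : (S → ℝ) → S → ℝ) (π : Measure S) : Prop :=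
  (∀ u, BddMeas u → MemLp (L u) 2 π) ∧
  ∀ f g : S → ℝ, MemLp f 2 π → MemLp g 2 π →
    (InGraph L π f g ↔
      ∀ u v : S → ℝ, InGraph L π u v → ∫ η, f η * v η ∂π = ∫ η, g η * u η ∂π)

/-- The spectral gap: the supremum of the constants `k` in the Poincaré inequality
`k Var_π(f) ≤ -π(f 𝓛f)`, over all `f` in the domain of (the closure of) `L`. It is `⊤` when every
function has zero variance. -/
def gap [MeasurableSpace S] (L : (S → ℝ) → S → ℝ) (π : Measure S) : EReal :=
  sSup ((fun k : ℝ => (k : EReal)) ''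
    {k : ℝ | ∀ f g : S → ℝ, InGraph L π f g → k * variance f π ≤ -∫ η, f η * g η ∂π})

end JumpGen

/-! ## The lifted measure and its jump dynamics -/

namespace TransverseField

/-- Finite subsets of `[0, β)`. -/
@[ext]
structure Config (β : ℝ) where
  pts : Finset (Set.Ico (0 : ℝ) β)

/-- The usual σ-algebra on point configurations, generated by the numbers of points in Borel
sets. -/
instance (β : ℝ) : MeasurableSpace (Config β) :=
  ⨆ B : {B : Set (Set.Ico (0 : ℝ) β) // MeasurableSet B},
    MeasurableSpace.comap (fun v : Config β => ((v.pts : Set (Set.Ico (0 : ℝ) β)) ∩ B.1).ncard) ⊤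

/-- Lebesgue measure on `[0, β)`. -/
def leb (β : ℝ) : Measure (Set.Ico (0 : ℝ) β) :=
  Measure.comap (fun x : Set.Ico (0 : ℝ) β => (x : ℝ)) volume

/-- The law of the Poisson point process on `[0, β)` with intensity `a`, that is
`e^{-aβ} ∑ₙ aⁿ / n! ∫ 1{ {x₁, …, xₙ} ∈ · } dx₁ ⋯ dxₙ`. -/
def poisson (β a : ℝ) : Measure (Config β) :=
  ENNReal.ofReal (Real.exp (-(a * β))) • Measure.sum fun n : ℕ =>
    ENNReal.ofReal (a ^ n / n.factorial) •
      (Measure.pi fun _ : Fin n => leb β).map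
        fun x => (⟨Finset.univ.image x⟩ : Config β)

/-- One-site states `(v, w, s)`; the spin space `{-1, 1}` is `ℤˣ`. -/
abbrev Site (β : ℝ) := Config β × Config β × ℤˣ

/-- The coloring `[0, β) → {-1, 1}` encoded by `(v, w, s)`: it is constantly `s` if `v ∪ w` is
empty; otherwise points of `v` have label `1`, those of `w` label `-1`, the label of a point being
the left limit of the coloring there, so that the value at `t` is the label of the first point
after `t` on the circle. (Points of `v ∩ w`, which almost surely do not exist, get label `1`.) -/
def coloring {β : ℝ} (q : Site β) (t : ℝ) : ℤˣ :=
  if h : (q.1.pts ∪ q.2.1.pts).Nonempty then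
    let next : Set.Ico (0 : ℝ) β :=
      if h' : ((q.1.pts ∪ q.2.1.pts).filter fun x : Set.Ico (0 : ℝ) β => t < (x : ℝ)).Nonempty then
        ((q.1.pts ∪ q.2.1.pts).filter fun x : Set.Ico (0 : ℝ) β => t < (x : ℝ)).min' h'
      else (q.1.pts ∪ q.2.1.pts).min' h
    if next ∈ q.1.pts then 1 else -1
  else q.2.2

/-- The points of a one-site state: those of `v` for `k = 0`, those of `w` for `k = 1`. -/
def sitePts {β : ℝ} (k : Fin 2) (q : Site β) : Finset (Set.Ico (0 : ℝ) β) :=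
  if k = 0 then q.1.pts else q.2.1.pts

/-- Replace the points of kind `k` of a one-site state. -/
def setPts {β : ℝ} (k : Fin 2) (q : Site β) (A : Finset (Set.Ico (0 : ℝ) β)) : Site β :=
  if k = 0 then (⟨A⟩, q.2.1, q.2.2) else (q.1, ⟨A⟩, q.2.2)

variable {d : ℕ}

/-- The Euclidean distance on `ℤ^d`. -/
def latticeDist (i j : Fin d → ℤ) : ℝ := √(∑ k, ((i k : ℝ) - (j k : ℝ)) ^ 2)

/-- `∇ᵢ H (σ) = H (σⁱ) - H (σ)`, where `σⁱ` is `σ` with the spin at `i` flipped. -/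
def spinGrad {Λ : Finset (Fin d → ℤ)} (H : (Λ → ℤˣ) → ℝ) (i : Λ) (σ : Λ → ℤˣ) : ℝ :=
  H (Function.update σ i (-σ i)) - H σ

/-- The lifted space `(Σ × Σ × {-1, 1})^Λ`. -/
abbrev State (Λ : Finset (Fin d → ℤ)) (β : ℝ) := Λ → Site β

/-- `Ĥ(ω) = ∫₀^β H(σ(t)) dt`, with `σ` the coloring encoded by `ω`. -/
def energy {Λ : Finset (Fin d → ℤ)} {β : ℝ} (H : (Λ → ℤˣ) → ℝ) (ω : State Λ β) : ℝ :=
  ∫ t in (0 : ℝ)..β, H fun i => coloring (ω i) t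

/-- The unnormalized lifted measure. -/
def weight {Λ : Finset (Fin d → ℤ)} (β : ℝ) (H : (Λ → ℤˣ) → ℝ) (lam : Λ → ℝ) :
    Measure (State Λ β) :=
  (Measure.pi fun i : Λ =>
    (poisson β (lam i / 2)).prod ((poisson β (lam i / 2)).prod (Measure.count : Measure ℤˣ))
  ).withDensity fun ω => ENNReal.ofReal (Real.exp (energy H ω))

/-- The lifted probability measure `π̂`. -/
def liftedMeasure {Λ : Finset (Fin d → ℤ)} (β : ℝ) (H : (Λ → ℤˣ) → ℝ) (lam : Λ → ℝ) :
    Measure (State Λ β) :=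
  (weight β H lam Set.univ)⁻¹ • weight β H lam

/-- The moves: adding or removing a point `x` of kind `k` at the site `i`, and flipping the spin
`ρᵢ`. -/
inductive Move (Λ : Finset (Fin d → ℤ)) (β : ℝ)
  | add (k : Fin 2) (i : Λ) (x : Set.Ico (0 : ℝ) β) : Move Λ β
  | rem (k : Fin 2) (i : Λ) (x : Set.Ico (0 : ℝ) β) : Move Λ β
  | flip (i : Λ) : Move Λ β

/-- A set of moves is measurable iff for all `k`, `i` the sets of `x` with `add k i x`, resp.
`rem k i x`, in it are Borel. -/
instance (Λ : Finset (Fin d → ℤ)) (β : ℝ) : MeasurableSpace (Move Λ β) :=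
  ⨅ (k : Fin 2) (i : Λ),
    MeasurableSpace.map (Move.add k i) inferInstance ⊓
      MeasurableSpace.map (Move.rem k i) inferInstance

namespace Move

variable {Λ : Finset (Fin d → ℤ)} {β : ℝ}

/-- The action of the moves on the lifted space. -/
def act : Move Λ β → State Λ β → State Λ β
  | add k i x, ω => Function.update ω i (setPts k (ω i) (insert x (sitePts k (ω i))))
  | rem k i x, ω => Function.update ω i (setPts k (ω i) ((sitePts k (ω i)).erase x))
  | flip i, ω => Function.update ω i ((ω i).1, (ω i).2.1, -(ω i).2.2)

/-- Inversion of moves. -/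
def inv : Move Λ β → Move Λ β
  | add k i x => rem k i x
  | rem k i x => add k i x
  | flip i => flip i

end Move

/-- The jump rates: a point `x` of kind `k` is added at `i` at rate
`(λᵢ / 2) exp(Ĥ(γω) - Ĥ(ω)) dx`, every point is removed at rate `1`, and `ρᵢ` is flipped at rate
`exp((Ĥ(γω) - Ĥ(ω)) / 2)`. -/
def rates {Λ : Finset (Fin d → ℤ)} (β : ℝ) (H : (Λ → ℤˣ) → ℝ) (lam : Λ → ℝ) (ω : State Λ β) :
    Measure (Move Λ β) :=
  (∑ i : Λ, ∑ k : Fin 2, ENNReal.ofReal (lam i / 2) •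
    ((leb β).withDensity fun x =>
      ENNReal.ofReal (Real.exp (energy H ((Move.add k i x).act ω) - energy H ω))).map
        (Move.add k i)) +
  (∑ i : Λ, ∑ k : Fin 2, ∑ x ∈ sitePts k (ω i), Measure.dirac (Move.rem k i x)) +
  ∑ i : Λ, ENNReal.ofReal (Real.exp ((energy H ((Move.flip i).act ω) - energy H ω) / 2)) •
    Measure.dirac (Move.flip i)

/-- The generator of the jump dynamics. -/
def generator {Λ : Finset (Fin d → ℤ)} (β : ℝ) (H : (Λ → ℤˣ) → ℝ) (lam : Λ → ℝ) :
    (State Λ β → ℝ) → State Λ β → ℝ :=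
  JumpGen.gen Move.act (rates β H lam)

end TransverseField

end

set_option linter.unusedSectionVars false

open MeasureTheory ProbabilityTheory Filter Topology
open scoped ENNReal

noncomputable section

/-! Reversibility is a one-site computation. The weight `e^Ĥ` times the rate of adding a point is
`e^Ĥ` at the new state, so the Mecke formula for Poisson processes balances additions against
removals. The weight times the flip rate is the geometric mean of the weights of the two states,
hence symmetric.

For self-adjointness, `L` is symmetric and nonpositive on bounded functions, so it suffices that `1
- L` has dense range. If `f` is orthogonal to the range, testing with `χₙ² f`, where `χₙ` cuts off
at about `n` points, gives `∫ χₙ² f² ≤ O(1/n) ∫ f²`. The reason is that the total rate grows at most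
linearly in the number of points while `χₙ` changes by at most `1/n` in one jump
(`integral_cutoff_sq_le`, `mem_closure_of_adjoint`).

For the gap, the free dynamics at one site satisfies a Poincaré inequality with constant `1` for
every intensity (`siteRef_poincare`). It comes from the Poincaré inequality on the discrete cube:
two independent Poisson processes of equal intensity are one process whose points are labelled by
fair coins. With all other sites frozen, `Ĥ` varies by at most `βC`, so a Holley–Stroock comparison
bounds the conditional variance at a site by `e^{βC}` times the Dirichlet form at that site
(`lintegral_sub_siteAvg_sq_le`).

Dobrushin's argument combines the sites. The conditional law at `i` depends on the state at `j` with
strength at most `(e^{2βC} - 1)/2` if `|i - j| ≤ R`, and not at all otherwise, and at most `15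
(2R)^d` sites `j ≠ i` are that close. With `α` the product of these two numbers, averaging a
uniformly chosen site conditionally on the others contracts total oscillations by `1 - (1 - α)/|Λ|`.
By symmetry this sup-norm rate is also an `L²` rate, so `(1 - α) Var` is at most the sum of the
conditional variances (`DobrushinSystem.variance_le`). Hence the gap is at least `e^{-βC} (1 - α)`,
and an elementary inequality compares this with the asserted bound (`gap_bound_le`). -/

/-- A kernel of finite measures, whose total masses may be unbounded, is s-finite. -/
theorem isSFiniteKernel_of_forall_isFiniteMeasure {α β : Type*} [MeasurableSpace α]
    [MeasurableSpace β] (κ : Kernel α β) (h : ∀ a, κ a Set.univ < ∞) : IsSFiniteKernel κ := by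
  classical
  -- The state space is sliced by the integer part of the total mass. On the `n`-th slice the mass
  -- is at most `n + 1`, so the kernel restricted to it is a finite kernel, and the kernel is the
  -- sum of these pieces.
  let A : ℕ → Set α := fun n => {a | (n : ℝ≥0∞) ≤ κ a Set.univ ∧ κ a Set.univ < n + 1}
  have hA : ∀ n, MeasurableSet (A n) := fun n =>
    (measurableSet_le measurable_const (κ.measurable_coe .univ)).inter
      (measurableSet_lt (κ.measurable_coe .univ) measurable_const)
  have hex : ∀ a, ∃! n, a ∈ A n := by
    intro a
    have hne := (h a).ne
    refine ⟨⌊(κ a Set.univ).toReal⌋₊, ?_, ?_⟩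
    · constructor
      · rw [← ENNReal.ofReal_toReal hne, ← ENNReal.ofReal_natCast]
        refine ENNReal.ofReal_le_ofReal ?_
        simpa [ENNReal.ofReal_toReal hne] using Nat.floor_le (ENNReal.toReal_nonneg (a := κ a Set.univ))
      · have := Nat.lt_floor_add_one (κ a Set.univ).toReal
        rw [← ENNReal.ofReal_toReal hne]
        have h2 : ((⌊(κ a Set.univ).toReal⌋₊ : ℝ≥0∞) + 1) =
            ENNReal.ofReal ((⌊(κ a Set.univ).toReal⌋₊ : ℝ) + 1) := by
          rw [ENNReal.ofReal_add (by positivity) (by norm_num)]; simp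
        rw [ENNReal.ofReal_toReal hne, h2]
        exact (ENNReal.lt_ofReal_iff_toReal_lt hne).2 this
    · rintro n ⟨h1, h2⟩
      symm
      rw [Nat.floor_eq_iff ENNReal.toReal_nonneg]
      constructor
      · simpa using ENNReal.toReal_mono hne h1
      · have := (ENNReal.toReal_lt_toReal hne (by simp)).2 h2
        rwa [ENNReal.toReal_add (by simp) (by simp)] at this
  refine ⟨⟨fun n => Kernel.piecewise (hA n) κ 0, fun n => ⟨⟨n + 1, by simp, ?_⟩⟩, ?_⟩⟩
  · intro a
    rw [Kernel.piecewise_apply]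
    split_ifs with ha
    · exact ha.2.le
    · simp
  · ext a s hs
    rw [Kernel.sum_apply' _ _ hs]
    obtain ⟨n, hn, hu⟩ := hex a
    rw [tsum_eq_single n]
    · rw [Kernel.piecewise_apply, if_pos hn]
    · intro m hm
      rw [Kernel.piecewise_apply, if_neg fun h' => hm (hu m h')]
      simp

/-! ### Symmetric forms of reversible jump generators with linearly growing rates -/

namespace JumpGen

variable {S G : Type*} [MeasurableSpace S] [MeasurableSpace G]
  {act : G → S → S} {inv : G → G} {c : S → Measure G} {π : Measure S}

theorem BddMeas.memLp [IsFiniteMeasure π] {u : S → ℝ} (hu : BddMeas u) (p : ℝ≥0∞) :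
    MemLp u p π := by
  obtain ⟨M, hM⟩ := hu.2
  exact MemLp.of_bound hu.1.aestronglyMeasurable M (Eventually.of_forall hM)

theorem BddMeas.add {u v : S → ℝ} (hu : BddMeas u) (hv : BddMeas v) : BddMeas (u + v) := by
  obtain ⟨M, hM⟩ := hu.2
  obtain ⟨M', hM'⟩ := hv.2
  exact ⟨hu.1.add hv.1, M + M', fun η => (abs_add_le _ _).trans (add_le_add (hM η) (hM' η))⟩

theorem BddMeas.const_smul {u : S → ℝ} (hu : BddMeas u) (a : ℝ) : BddMeas (a • u) := by
  obtain ⟨M, hM⟩ := hu.2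
  refine ⟨hu.1.const_smul a, |a| * M, fun η => ?_⟩
  simp only [Pi.smul_apply, smul_eq_mul, abs_mul]
  exact mul_le_mul_of_nonneg_left (hM η) (abs_nonneg _)

/-- A reversible system of rates whose total mass grows at most linearly in a square integrable
function `N` that every move changes by at most one. -/
structure LinearGrowth (act : G → S → S) (inv : G → G) (c : S → Measure G) (π : Measure S)
    (N : S → ℝ) (K : ℝ) : Prop where
  rev : Reversible act inv c π
  measurable_size : Measurable N
  size_nonneg : ∀ η, 0 ≤ N η
  const_nonneg : 0 ≤ K
  rate_le : ∀ η, c η Set.univ ≤ ENNReal.ofReal (K * (1 + N η))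
  step_le : ∀ γ η, |N (act γ η) - N η| ≤ 1
  memLp_size : MemLp N 2 π

namespace LinearGrowth

variable {N : S → ℝ} {K : ℝ} (h : LinearGrowth act inv c π N K)

include h

def kernel : Kernel S G := ⟨c, h.rev.measurable_rates⟩

theorem kernel_apply (η : S) : h.kernel η = c η := rfl

theorem rate_lt_top (η : S) : c η Set.univ < ∞ := (h.rate_le η).trans_lt ENNReal.ofReal_lt_top

theorem isFiniteMeasure_rate (η : S) : IsFiniteMeasure (c η) := ⟨h.rate_lt_top η⟩

theorem isSFiniteKernel : IsSFiniteKernel h.kernel :=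
  isSFiniteKernel_of_forall_isFiniteMeasure _ h.rate_lt_top

/-- The measure `π(dη) c(η, dγ)`. -/
def joint : Measure (S × G) := π ⊗ₘ h.kernel

/-- `(η, γ) ↦ (γ η, γ⁻¹)`. -/
def swap (_ : LinearGrowth act inv c π N K) (p : S × G) : S × G := (act p.2 p.1, inv p.2)

theorem measurable_swap : Measurable h.swap :=
  h.rev.measurable_act.prodMk (h.rev.measurable_inv.comp measurable_snd)

variable [IsProbabilityMeasure π]

theorem lintegral_joint {F : S × G → ℝ≥0∞} (hF : Measurable F) :
    ∫⁻ p, F p ∂h.joint = ∫⁻ η, ∫⁻ γ, F (η, γ) ∂(c η) ∂π := by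
  have := h.isSFiniteKernel
  exact Measure.lintegral_compProd hF

/-- This is detailed balance in the form used below: an integral over pairs (state, jump) is
unchanged when every jump is replaced by its reversal. -/
theorem measurePreserving_swap : MeasurePreserving h.swap h.joint h.joint := by
  refine ⟨h.measurable_swap, ?_⟩
  refine Measure.ext_of_lintegral _ fun F hF => ?_
  rw [lintegral_map hF h.measurable_swap,
    h.lintegral_joint (F := fun p => F (h.swap p)) (hF.comp h.measurable_swap),
    h.lintegral_joint hF]
  exact (h.rev.detailed_balance F hF).symm

theorem integral_joint_swap {F : S × G → ℝ} (hF : Measurable F) :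
    ∫ p, F (h.swap p) ∂h.joint = ∫ p, F p ∂h.joint := by
  have := integral_map (μ := h.joint) h.measurable_swap.aemeasurable
    (f := F) hF.aestronglyMeasurable
  rw [h.measurePreserving_swap.map_eq] at this
  exact this.symm

theorem ae_joint_of_ae {p : S × G → Prop} (hp : MeasurableSet {x | p x})
    (hae : ∀ᵐ η ∂π, ∀ᵐ γ ∂(c η), p (η, γ)) : ∀ᵐ x ∂h.joint, p x := by
  have := h.isSFiniteKernel
  exact (Measure.ae_compProd_iff hp).2 hae

/-- A measurable function bounded by an integrable function of the starting point, weighted with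
the total rate, is integrable with respect to `π(dη) c(η, dγ)`. -/
theorem integrable_joint {F : S × G → ℝ} (hF : Measurable F) {A : S → ℝ}
    (hFA : ∀ η γ, |F (η, γ)| ≤ A η) (hA : Integrable (fun η => A η * (1 + N η)) π) :
    Integrable F h.joint := by
  refine ⟨hF.aestronglyMeasurable, ?_⟩
  rw [HasFiniteIntegral, h.lintegral_joint hF.enorm]
  calc ∫⁻ η, ∫⁻ γ, ‖F (η, γ)‖ₑ ∂(c η) ∂π
      ≤ ∫⁻ η, ENNReal.ofReal K * ‖A η * (1 + N η)‖ₑ ∂π := by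
        refine lintegral_mono fun η => ?_
        calc ∫⁻ γ, ‖F (η, γ)‖ₑ ∂(c η) ≤ ∫⁻ _, ‖A η‖ₑ ∂(c η) := by
              refine lintegral_mono fun γ => ?_
              exact enorm_le_iff_norm_le.2 ((hFA η γ).trans (le_abs_self _))
          _ = ‖A η‖ₑ * c η Set.univ := lintegral_const _
          _ ≤ ‖A η‖ₑ * ENNReal.ofReal (K * (1 + N η)) := by gcongr; exact h.rate_le η
          _ = _ := by
            have h1 : 0 ≤ 1 + N η := by linarith [h.size_nonneg η]
            rw [enorm_mul, ENNReal.ofReal_mul h.const_nonneg, ← Real.enorm_of_nonneg h1]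
            ring
    _ = ENNReal.ofReal K * ∫⁻ η, ‖A η * (1 + N η)‖ₑ ∂π := lintegral_const_mul' _ _ (by simp)
    _ < ∞ := ENNReal.mul_lt_top (by simp) hA.2

theorem memLp_one_add_size : MemLp (fun η => 1 + N η) 2 π :=
  MemLp.add (memLp_const (1 : ℝ)) h.memLp_size

theorem measurable_grad {f : S → ℝ} (hf : Measurable f) :
    Measurable fun p : S × G => f (act p.2 p.1) - f p.1 :=
  (hf.comp h.rev.measurable_act).sub (hf.comp measurable_fst)

theorem integrable_mul_grad {f u : S → ℝ} (hf : Measurable f) (hf2 : MemLp f 2 π)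
    (hu : BddMeas u) :
    Integrable (fun p : S × G => f p.1 * (u (act p.2 p.1) - u p.1)) h.joint := by
  obtain ⟨M, hM⟩ := hu.2
  refine h.integrable_joint ((hf.comp measurable_fst).mul (h.measurable_grad hu.1))
    (A := fun η => |f η| * (2 * M)) (fun η γ => ?_) ?_
  · rw [abs_mul]
    refine mul_le_mul_of_nonneg_left ?_ (abs_nonneg _)
    calc _ ≤ |u (act γ η)| + |u η| := abs_sub _ _
      _ ≤ _ := by linarith [hM (act γ η), hM η]
  · have := (MemLp.integrable_mul hf2.abs h.memLp_one_add_size).const_mul (2 * M)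
    refine this.congr (Eventually.of_forall fun η => ?_)
    simp only [Pi.mul_apply, Pi.abs_apply]; ring

theorem integrable_rate_grad {u : S → ℝ} (hu : BddMeas u) (η : S) :
    Integrable (fun γ => u (act γ η) - u η) (c η) := by
  have := h.isFiniteMeasure_rate η
  obtain ⟨M, hM⟩ := hu.2
  refine Integrable.of_bound
    ((h.measurable_grad hu.1).comp measurable_prodMk_left).aestronglyMeasurable (2 * M)
    (Eventually.of_forall fun γ => ?_)
  calc _ ≤ |u (act γ η)| + |u η| := abs_sub _ _
    _ ≤ _ := by linarith [hM (act γ η), hM η]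

theorem measurable_gen {u : S → ℝ} (hu : BddMeas u) : Measurable (gen act c u) := by
  have := h.isSFiniteKernel
  exact (StronglyMeasurable.integral_kernel_prod_right (κ := h.kernel)
    (f := fun η γ => u (act γ η) - u η) (h.measurable_grad hu.1).stronglyMeasurable).measurable

/-- If `|u| ≤ M` then `|Lu| ≤ 2MK(1 + N)`, and `N` is square integrable. -/
theorem memLp_gen {u : S → ℝ} (hu : BddMeas u) : MemLp (gen act c u) 2 π := by
  obtain ⟨M, hM⟩ := hu.2
  refine MemLp.mono (h.memLp_one_add_size.const_mul (2 * M * K))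
    (h.measurable_gen hu).aestronglyMeasurable (Eventually.of_forall fun η => ?_)
  have := h.isFiniteMeasure_rate η
  have hM0 : 0 ≤ M := (abs_nonneg _).trans (hM η)
  have h1 : 0 ≤ 1 + N η := by linarith [h.size_nonneg η]
  calc ‖gen act c u η‖ ≤ 2 * M * (c η).real Set.univ :=
        norm_integral_le_of_norm_le_const (Eventually.of_forall fun γ => by
          calc _ ≤ |u (act γ η)| + |u η| := abs_sub _ _
            _ ≤ _ := by linarith [hM (act γ η), hM η])
    _ ≤ 2 * M * (K * (1 + N η)) := by
        gcongr
        exact ENNReal.toReal_le_of_le_ofReal (mul_nonneg h.const_nonneg h1) (h.rate_le η)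
    _ ≤ _ := by
        rw [← mul_assoc]; exact le_abs_self _

theorem gen_add {u v : S → ℝ} (hu : BddMeas u) (hv : BddMeas v) :
    gen act c (u + v) = gen act c u + gen act c v := by
  ext η
  simp only [gen, Pi.add_apply]
  rw [← integral_add (h.integrable_rate_grad hu η) (h.integrable_rate_grad hv η)]
  congr 1; ext γ; ring

omit h [MeasurableSpace S] [IsProbabilityMeasure π] in
theorem gen_const_smul (a : ℝ) (u : S → ℝ) : gen act c (a • u) = a • gen act c u := by
  ext η
  simp only [gen, Pi.smul_apply, smul_eq_mul]
  rw [← integral_const_mul]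
  congr 1; ext γ; ring

theorem integral_mul_gen_eq_joint {f u : S → ℝ} (hf : Measurable f) (hf2 : MemLp f 2 π)
    (hu : BddMeas u) :
    ∫ η, f η * gen act c u η ∂π =
      ∫ p, f p.1 * (u (act p.2 p.1) - u p.1) ∂h.joint := by
  have := h.isSFiniteKernel
  have h2 := Measure.integral_compProd (h.integrable_mul_grad hf hf2 hu)
  rw [joint, h2]
  congr 1; ext η
  simp only [h.kernel_apply, gen]
  rw [integral_const_mul]

/-- The identity is tested through a real function `f` because the set where two maps into a general
measurable space agree need not be measurable. -/
theorem ae_act_inv {f : S → ℝ} (hf : Measurable f) :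
    ∀ᵐ p ∂h.joint, f (act (inv p.2) (act p.2 p.1)) = f p.1 := by
  refine h.ae_joint_of_ae (p := fun p => f (act (inv p.2) (act p.2 p.1)) = f p.1) ?_ ?_
  · exact measurableSet_eq_fun (hf.comp (h.rev.measurable_act.comp h.measurable_swap))
      (hf.comp measurable_fst)
  · filter_upwards [h.rev.inv_unique] with η hη
    filter_upwards [hη] with γ hγ
    rw [(hγ (inv γ)).2 rfl]

/-- The symmetric form of the generator, with an unbounded first argument. -/
theorem integral_mul_gen {f u : S → ℝ} (hf : Measurable f) (hf2 : MemLp f 2 π)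
    (hu : BddMeas u) :
    ∫ η, f η * gen act c u η ∂π =
      -(1 / 2) * ∫ p, (f (act p.2 p.1) - f p.1) * (u (act p.2 p.1) - u p.1) ∂h.joint := by
  set F : S × G → ℝ := fun p => f p.1 * (u (act p.2 p.1) - u p.1) with hF
  have hFm : Measurable F := (hf.comp measurable_fst).mul (h.measurable_grad hu.1)
  have hFi : Integrable F h.joint := h.integrable_mul_grad hf hf2 hu
  have hFi' : Integrable (fun p => F (h.swap p)) h.joint :=
    (h.measurePreserving_swap.integrable_comp hFm.aestronglyMeasurable).2 hFi
  -- Reversing a jump turns `F = f(η)(u(γη) - u(η))` into `f(γη)(u(η) - u(γη))`, because `γ⁻¹`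
  -- undoes `γ` almost surely. The sum of the two is minus the product of the gradients.
  have key : (fun p : S × G => (f (act p.2 p.1) - f p.1) * (u (act p.2 p.1) - u p.1))
      =ᵐ[h.joint] fun p => -(F (h.swap p) + F p) := by
    filter_upwards [h.ae_act_inv hu.1] with p hp
    simp only [hF, swap, hp]; ring
  rw [h.integral_mul_gen_eq_joint hf hf2 hu, integral_congr_ae key, integral_neg,
    integral_add hFi' hFi, h.integral_joint_swap hFm]
  ring

theorem integral_mul_gen_comm {u v : S → ℝ} (hu : BddMeas u) (hv : BddMeas v) :
    ∫ η, u η * gen act c v η ∂π = ∫ η, gen act c u η * v η ∂π := by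
  simp_rw [mul_comm (gen act c u _)]
  rw [h.integral_mul_gen hu.1 (hu.memLp 2) hv, h.integral_mul_gen hv.1 (hv.memLp 2) hu]
  simp_rw [mul_comm]

theorem integral_mul_gen_nonpos {u : S → ℝ} (hu : BddMeas u) :
    ∫ η, u η * gen act c u η ∂π ≤ 0 := by
  rw [h.integral_mul_gen hu.1 (hu.memLp 2) hu]
  have : 0 ≤ ∫ p, (u (act p.2 p.1) - u p.1) * (u (act p.2 p.1) - u p.1) ∂h.joint :=
    integral_nonneg fun p => mul_self_nonneg _
  linarith

/-- The cutoff function, equal to `1` where `N ≤ n` and to `0` where `N ≥ 2 n`. -/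
def cutoff (_ : LinearGrowth act inv c π N K) (n : ℕ) (η : S) : ℝ :=
  max 0 (min 1 (2 - N η / n))

theorem measurable_cutoff (n : ℕ) : Measurable (h.cutoff n) :=
  measurable_const.max (measurable_const.min (measurable_const.sub
    (h.measurable_size.div_const _)))

theorem cutoff_nonneg (n : ℕ) (η : S) : 0 ≤ h.cutoff n η := le_max_left _ _

theorem cutoff_le_one (n : ℕ) (η : S) : h.cutoff n η ≤ 1 :=
  max_le zero_le_one (min_le_left _ _)

theorem cutoff_eq_zero {n : ℕ} (hn : 0 < n) {η : S} (hη : 2 * (n : ℝ) ≤ N η) :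
    h.cutoff n η = 0 := by
  have : (0 : ℝ) < n := by exact_mod_cast hn
  have h2 : 2 ≤ N η / n := (le_div_iff₀ this).2 hη
  exact max_eq_left ((min_le_right _ _).trans (by linarith))

theorem cutoff_eq_one {n : ℕ} (hn : 0 < n) {η : S} (hη : N η ≤ n) : h.cutoff n η = 1 := by
  have : (0 : ℝ) < n := by exact_mod_cast hn
  have h2 : N η / n ≤ 1 := (div_le_one this).2 hη
  rw [cutoff, min_eq_left (by linarith), max_eq_right zero_le_one]

theorem abs_cutoff_sub_le {n : ℕ} (hn : 0 < n) (γ : G) (η : S) :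
    |h.cutoff n (act γ η) - h.cutoff n η| ≤ 1 / n := by
  have h0 : (0 : ℝ) < n := by exact_mod_cast hn
  have h1 := h.step_le γ η
  calc |h.cutoff n (act γ η) - h.cutoff n η|
      ≤ |min 1 (2 - N (act γ η) / n) - min 1 (2 - N η / n)| :=
        (abs_max_sub_max_le_max _ _ _ _).trans (by simp)
    _ ≤ |(2 - N (act γ η) / n) - (2 - N η / n)| :=
        (abs_min_sub_min_le_max _ _ _ _).trans (by simp)
    _ = |N (act γ η) - N η| / n := by
        rw [← abs_neg, ← abs_of_pos h0, ← abs_div, abs_of_pos h0]; congr 1; ring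
    _ ≤ 1 / n := by gcongr

end LinearGrowth
end JumpGen

/-! ### The cutoff argument: the range of `1 - L` is dense -/

namespace JumpGen

variable {S G : Type*} [MeasurableSpace S] [MeasurableSpace G]
  {act : G → S → S} {inv : G → G} {c : S → Measure G} {π : Measure S}

namespace LinearGrowth

variable {N : S → ℝ} {K : ℝ} (h : LinearGrowth act inv c π N K)

include h

variable [IsProbabilityMeasure π]

/-- For `f` in `L²` nothing makes `f²` integrable against the unbounded total rate. On `N ≤ M` that
rate is at most `K (1 + M)`. -/
theorem integrable_sq_indicator_joint {f : S → ℝ} (hf : Measurable f) (hf2 : MemLp f 2 π)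
    (M : ℝ) :
    Integrable (fun p : S × G => {η | N η ≤ M}.indicator (fun η => f η ^ 2) p.1) h.joint := by
  have hm : Measurable ({η | N η ≤ M}.indicator fun η => f η ^ 2) :=
    (hf.pow_const 2).indicator (measurableSet_le h.measurable_size measurable_const)
  refine h.integrable_joint (hm.comp measurable_fst)
    (A := {η | N η ≤ M}.indicator fun η => f η ^ 2) (fun η γ => ?_) ?_
  · rw [abs_of_nonneg]
    exact Set.indicator_nonneg (fun _ _ => sq_nonneg _) _
  · refine Integrable.mono' (hf2.integrable_sq.mul_const (1 + |M|))
      (hm.mul (measurable_const.add h.measurable_size)).aestronglyMeasurable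
      (Eventually.of_forall fun η => ?_)
    have h0 := h.size_nonneg η
    by_cases hη : N η ≤ M
    · rw [Set.indicator_of_mem (by exact hη), Real.norm_eq_abs, abs_of_nonneg (by positivity)]
      have := hη.trans (le_abs_self M)
      gcongr
    · rw [Set.indicator_of_notMem (by exact hη)]
      simp; positivity

theorem integral_sq_indicator_joint_le {f : S → ℝ} (hf : Measurable f) (hf2 : MemLp f 2 π)
    {M : ℝ} (hM : 0 ≤ M) :
    ∫ p, {η | N η ≤ M}.indicator (fun η => f η ^ 2) p.1 ∂h.joint ≤
      K * (1 + M) * ∫ η, f η ^ 2 ∂π := by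
  have := h.isSFiniteKernel
  rw [joint, Measure.integral_compProd (h.integrable_sq_indicator_joint hf hf2 M),
    ← integral_const_mul]
  refine integral_mono_of_nonneg (Eventually.of_forall fun η => integral_nonneg fun γ =>
    Set.indicator_nonneg (fun _ _ => sq_nonneg _) _) (hf2.integrable_sq.const_mul _)
    (Eventually.of_forall fun η => ?_)
  have h0 := h.size_nonneg η
  have hK := h.const_nonneg
  simp only [h.kernel_apply, integral_const, smul_eq_mul]
  have hr : (c η).real Set.univ ≤ K * (1 + N η) :=
    ENNReal.toReal_le_of_le_ofReal (by positivity) (h.rate_le η)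
  by_cases hη : N η ≤ M
  · rw [Set.indicator_of_mem (by exact hη)]
    gcongr
    exact hr.trans (by gcongr)
  · rw [Set.indicator_of_notMem (by exact hη)]
    simp; positivity

/-- The bound on the truncation of a function orthogonal to the range of `1 - L`. -/
theorem integral_cutoff_sq_le {f : S → ℝ} (hf : Measurable f) (hf2 : MemLp f 2 π)
    (hort : ∀ u, BddMeas u → ∫ η, f η * u η ∂π = ∫ η, f η * gen act c u η ∂π)
    {n : ℕ} (hn : 0 < n) :
    ∫ η, h.cutoff n η ^ 2 * f η ^ 2 ∂π ≤
      K * (1 + (2 * n + 1)) / (2 * n ^ 2) * ∫ η, f η ^ 2 ∂π := by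
  have hn0 : (0 : ℝ) < n := by exact_mod_cast hn
  set χ := h.cutoff n with hχ
  -- The bound `2n + 1` instead of `2n` leaves room for one jump: if one end of a jump has `N > 2n +
  -- 1`, the other still has `N > 2n`.
  set D : S → ℝ := {η | N η ≤ 2 * n + 1}.indicator (fun η => f η ^ 2) with hD
  have hDm : Measurable D :=
    (hf.pow_const 2).indicator (measurableSet_le h.measurable_size measurable_const)
  have hD1 : Integrable (fun p : S × G => D p.1) h.joint :=
    h.integrable_sq_indicator_joint hf hf2 _
  have hD2 : Integrable (fun p : S × G => D (act p.2 p.1)) h.joint :=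
    (h.measurePreserving_swap.integrable_comp
      (g := fun p : S × G => D p.1) (hDm.comp measurable_fst).aestronglyMeasurable).2 hD1
  have hD2' : ∫ p, D (act p.2 p.1) ∂h.joint = ∫ p, D p.1 ∂h.joint :=
    h.integral_joint_swap (F := fun p : S × G => D p.1) (hDm.comp measurable_fst)
  have hD0 : ∀ η, 0 ≤ D η := fun η => Set.indicator_nonneg (fun _ _ => sq_nonneg _) _
  -- away from the region where `D = f²` both cutoffs vanish
  have hcase : ∀ p : S × G, (χ (act p.2 p.1) = 0 ∧ χ p.1 = 0) ∨
      (D (act p.2 p.1) = f (act p.2 p.1) ^ 2 ∧ D p.1 = f p.1 ^ 2) := by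
    intro p
    have hst := abs_le.1 (h.step_le p.2 p.1)
    by_cases h1 : N p.1 ≤ 2 * n + 1
    · by_cases h2 : N (act p.2 p.1) ≤ 2 * n + 1
      · exact Or.inr ⟨Set.indicator_of_mem (by exact h2) _, Set.indicator_of_mem (by exact h1) _⟩
      · push Not at h2
        exact Or.inl ⟨h.cutoff_eq_zero hn (by linarith), h.cutoff_eq_zero hn (by linarith)⟩
    · push Not at h1
      exact Or.inl ⟨h.cutoff_eq_zero hn (by linarith), h.cutoff_eq_zero hn (by linarith)⟩
  -- The test function `χ² f` is not bounded, so it is not admissible in `hort`. The values of `f`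
  -- are clamped to `[-m, m]`, and `m → ∞` by dominated convergence on both sides, with dominating
  -- functions `f²` and `2D(γη) + 2D(η)`.
  let cl : ℕ → ℝ → ℝ := fun m x => max (-m) (min x m)
  have hcl : ∀ m x, |cl m x| ≤ |x| := by
    intro m x
    have : (0 : ℝ) ≤ m := by positivity
    simp only [cl]
    rw [abs_le]
    constructor
    · rcases le_total x m with hx | hx
      · rw [min_eq_left hx]; exact (neg_abs_le x).trans (le_max_right _ _)
      · rw [min_eq_right hx]; exact (by linarith [abs_nonneg x] : -|x| ≤ m).trans (le_max_right _ _)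
    · exact max_le (by linarith [abs_nonneg x]) ((min_le_left _ _).trans (le_abs_self x))
  have hclm : ∀ m x, |cl m x| ≤ m := by
    intro m x
    have : (0 : ℝ) ≤ m := by positivity
    exact abs_le.2 ⟨le_max_left _ _, max_le (by linarith) (min_le_right _ _)⟩
  have hclim : ∀ x, Tendsto (fun m => cl m x) atTop (𝓝 x) := by
    intro x
    obtain ⟨m₀, hm₀⟩ := exists_nat_ge |x|
    refine tendsto_const_nhds.congr' ?_
    filter_upwards [eventually_ge_atTop m₀] with m hm
    have hm' : |x| ≤ m := hm₀.trans (by exact_mod_cast hm)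
    obtain ⟨h1, h2⟩ := abs_le.1 hm'
    simp only [cl]
    rw [min_eq_left h2, max_eq_right h1]
  have hclmeas : ∀ m, Measurable (cl m) := fun m =>
    measurable_const.max (measurable_id.min measurable_const)
  set u : ℕ → S → ℝ := fun m η => χ η ^ 2 * cl m (f η) with hu
  have hub : ∀ m, BddMeas (u m) := by
    intro m
    refine ⟨((h.measurable_cutoff n).pow_const 2).mul ((hclmeas m).comp hf), m, fun η => ?_⟩
    rw [hu]; simp only
    rw [abs_mul, abs_of_nonneg (sq_nonneg _)]
    have h1 : χ η ^ 2 ≤ 1 := pow_le_one₀ (h.cutoff_nonneg n η) (h.cutoff_le_one n η)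
    exact (mul_le_of_le_one_left (abs_nonneg _) h1).trans (hclm m _)
  have hχ1 : ∀ η, χ η ^ 2 ≤ 1 := fun η =>
    pow_le_one₀ (h.cutoff_nonneg n η) (h.cutoff_le_one n η)
  have lim1 : Tendsto (fun m => ∫ η, f η * u m η ∂π) atTop (𝓝 (∫ η, f η * (χ η ^ 2 * f η) ∂π)) := by
    refine tendsto_integral_of_dominated_convergence (fun η => f η ^ 2)
      (fun m => (hf.mul (hub m).1).aestronglyMeasurable) hf2.integrable_sq
      (fun m => Eventually.of_forall fun η => ?_) (Eventually.of_forall fun η => ?_)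
    · rw [hu]; simp only
      rw [Real.norm_eq_abs, abs_mul, abs_mul, abs_of_nonneg (sq_nonneg (χ η)),
        sq (f η), ← abs_mul_abs_self (f η)]
      refine mul_le_mul_of_nonneg_left ?_ (abs_nonneg (f η))
      exact (mul_le_of_le_one_left (abs_nonneg _) (hχ1 η)).trans (hcl m _)
    · exact ((hclim (f η)).const_mul _).const_mul _
  have lim2 : Tendsto (fun m => ∫ p : S × G,
      (f (act p.2 p.1) - f p.1) * (u m (act p.2 p.1) - u m p.1) ∂h.joint) atTop
      (𝓝 (∫ p : S × G, (f (act p.2 p.1) - f p.1) *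
        (χ (act p.2 p.1) ^ 2 * f (act p.2 p.1) - χ p.1 ^ 2 * f p.1) ∂h.joint)) := by
    refine tendsto_integral_of_dominated_convergence
      (fun p => 2 * D (act p.2 p.1) + 2 * D p.1)
      (fun m => ((h.measurable_grad hf).mul (h.measurable_grad (hub m).1)).aestronglyMeasurable)
      ((hD2.const_mul 2).add (hD1.const_mul 2))
      (fun m => Eventually.of_forall fun p => ?_) (Eventually.of_forall fun p => ?_)
    · rcases hcase p with ⟨h1, h2⟩ | ⟨h1, h2⟩
      · have := hD0 (act p.2 p.1)
        have := hD0 p.1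
        simp only [hu, h1, h2]
        simp; positivity
      · rw [h1, h2, Real.norm_eq_abs, abs_mul]
        set a := f (act p.2 p.1)
        set b := f p.1
        have e1 : |a - b| ≤ |a| + |b| := abs_sub _ _
        have e2 : |u m (act p.2 p.1) - u m p.1| ≤ |a| + |b| := by
          refine (abs_sub _ _).trans (add_le_add ?_ ?_) <;>
          · simp only [hu]
            rw [abs_mul, abs_of_nonneg (sq_nonneg _)]
            exact (mul_le_of_le_one_left (abs_nonneg _) (hχ1 _)).trans (hcl m _)
        calc |a - b| * |u m (act p.2 p.1) - u m p.1| ≤ (|a| + |b|) * (|a| + |b|) := by gcongr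
          _ ≤ 2 * a ^ 2 + 2 * b ^ 2 := by
            rw [← sq_abs a, ← sq_abs b]; nlinarith [sq_nonneg (|a| - |b|)]
    · exact ((((hclim _).const_mul _)).sub ((hclim _).const_mul _)).const_mul _
  have hlim := tendsto_nhds_unique lim1 ((lim2.const_mul (-(1 / 2))).congr fun m => by
    rw [hort _ (hub m), h.integral_mul_gen hf hf2 (hub m)])
  have e0 : ∫ η, χ η ^ 2 * f η ^ 2 ∂π = ∫ η, f η * (χ η ^ 2 * f η) ∂π := by
    congr 1; ext η; ring
  rw [e0, hlim, ← integral_const_mul]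
  calc ∫ p : S × G, -(1 / 2) * ((f (act p.2 p.1) - f p.1) *
        (χ (act p.2 p.1) ^ 2 * f (act p.2 p.1) - χ p.1 ^ 2 * f p.1)) ∂h.joint
      ≤ ∫ p : S × G, 1 / (4 * (n : ℝ) ^ 2) * (D (act p.2 p.1) + D p.1) ∂h.joint := by
        refine integral_mono ?_ ((hD2.add hD1).const_mul _) fun p => ?_
        · refine Integrable.const_mul ?_ _
          refine Integrable.mono' ((hD2.const_mul 2).add (hD1.const_mul 2))
            ((h.measurable_grad hf).mul (h.measurable_grad (f := fun η => χ η ^ 2 * f η)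
              (((h.measurable_cutoff n).pow_const 2).mul hf))).aestronglyMeasurable
              (Eventually.of_forall fun p => ?_)
          rcases hcase p with ⟨h1, h2⟩ | ⟨h1, h2⟩
          · have := hD0 (act p.2 p.1)
            have := hD0 p.1
            simp only [h1, h2, Pi.add_apply]
            simp; positivity
          · simp only [h1, h2, Pi.add_apply]
            rw [Real.norm_eq_abs, abs_mul]
            set a := f (act p.2 p.1)
            set b := f p.1
            have e1 : |a - b| ≤ |a| + |b| := abs_sub _ _
            have e2 : |χ (act p.2 p.1) ^ 2 * a - χ p.1 ^ 2 * b| ≤ |a| + |b| := by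
              refine (abs_sub _ _).trans (add_le_add ?_ ?_) <;>
              · rw [abs_mul, abs_of_nonneg (sq_nonneg _)]
                exact mul_le_of_le_one_left (abs_nonneg _) (hχ1 _)
            calc |a - b| * |χ (act p.2 p.1) ^ 2 * a - χ p.1 ^ 2 * b|
                ≤ (|a| + |b|) * (|a| + |b|) := by gcongr
              _ ≤ 2 * a ^ 2 + 2 * b ^ 2 := by
                rw [← sq_abs a, ← sq_abs b]; nlinarith [sq_nonneg (|a| - |b|)]
        · rcases hcase p with ⟨h1, h2⟩ | ⟨h1, h2⟩
          · have := hD0 (act p.2 p.1)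
            have := hD0 p.1
            simp only [h1, h2]
            simp; positivity
          · simp only [h1, h2]
            have e3 : (χ (act p.2 p.1) - χ p.1) ^ 2 ≤ 1 / (n : ℝ) ^ 2 := by
              have := h.abs_cutoff_sub_le hn p.2 p.1
              rw [← sq_abs, ← one_div_pow]
              gcongr
            set a := f (act p.2 p.1)
            set b := f p.1
            set x := χ (act p.2 p.1)
            set y := χ p.1
            have e4 : (a ^ 2 + b ^ 2) * (x - y) ^ 2 ≤ (a ^ 2 + b ^ 2) * (1 / (n : ℝ) ^ 2) := by
              gcongr
            have e5 : 1 / (4 * (n : ℝ) ^ 2) * (a ^ 2 + b ^ 2) =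
                (1 / 4) * ((a ^ 2 + b ^ 2) * (1 / (n : ℝ) ^ 2)) := by
              field_simp
            rw [e5]
            -- This uses `(a - b)(x²a - y²b) = (xa - yb)² - ab(x - y)²` together with `2ab ≤ a² +
            -- b²`. The square is favourable and only the gradient of the cutoff remains.
            nlinarith [sq_nonneg (x * a - y * b), mul_nonneg (sq_nonneg (a - b)) (sq_nonneg (x - y))]
    _ = 1 / (2 * (n : ℝ) ^ 2) * ∫ p, D p.1 ∂h.joint := by
        rw [integral_const_mul, integral_add hD2 hD1, hD2']
        field_simp; ring
    _ ≤ 1 / (2 * (n : ℝ) ^ 2) * (K * (1 + (2 * n + 1)) * ∫ η, f η ^ 2 ∂π) := by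
        gcongr
        exact h.integral_sq_indicator_joint_le hf hf2 (by positivity)
    _ = _ := by field_simp

/-- The range of `1 - L` on bounded measurable functions has trivial orthogonal complement. -/
theorem ae_eq_zero_of_orthogonal {f : S → ℝ} (hf : Measurable f) (hf2 : MemLp f 2 π)
    (hort : ∀ u, BddMeas u → ∫ η, f η * u η ∂π = ∫ η, f η * gen act c u η ∂π) :
    f =ᵐ[π] 0 := by
  have lim1 : Tendsto (fun n : ℕ => ∫ η, h.cutoff n η ^ 2 * f η ^ 2 ∂π) atTop
      (𝓝 (∫ η, f η ^ 2 ∂π)) := by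
    refine tendsto_integral_of_dominated_convergence (fun η => f η ^ 2)
      (fun n => (((h.measurable_cutoff n).pow_const 2).mul
        (hf.pow_const 2)).aestronglyMeasurable) hf2.integrable_sq
      (fun m => Eventually.of_forall fun η => ?_) (Eventually.of_forall fun η => ?_)
    · rw [Real.norm_eq_abs, abs_of_nonneg (by positivity)]
      exact mul_le_of_le_one_left (sq_nonneg _)
        (pow_le_one₀ (h.cutoff_nonneg m η) (h.cutoff_le_one m η))
    · obtain ⟨m₀, hm₀⟩ := exists_nat_ge (N η)
      refine tendsto_const_nhds.congr' ?_
      filter_upwards [eventually_ge_atTop (max 1 m₀)] with m hm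
      rw [h.cutoff_eq_one (by omega) (hm₀.trans (by exact_mod_cast (le_max_right _ _).trans hm))]
      ring
  have lim2 : Tendsto (fun n : ℕ => K * (1 + (2 * n + 1)) / (2 * (n : ℝ) ^ 2) * ∫ η, f η ^ 2 ∂π)
      atTop (𝓝 0) := by
    have e1 : Tendsto (fun n : ℕ => ((n : ℝ))⁻¹) atTop (𝓝 0) := tendsto_inv_atTop_nhds_zero_nat
    have e2 : Tendsto (fun n : ℕ => K * ((n : ℝ)⁻¹ + (n : ℝ)⁻¹ * (n : ℝ)⁻¹) * ∫ η, f η ^ 2 ∂π)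
        atTop (𝓝 (K * (0 + 0 * 0) * ∫ η, f η ^ 2 ∂π)) :=
      ((e1.add (e1.mul e1)).const_mul K).mul_const _
    simp only [mul_zero, add_zero, zero_mul] at e2
    refine e2.congr' ?_
    filter_upwards [eventually_gt_atTop 0] with n hn
    have : (0 : ℝ) < n := by exact_mod_cast hn
    field_simp
    ring
  have hle : ∫ η, f η ^ 2 ∂π ≤ 0 := by
    refine le_of_tendsto_of_tendsto lim1 lim2 ?_
    filter_upwards [eventually_gt_atTop 0] with n hn
    exact h.integral_cutoff_sq_le hf hf2 hort hn
  have h0 := (integral_eq_zero_iff_of_nonneg (fun η => sq_nonneg (f η)) hf2.integrable_sq).1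
    (le_antisymm hle (integral_nonneg fun η => sq_nonneg _))
  filter_upwards [h0] with η hη
  simpa using hη

end LinearGrowth
end JumpGen

theorem MeasureTheory.MemLp.inner_toLp_toLp {S : Type*} [MeasurableSpace S] {π : Measure S}
    {f g : S → ℝ} (hf : MemLp f 2 π) (hg : MemLp g 2 π) :
    inner ℝ (hf.toLp f) (hg.toLp g) = ∫ η, f η * g η ∂π := by
  rw [L2.inner_def]
  refine integral_congr_ae ?_
  filter_upwards [hf.coeFn_toLp, hg.coeFn_toLp] with η h1 h2
  rw [h1, h2]
  simp [mul_comm]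

/-! ### Self-adjointness of the closure, and Poincaré inequalities on its domain -/

namespace JumpGen

variable {S G : Type*} [MeasurableSpace S] [MeasurableSpace G]
  {act : G → S → S} {inv : G → G} {c : S → Measure G} {π : Measure S}

namespace LinearGrowth

variable {N : S → ℝ} {K : ℝ} (h : LinearGrowth act inv c π N K)

include h

variable [IsProbabilityMeasure π]

/-- The graph of the generator on bounded measurable functions, in `L²(π)`. -/
def graph : Submodule ℝ (Lp ℝ 2 π × Lp ℝ 2 π) where
  carrier := {x | ∃ (u : S → ℝ) (hu : BddMeas u),
    x = ((hu.memLp 2).toLp u, (h.memLp_gen hu).toLp (gen act c u))}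
  zero_mem' := by
    have h0 : BddMeas (0 : S → ℝ) := ⟨measurable_const, 0, by simp⟩
    refine ⟨0, h0, ?_⟩
    have : gen act c (0 : S → ℝ) = 0 := by ext; simp [gen]
    simp only [this]
    rfl
  add_mem' := by
    rintro _ _ ⟨u, hu, rfl⟩ ⟨v, hv, rfl⟩
    refine ⟨u + v, hu.add hv, ?_⟩
    simp only [h.gen_add hu hv]
    rfl
  smul_mem' := by
    rintro a _ ⟨u, hu, rfl⟩
    refine ⟨a • u, hu.const_smul a, ?_⟩
    simp only [gen_const_smul]
    rfl

theorem inner_graph_comm {x y : Lp ℝ 2 π × Lp ℝ 2 π} (hx : x ∈ h.graph) (hy : y ∈ h.graph) :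
    inner ℝ x.1 y.2 = inner ℝ x.2 y.1 := by
  obtain ⟨u, hu, rfl⟩ := hx
  obtain ⟨v, hv, rfl⟩ := hy
  rw [MemLp.inner_toLp_toLp, MemLp.inner_toLp_toLp]
  exact h.integral_mul_gen_comm hu hv

theorem inner_graph_nonpos {x : Lp ℝ 2 π × Lp ℝ 2 π} (hx : x ∈ h.graph) :
    inner ℝ x.1 x.2 ≤ 0 := by
  obtain ⟨u, hu, rfl⟩ := hx
  rw [MemLp.inner_toLp_toLp]
  exact h.integral_mul_gen_nonpos hu

/-- Since `⟨x, Lx⟩ ≤ 0`, expanding the square gives `‖x - Lx‖² ≥ ‖x‖²`. Convergence of `(1 - L)uₙ`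
therefore forces convergence of `uₙ`. -/
theorem norm_fst_le {x : Lp ℝ 2 π × Lp ℝ 2 π} (hx : x ∈ h.graph) : ‖x.1‖ ≤ ‖x.1 - x.2‖ := by
  have h1 := norm_sub_sq_real x.1 x.2
  have h2 := h.inner_graph_nonpos hx
  refine le_of_sq_le_sq ?_ (norm_nonneg _) |>.trans le_rfl
  nlinarith [sq_nonneg ‖x.2‖]

/-- This translates the sequential definition on functions into the closure of a subspace of `L² ×
L²`, where Hilbert space arguments apply. -/
theorem inGraph_iff {f g : S → ℝ} (hf : MemLp f 2 π) (hg : MemLp g 2 π) :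
    InGraph (gen act c) π f g ↔ (hf.toLp f, hg.toLp g) ∈ closure (h.graph : Set _) := by
  rw [mem_closure_iff_seq_limit]
  constructor
  · rintro ⟨-, -, u, hu, h1, h2⟩
    refine ⟨fun n => (((hu n).memLp 2).toLp (u n), (h.memLp_gen (hu n)).toLp _),
      fun n => ⟨u n, hu n, rfl⟩, ?_⟩
    rw [Prod.tendsto_iff]
    exact ⟨(Lp.tendsto_Lp_iff_tendsto_eLpNorm'' _ (fun n => (hu n).memLp 2) _ hf).2 h1,
      (Lp.tendsto_Lp_iff_tendsto_eLpNorm'' _ (fun n => h.memLp_gen (hu n)) _ hg).2 h2⟩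
  · rintro ⟨x, hx, hlim⟩
    choose u hu hxu using hx
    rw [Prod.tendsto_iff] at hlim
    simp only [hxu] at hlim
    exact ⟨hf, hg, u, hu, (Lp.tendsto_Lp_iff_tendsto_eLpNorm'' _ _ _ hf).1 hlim.1,
      (Lp.tendsto_Lp_iff_tendsto_eLpNorm'' _ _ _ hg).1 hlim.2⟩

theorem inner_closure_comm {x y : Lp ℝ 2 π × Lp ℝ 2 π} (hx : x ∈ closure (h.graph : Set _))
    (hy : y ∈ closure (h.graph : Set _)) : inner ℝ x.1 y.2 = inner ℝ x.2 y.1 := by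
  obtain ⟨a, ha, hax⟩ := mem_closure_iff_seq_limit.1 hx
  obtain ⟨b, hb, hby⟩ := mem_closure_iff_seq_limit.1 hy
  rw [Prod.tendsto_iff] at hax hby
  exact tendsto_nhds_unique (hax.1.inner hby.2) ((hax.2.inner hby.1).congr fun n =>
    (h.inner_graph_comm (ha n) (hb n)).symm)

/-- The range of `1 - L` on bounded measurable functions. -/
def rangeOneSub : Submodule ℝ (Lp ℝ 2 π) :=
  h.graph.map (LinearMap.fst ℝ (Lp ℝ 2 π) (Lp ℝ 2 π) - LinearMap.snd ℝ (Lp ℝ 2 π) (Lp ℝ 2 π))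

theorem mem_rangeOneSub {w : Lp ℝ 2 π} :
    w ∈ h.rangeOneSub ↔ ∃ z ∈ h.graph, z.1 - z.2 = w := Iff.rfl

/-- A class orthogonal to the range is replaced by an everywhere measurable representative, because
the cutoff argument composes it with the moves. -/
theorem dense_rangeOneSub : h.rangeOneSub.topologicalClosure = ⊤ := by
  rw [Submodule.topologicalClosure_eq_top_iff, Submodule.eq_bot_iff]
  intro x hx
  rw [Submodule.mem_orthogonal'] at hx
  have hxm := Lp.memLp x
  obtain ⟨f, hf, hxf⟩ : ∃ f : S → ℝ, Measurable f ∧ x =ᵐ[π] f :=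
    ⟨_, hxm.1.stronglyMeasurable_mk.measurable, hxm.1.ae_eq_mk⟩
  have hf2 : MemLp f 2 π := (memLp_congr_ae hxf).1 hxm
  have hxe : x = hf2.toLp f := by
    rw [← Lp.toLp_coeFn x hxm]
    exact (MemLp.toLp_eq_toLp_iff _ _).2 hxf
  have h0 : f =ᵐ[π] 0 := by
    refine h.ae_eq_zero_of_orthogonal hf hf2 fun u hu => ?_
    have := hx _ (h.mem_rangeOneSub.2 ⟨_, ⟨u, hu, rfl⟩, rfl⟩)
    rw [inner_sub_right, hxe, MemLp.inner_toLp_toLp, MemLp.inner_toLp_toLp] at this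
    linarith
  exact (Lp.eq_zero_iff_ae_eq_zero).2 (hxf.trans h0)

/-- This is the hard inclusion, that the adjoint lies in the closure. Approximate `x - y` by `(1 -
L)uₙ`; by `norm_fst_le` the `uₙ` converge to some `U`, and `(U, U - (x - y))` lies in the closure.
Then `x - U` is orthogonal to the range of `1 - L`, so `x = U`. -/
theorem mem_closure_of_adjoint {x y : Lp ℝ 2 π}
    (hxy : ∀ z ∈ h.graph, inner ℝ x z.2 = inner ℝ y z.1) :
    (x, y) ∈ closure (h.graph : Set (Lp ℝ 2 π × Lp ℝ 2 π)) := by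
  have hd := h.dense_rangeOneSub
  have hmem : x - y ∈ h.rangeOneSub.topologicalClosure := by rw [hd]; trivial
  obtain ⟨w, hw, hwlim⟩ := mem_closure_iff_seq_limit.1
    (show x - y ∈ closure (_ : Set (Lp ℝ 2 π)) from hmem)
  choose z hz hzw' using fun n => h.mem_rangeOneSub.1 (hw n)
  have hcau : CauchySeq fun n => (z n).1 := by
    have hw' := hwlim.cauchySeq
    rw [Metric.cauchySeq_iff'] at hw' ⊢
    intro ε hε
    obtain ⟨n₀, hn₀⟩ := hw' ε hε
    refine ⟨n₀, fun n hn => ?_⟩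
    have h1 := h.norm_fst_le (h.graph.sub_mem (hz n) (hz n₀))
    have h2 := hn₀ n hn
    rw [dist_eq_norm] at h2 ⊢
    refine lt_of_le_of_lt (h1.trans_eq ?_) h2
    rw [← hzw', ← hzw', Prod.fst_sub, Prod.snd_sub]
    congr 1; abel
  obtain ⟨U, hU⟩ := cauchySeq_tendsto_of_complete hcau
  have hV : Tendsto (fun n => (z n).2) atTop (𝓝 (U - (x - y))) := by
    refine (hU.sub hwlim).congr fun n => ?_
    rw [← hzw']; abel
  have hUV : (U, U - (x - y)) ∈ closure (h.graph : Set (Lp ℝ 2 π × Lp ℝ 2 π)) :=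
    mem_closure_of_tendsto (hU.prodMk_nhds hV) (Eventually.of_forall hz)
  have hzero : x - U = 0 := by
    have hperp : x - U ∈ h.rangeOneSubᗮ := by
      rw [Submodule.mem_orthogonal']
      intro w hw
      obtain ⟨v, hv, rfl⟩ := h.mem_rangeOneSub.1 hw
      have e1 := hxy v hv
      have e2 := h.inner_closure_comm hUV (subset_closure hv)
      simp only [inner_sub_right, inner_sub_left] at e1 e2 ⊢
      linarith
    rw [Submodule.topologicalClosure_eq_top_iff.1 hd] at hperp
    simpa using hperp
  have hxU : x = U := sub_eq_zero.1 hzero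
  rw [← hxU] at hUV
  simpa using hUV

theorem selfAdjointClosure : SelfAdjointClosure (gen act c) π := by
  refine ⟨fun u hu => h.memLp_gen hu, fun f g hf hg => ⟨?_, ?_⟩⟩
  · intro hfg u v huv
    have := h.inner_closure_comm ((h.inGraph_iff hf hg).1 hfg)
      ((h.inGraph_iff huv.1 huv.2.1).1 huv)
    simpa only [MemLp.inner_toLp_toLp] using this
  · intro hadj
    rw [h.inGraph_iff hf hg]
    refine h.mem_closure_of_adjoint ?_
    rintro _ ⟨u, hu, rfl⟩
    simp only [MemLp.inner_toLp_toLp]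
    exact hadj u _ ((h.inGraph_iff (hu.memLp 2) (h.memLp_gen hu)).2 (subset_closure ⟨u, hu, rfl⟩))

/-- A Poincaré inequality for bounded measurable functions bounds the gap from below. -/
theorem le_gap {k : ℝ}
    (hk : ∀ u, BddMeas u → k * variance u π ≤ -∫ η, u η * gen act c u η ∂π) :
    (k : EReal) ≤ gap (gen act c) π := by
  refine le_sSup ⟨k, fun f g hfg => ?_, rfl⟩
  have hf := hfg.1
  have hg := hfg.2.1
  have h1 : MemLp (fun _ : S => (1 : ℝ)) 2 π := memLp_const 1
  -- Written as `⟨u, u⟩ - ⟨u, 1⟩²`, the variance is continuous on `L²`, so the inequality is a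
  -- closed condition on the pair `(u, Lu)` and passes to the closure of the graph.
  have hvar : ∀ u (hu : MemLp u 2 π), variance u π =
      inner ℝ (hu.toLp u) (hu.toLp u) - inner ℝ (hu.toLp u) (h1.toLp _) ^ 2 := by
    intro u hu
    rw [variance_eq_sub hu, MemLp.inner_toLp_toLp, MemLp.inner_toLp_toLp]
    simp [sq]
  have hcl : ∀ x ∈ closure (h.graph : Set (Lp ℝ 2 π × Lp ℝ 2 π)),
      k * (inner ℝ x.1 x.1 - inner ℝ x.1 (h1.toLp _) ^ 2) ≤ -inner ℝ x.1 x.2 := by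
    intro x hx
    refine closure_minimal (s := (h.graph : Set (Lp ℝ 2 π × Lp ℝ 2 π)))
      (t := {x | k * (inner ℝ x.1 x.1 - inner ℝ x.1 (h1.toLp _) ^ 2) ≤ -inner ℝ x.1 x.2})
      ?_ ?_ hx
    · rintro _ ⟨u, hu, rfl⟩
      have := hk u hu
      rw [hvar u (hu.memLp 2)] at this
      simp only [Set.mem_ofPred_eq]
      rwa [MemLp.inner_toLp_toLp (hu.memLp 2) (h.memLp_gen hu)]
    · exact isClosed_le (by fun_prop) (by fun_prop)
  have := hcl _ ((h.inGraph_iff hf hg).1 hfg)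
  rw [hvar f hf]
  simpa only [MemLp.inner_toLp_toLp hf hg] using this

end LinearGrowth
end JumpGen

/-! ### Dobrushin's criterion: from contraction of oscillations to a bound on the variance -/

namespace Tensorization

open JumpGen

variable {ι Y : Type*} [Fintype ι] [DecidableEq ι]

/-- Changing the coordinate `i` changes `f` by at most `δ i`. -/
def OscBound (f : (ι → Y) → ℝ) (δ : ι → ℝ) : Prop :=
  ∀ i ω q, |f (Function.update ω i q) - f ω| ≤ δ i

/-- The configurations are joined by a path that changes one coordinate at a time. -/
theorem OscBound.abs_sub_le {f : (ι → Y) → ℝ} {δ : ι → ℝ} (h : OscBound f δ) (ω ω' : ι → Y) :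
    |f ω' - f ω| ≤ ∑ i, δ i := by
  have key : ∀ s : Finset ι, |f (s.piecewise ω' ω) - f ω| ≤ ∑ i ∈ s, δ i := by
    intro s
    induction s using Finset.induction with
    | empty => simp
    | insert j s hj ih =>
      rw [Finset.sum_insert hj, Finset.piecewise_insert]
      have := h j (s.piecewise ω' ω) (ω' j)
      calc _ ≤ |f (Function.update (s.piecewise ω' ω) j (ω' j)) - f (s.piecewise ω' ω)|
            + |f (s.piecewise ω' ω) - f ω| := _root_.abs_sub_le _ _ _
        _ ≤ _ := add_le_add this ih
  simpa using key Finset.univ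

/-- A doubling sequence that is dominated by a geometric rate starts below that rate. -/
theorem le_mul_of_sq_le_mul {a : ℕ → ℝ} {A B r : ℝ} (hA : 0 ≤ A) (hr : 0 ≤ r)
    (hsq : ∀ k, a k ^ 2 ≤ a (k + 1) * A) (hbd : ∀ k, a k ≤ B * r ^ 2 ^ k) : a 0 ≤ r * A := by
  by_contra hcon
  push Not at hcon
  have h0 : 0 < a 0 := (mul_nonneg hr hA).trans_lt hcon
  have hA' : 0 < A := by
    rcases hA.lt_or_eq with h | h
    · exact h
    · have := hsq 0
      rw [← h] at this
      nlinarith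
  -- Iterating `aₖ² ≤ aₖ₊₁ A` from `a₀` gives growth at rate `a₀ / A`. If this exceeded `r`, the
  -- upper bound `B r^(2^k)` would eventually be violated.
  have key : ∀ k, A * (a 0 / A) ^ 2 ^ k ≤ a k := by
    intro k
    induction k with
    | zero => simp; field_simp; rfl
    | succ k ih =>
      have h1 : 0 ≤ A * (a 0 / A) ^ 2 ^ k := by positivity
      have h2 : (A * (a 0 / A) ^ 2 ^ k) ^ 2 ≤ a (k + 1) * A :=
        (pow_le_pow_left₀ h1 ih 2).trans (hsq k)
      rw [pow_succ 2 k, pow_mul]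
      have : (A * (a 0 / A) ^ 2 ^ k) ^ 2 = (A * ((a 0 / A) ^ 2 ^ k) ^ 2) * A := by ring
      rw [this] at h2
      exact le_of_mul_le_mul_right h2 hA'
  have hrlt : r < a 0 / A := (lt_div_iff₀ hA').2 hcon
  have hpos : 0 < a 0 / A := hr.trans_lt hrlt
  have h3 : ∀ k : ℕ, A ≤ B * (r / (a 0 / A)) ^ 2 ^ k := by
    intro k
    rw [div_pow, ← mul_div_assoc, le_div_iff₀ (by positivity)]
    exact (key k).trans (hbd k)
  have hlim : Tendsto (fun k : ℕ => B * (r / (a 0 / A)) ^ 2 ^ k) atTop (𝓝 (B * 0)) := by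
    refine Tendsto.const_mul _ ?_
    refine (tendsto_pow_atTop_nhds_zero_of_lt_one (by positivity)
      ((div_lt_one hpos).2 hrlt)).comp ?_
    exact tendsto_pow_atTop_atTop_of_one_lt (by norm_num)
  have := ge_of_tendsto' hlim h3
  linarith

variable [MeasurableSpace Y]

/-- Operators on bounded functions of `ω : ι → Y` which are symmetric in `L²(π)`, preserve the mean
and are such that `E i f` does not depend on the coordinate `i`, while its dependence on the
coordinate `j` is controlled by that of `f` on `j` and `i`. -/
structure DobrushinSystem (π : Measure (ι → Y)) (E : ι → ((ι → Y) → ℝ) → (ι → Y) → ℝ)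
    (c : ι → ι → ℝ) : Prop where
  bddMeas : ∀ i {f}, BddMeas f → BddMeas (E i f)
  symm : ∀ i {f g}, BddMeas f → BddMeas g → ∫ ω, E i f ω * g ω ∂π = ∫ ω, f ω * E i g ω ∂π
  mean : ∀ i {f}, BddMeas f → ∫ ω, E i f ω ∂π = ∫ ω, f ω ∂π
  coeff_nonneg : ∀ i j, 0 ≤ c i j
  osc : ∀ i {f} {δ : ι → ℝ}, BddMeas f → OscBound f δ →
    OscBound (E i f) fun j => if j = i then 0 else δ j + c i j * δ i

namespace DobrushinSystem

variable {π : Measure (ι → Y)} [IsProbabilityMeasure π]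
  {E : ι → ((ι → Y) → ℝ) → (ι → Y) → ℝ} {c : ι → ι → ℝ}

/-- The random scan average of the operators `E i`. -/
def scan (E : ι → ((ι → Y) → ℝ) → (ι → Y) → ℝ) (f : (ι → Y) → ℝ) (ω : ι → Y) : ℝ :=
  (Fintype.card ι : ℝ)⁻¹ * ∑ i, E i f ω

variable (hE : DobrushinSystem π E c)

include hE

theorem bddMeas_scan {f : (ι → Y) → ℝ} (hf : BddMeas f) : BddMeas (scan E f) := by
  choose M hM using fun i => (hE.bddMeas i hf).2
  refine ⟨(Finset.measurable_sum _ fun i _ => (hE.bddMeas i hf).1).const_mul _,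
    (Fintype.card ι : ℝ)⁻¹ * ∑ i, M i, fun ω => ?_⟩
  rw [scan, abs_mul, abs_of_nonneg (by positivity)]
  gcongr
  exact (Finset.abs_sum_le_sum_abs _ _).trans (Finset.sum_le_sum fun i _ => hM i ω)

theorem integral_mul_scan {f g : (ι → Y) → ℝ} (hf : BddMeas f) (hg : BddMeas g) :
    ∫ ω, g ω * scan E f ω ∂π = (Fintype.card ι : ℝ)⁻¹ * ∑ i, ∫ ω, g ω * E i f ω ∂π := by
  rw [← integral_finsetSum, ← integral_const_mul]
  · congr 1; ext ω
    rw [scan, ← Finset.mul_sum]; ring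
  · intro i _
    exact MemLp.integrable_mul (hg.memLp 2) ((hE.bddMeas i hf).memLp 2)

theorem scan_symm {f g : (ι → Y) → ℝ} (hf : BddMeas f) (hg : BddMeas g) :
    ∫ ω, scan E f ω * g ω ∂π = ∫ ω, f ω * scan E g ω ∂π := by
  simp_rw [mul_comm (scan E f _)]
  rw [hE.integral_mul_scan hf hg, hE.integral_mul_scan hg hf]
  congr 1
  refine Finset.sum_congr rfl fun i _ => ?_
  rw [← hE.symm i hf hg]
  simp_rw [mul_comm]

theorem scan_mean [Nonempty ι] {f : (ι → Y) → ℝ} (hf : BddMeas f) :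
    ∫ ω, scan E f ω ∂π = ∫ ω, f ω ∂π := by
  have h1 : BddMeas (fun _ : ι → Y => (1 : ℝ)) := ⟨measurable_const, 1, by simp⟩
  have := hE.integral_mul_scan hf h1
  simp only [one_mul] at this
  rw [this]
  simp only [hE.mean _ hf, Finset.sum_const, Finset.card_univ, nsmul_eq_mul]
  field_simp

/-- Applying `E i` removes the oscillation `δ i` and adds at most `α δ i` in total to the other
coordinates. Averaging over `i` yields the factor `1 - (1 - α)/n`. -/
theorem scan_osc [Nonempty ι] {α : ℝ} (hα : ∀ i, ∑ j, (if j = i then 0 else c i j) ≤ α)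
    {f : (ι → Y) → ℝ} (hf : BddMeas f) {δ : ι → ℝ} (hδ0 : ∀ i, 0 ≤ δ i) (hδ : OscBound f δ) :
    ∃ δ' : ι → ℝ, (∀ i, 0 ≤ δ' i) ∧ OscBound (scan E f) δ' ∧
      ∑ i, δ' i ≤ (1 - (1 - α) / Fintype.card ι) * ∑ i, δ i := by
  have hn : (0 : ℝ) < Fintype.card ι := by exact_mod_cast Fintype.card_pos
  refine ⟨fun j => (Fintype.card ι : ℝ)⁻¹ * ∑ i, if j = i then 0 else δ j + c i j * δ i,
    fun j => ?_, fun j ω q => ?_, ?_⟩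
  · refine mul_nonneg (by positivity) (Finset.sum_nonneg fun i _ => ?_)
    split_ifs
    · exact le_rfl
    · exact add_nonneg (hδ0 j) (mul_nonneg (hE.coeff_nonneg i j) (hδ0 i))
  · simp only [scan]
    rw [← mul_sub, ← Finset.sum_sub_distrib, abs_mul, abs_of_nonneg (by positivity)]
    gcongr
    exact (Finset.abs_sum_le_sum_abs _ _).trans
      (Finset.sum_le_sum fun i _ => hE.osc i hf hδ j ω q)
  · rw [← Finset.mul_sum, Finset.sum_comm]
    have h1 : ∀ i, ∑ j, (if j = i then 0 else δ j + c i j * δ i) ≤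
        (∑ j, δ j) - δ i + α * δ i := by
      intro i
      have e1 : ∀ j, (if j = i then 0 else δ j + c i j * δ i) =
          (δ j - if j = i then δ j else 0) + (if j = i then 0 else c i j) * δ i := by
        intro j; split_ifs <;> ring
      simp_rw [e1]
      rw [Finset.sum_add_distrib, Finset.sum_sub_distrib, ← Finset.sum_mul]
      simp only [Finset.sum_ite_eq', Finset.mem_univ, if_true]
      have := mul_le_mul_of_nonneg_right (hα i) (hδ0 i)
      linarith
    calc (Fintype.card ι : ℝ)⁻¹ * ∑ i, ∑ j, (if j = i then 0 else δ j + c i j * δ i)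
        ≤ (Fintype.card ι : ℝ)⁻¹ * ∑ i, ((∑ j, δ j) - δ i + α * δ i) := by
          gcongr with i; exact h1 i
      _ = _ := by
          rw [Finset.sum_add_distrib, Finset.sum_sub_distrib, ← Finset.mul_sum]
          simp only [Finset.sum_const, Finset.card_univ, nsmul_eq_mul]
          field_simp
          ring

theorem iterate_bddMeas {f : (ι → Y) → ℝ} (hf : BddMeas f) (m : ℕ) :
    BddMeas ((scan E)^[m] f) := by
  induction m with
  | zero => exact hf
  | succ m ih => rw [Function.iterate_succ_apply']; exact hE.bddMeas_scan ih

theorem iterate_mean [Nonempty ι] {f : (ι → Y) → ℝ} (hf : BddMeas f) (m : ℕ) :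
    ∫ ω, (scan E)^[m] f ω ∂π = ∫ ω, f ω ∂π := by
  induction m with
  | zero => rfl
  | succ m ih => rw [Function.iterate_succ_apply', hE.scan_mean (hE.iterate_bddMeas hf m), ih]

theorem iterate_symm {f g : (ι → Y) → ℝ} (hf : BddMeas f) (hg : BddMeas g) (m : ℕ) :
    ∫ ω, (scan E)^[m] f ω * g ω ∂π = ∫ ω, f ω * (scan E)^[m] g ω ∂π := by
  induction m generalizing g with
  | zero => rfl
  | succ m ih =>
    rw [Function.iterate_succ_apply', hE.scan_symm (hE.iterate_bddMeas hf m) hg,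
      ih (hE.bddMeas_scan hg), Function.iterate_succ_apply]

theorem iterate_osc [Nonempty ι] {α : ℝ} (hα : ∀ i, ∑ j, (if j = i then 0 else c i j) ≤ α)
    (hα1 : 0 ≤ 1 - (1 - α) / Fintype.card ι)
    {f : (ι → Y) → ℝ} (hf : BddMeas f) {δ : ι → ℝ} (hδ0 : ∀ i, 0 ≤ δ i) (hδ : OscBound f δ)
    (m : ℕ) :
    ∃ δ' : ι → ℝ, (∀ i, 0 ≤ δ' i) ∧ OscBound ((scan E)^[m] f) δ' ∧
      ∑ i, δ' i ≤ (1 - (1 - α) / Fintype.card ι) ^ m * ∑ i, δ i := by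
  induction m with
  | zero => exact ⟨δ, hδ0, hδ, by simp⟩
  | succ m ih =>
    obtain ⟨δ', h1, h2, h3⟩ := ih
    obtain ⟨δ'', h4, h5, h6⟩ := hE.scan_osc hα (hE.iterate_bddMeas hf m) h1 h2
    refine ⟨δ'', h4, by rwa [Function.iterate_succ_apply'], h6.trans ?_⟩
    rw [pow_succ', mul_assoc]
    gcongr

/-- Under the Dobrushin condition, the sum of the quadratic forms of `1 - E i` dominates the
variance. -/
theorem variance_le {α : ℝ} (hα0 : 0 ≤ α) (hα : ∀ i, ∑ j, (if j = i then 0 else c i j) ≤ α)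
    {f : (ι → Y) → ℝ} (hf : BddMeas f) (hmean : ∫ ω, f ω ∂π = 0) :
    (1 - α) * ∫ ω, f ω ^ 2 ∂π ≤ ∑ i, (∫ ω, f ω ^ 2 ∂π - ∫ ω, f ω * E i f ω ∂π) := by
  rcases isEmpty_or_nonempty ι with hι | hι
  · have : ∀ ω, f ω = 0 := by
      intro ω
      have e : f = fun _ => f ω := by
        ext ω'; congr 1; exact Subsingleton.elim _ _
      rw [e] at hmean
      simpa using hmean
    simp [this]
  have hn : (1 : ℝ) ≤ Fintype.card ι := by exact_mod_cast Fintype.card_pos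
  set r := 1 - (1 - α) / Fintype.card ι with hr
  have hr0 : 0 ≤ r := by
    have : (1 - α) / Fintype.card ι ≤ 1 := (div_le_one (by linarith)).2 (by linarith)
    linarith
  obtain ⟨M, hM⟩ := hf.2
  have hδ : OscBound f fun _ => 2 * M := fun i ω q => by
    have := abs_sub (f (Function.update ω i q)) (f ω)
    linarith [hM (Function.update ω i q), hM ω]
  obtain ⟨ω₀⟩ : Nonempty (ι → Y) := nonempty_of_isProbabilityMeasure π
  have hM0 : 0 ≤ M := (abs_nonneg _).trans (hM ω₀)
  set B := ∑ _i : ι, 2 * M with hB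
  -- The iterates keep mean zero, so their sup norm is at most their total oscillation, which decays
  -- like `r ^ m`.
  have hsup : ∀ m ω, |(scan E)^[m] f ω| ≤ B * r ^ m := by
    intro m ω
    obtain ⟨δ', h1, h2, h3⟩ := hE.iterate_osc hα hr0 hf (fun _ => by positivity) hδ m
    have e1 : (scan E)^[m] f ω = ∫ ω', ((scan E)^[m] f ω - (scan E)^[m] f ω') ∂π := by
      rw [integral_sub (integrable_const _) ((hE.iterate_bddMeas hf m).memLp 1 |>.integrable le_rfl),
        hE.iterate_mean hf, hmean]
      simp
    rw [e1, ← Real.norm_eq_abs]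
    refine (norm_integral_le_of_norm_le_const (C := ∑ i, δ' i)
      (Eventually.of_forall fun ω' => h2.abs_sub_le ω' ω)).trans ?_
    simp only [probReal_univ, mul_one]
    rw [mul_comm]
    exact h3
  -- For `P = scan E`, symmetry and Cauchy–Schwarz give `⟨f, P^(2^k) f⟩² ≤ ⟨f, P^(2^(k+1)) f⟩ ‖f‖²`.
  -- The geometric sup-norm decay then yields `⟨f, Pf⟩ ≤ r ‖f‖²` without the spectral theorem, and
  -- multiplying by the number of sites gives the claim.
  have key := le_mul_of_sq_le_mul (a := fun k => ∫ ω, f ω * (scan E)^[2 ^ k] f ω ∂π)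
    (A := ∫ ω, f ω ^ 2 ∂π) (B := M * B) (r := r) (integral_nonneg fun ω => sq_nonneg _) hr0 ?_ ?_
  · simp only [pow_zero, Function.iterate_one] at key
    rw [hE.integral_mul_scan hf hf] at key
    rw [Finset.sum_sub_distrib]
    simp only [Finset.sum_const, Finset.card_univ, nsmul_eq_mul]
    have hn' : (0 : ℝ) < Fintype.card ι := by linarith
    have := mul_le_mul_of_nonneg_left key hn'.le
    rw [← mul_assoc, mul_inv_cancel₀ hn'.ne', one_mul, hr] at this
    have e : (Fintype.card ι : ℝ) * ((1 - (1 - α) / Fintype.card ι) * ∫ ω, f ω ^ 2 ∂π) =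
      Fintype.card ι * ∫ ω, f ω ^ 2 ∂π - (1 - α) * ∫ ω, f ω ^ 2 ∂π := by field_simp
    linarith
  · intro k
    have hg := hE.iterate_bddMeas hf (2 ^ k)
    have e : ∫ ω, f ω * (scan E)^[2 ^ (k + 1)] f ω ∂π =
        ∫ ω, (scan E)^[2 ^ k] f ω * (scan E)^[2 ^ k] f ω ∂π := by
      rw [hE.iterate_symm hf hg, ← Function.iterate_add_apply, pow_succ, mul_two]
    rw [e]
    have h1 := real_inner_mul_inner_self_le ((hf.memLp (π := π) 2).toLp f) ((hg.memLp 2).toLp _)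
    simp only [MemLp.inner_toLp_toLp] at h1
    simp only [sq]
    linarith
  · intro k
    have : ∀ ω, f ω * (scan E)^[2 ^ k] f ω ≤ M * B * r ^ 2 ^ k := by
      intro ω
      refine (le_abs_self _).trans ?_
      rw [abs_mul, mul_assoc]
      exact mul_le_mul (hM ω) (hsup _ ω) (abs_nonneg _) hM0
    have h2 := integral_mono (μ := π)
      (MemLp.integrable_mul (hf.memLp 2) ((hE.iterate_bddMeas hf (2 ^ k)).memLp 2))
      (integrable_const (M * B * r ^ 2 ^ k)) this
    simpa using h2

end DobrushinSystem
end Tensorization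

/-! ### Gibbs measures over product spaces and their one-site conditional averages -/

namespace Tensorization

open JumpGen

variable {ι Y : Type*} [Fintype ι] [DecidableEq ι] [MeasurableSpace Y]

/-- The probability measure with density proportional to `h` with respect to a product measure. -/
def gibbs (ν : ι → Measure Y) (h : (ι → Y) → ℝ) : Measure (ι → Y) :=
  ((Measure.pi ν).withDensity (fun ω => ENNReal.ofReal (h ω)) Set.univ)⁻¹ •
    (Measure.pi ν).withDensity fun ω => ENNReal.ofReal (h ω)

/-- A density bounded away from `0` and `∞`. -/
structure GibbsDensity (h : (ι → Y) → ℝ) (a b : ℝ) : Prop where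
  measurable : Measurable h
  pos : 0 < a
  lower : ∀ ω, a ≤ h ω
  upper : ∀ ω, h ω ≤ b

/-- The average over the coordinate `i`, conditionally on all other coordinates. -/
def siteAvg (ν : ι → Measure Y) (h : (ι → Y) → ℝ) (i : ι) (f : (ι → Y) → ℝ) (ω : ι → Y) : ℝ :=
  (∫ q, h (Function.update ω i q) * f (Function.update ω i q) ∂(ν i)) /
    ∫ q, h (Function.update ω i q) ∂(ν i)

namespace GibbsDensity

variable {h : (ι → Y) → ℝ} {a b : ℝ} (hh : GibbsDensity h a b)
  (ν : ι → Measure Y) [∀ i, IsFiniteMeasure (ν i)] [∀ i, NeZero (ν i)]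

include hh

theorem bddMeas : BddMeas h :=
  ⟨hh.measurable, b, fun ω => abs_le.2
    ⟨by linarith [hh.pos, hh.lower ω, hh.upper ω], hh.upper ω⟩⟩

theorem nonneg (ω : ι → Y) : 0 ≤ h ω := hh.pos.le.trans (hh.lower ω)

theorem weight_univ_ne_zero :
    (Measure.pi ν).withDensity (fun ω => ENNReal.ofReal (h ω)) Set.univ ≠ 0 := by
  rw [withDensity_apply _ .univ, setLIntegral_univ]
  refine ne_of_gt (lt_of_lt_of_le ?_ (lintegral_mono (f := fun _ => ENNReal.ofReal a) fun ω =>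
    ENNReal.ofReal_le_ofReal (hh.lower ω)))
  rw [lintegral_const, Measure.pi_univ]
  refine ENNReal.mul_pos (by simp [hh.pos]) ?_
  rw [Finset.prod_ne_zero_iff]
  intro i _
  simpa using NeZero.ne (ν i)

theorem weight_univ_ne_top :
    (Measure.pi ν).withDensity (fun ω => ENNReal.ofReal (h ω)) Set.univ ≠ ∞ := by
  rw [withDensity_apply _ .univ, setLIntegral_univ]
  refine ne_of_lt (lt_of_le_of_lt (lintegral_mono (g := fun _ => ENNReal.ofReal b) fun ω =>
    ENNReal.ofReal_le_ofReal (hh.upper ω)) ?_)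
  rw [lintegral_const]
  exact ENNReal.mul_lt_top (by simp) (measure_lt_top _ _)

theorem isProbabilityMeasure : IsProbabilityMeasure (gibbs ν h) :=
  ⟨by simpa [gibbs] using
    ENNReal.inv_mul_cancel (hh.weight_univ_ne_zero ν) (hh.weight_univ_ne_top ν)⟩

omit [∀ i, NeZero (ν i)] in
theorem lintegral_gibbs (F : (ι → Y) → ℝ≥0∞) :
    ∫⁻ ω, F ω ∂(gibbs ν h) =
      ((Measure.pi ν).withDensity (fun ω => ENNReal.ofReal (h ω)) Set.univ)⁻¹ *
        ∫⁻ ω, ENNReal.ofReal (h ω) * F ω ∂(Measure.pi ν) := by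
  rw [gibbs, lintegral_smul_measure, smul_eq_mul,
    lintegral_withDensity_eq_lintegral_mul_non_measurable _ hh.measurable.ennreal_ofReal
      (Eventually.of_forall fun _ => ENNReal.ofReal_lt_top)]
  rfl

/-- Integrals are compared by comparing integrals over one coordinate. -/
theorem lintegral_gibbs_le (i : ι) {A B : (ι → Y) → ℝ≥0∞} (hA : Measurable A) (hB : Measurable B)
    (hAB : ∀ ω, ∫⁻ q, ENNReal.ofReal (h (Function.update ω i q)) * A (Function.update ω i q) ∂(ν i)
      ≤ ∫⁻ q, ENNReal.ofReal (h (Function.update ω i q)) * B (Function.update ω i q) ∂(ν i)) :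
    ∫⁻ ω, A ω ∂(gibbs ν h) ≤ ∫⁻ ω, B ω ∂(gibbs ν h) := by
  rw [hh.lintegral_gibbs, hh.lintegral_gibbs]
  refine mul_le_mul' le_rfl ?_
  refine lintegral_le_of_lmarginal_le (μ := ν) {i} (hh.measurable.ennreal_ofReal.mul hA)
    (hh.measurable.ennreal_ofReal.mul hB) ?_
  rw [lmarginal_singleton, lmarginal_singleton]
  exact hAB

theorem lintegral_gibbs_congr (i : ι) {A B : (ι → Y) → ℝ≥0∞} (hA : Measurable A)
    (hB : Measurable B)
    (hAB : ∀ ω, ∫⁻ q, ENNReal.ofReal (h (Function.update ω i q)) * A (Function.update ω i q) ∂(ν i)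
      = ∫⁻ q, ENNReal.ofReal (h (Function.update ω i q)) * B (Function.update ω i q) ∂(ν i)) :
    ∫⁻ ω, A ω ∂(gibbs ν h) = ∫⁻ ω, B ω ∂(gibbs ν h) :=
  le_antisymm (hh.lintegral_gibbs_le ν i hA hB fun ω => (hAB ω).le)
    (hh.lintegral_gibbs_le ν i hB hA fun ω => (hAB ω).ge)

omit hh in
theorem integrable_update {f : (ι → Y) → ℝ} (hf : BddMeas f) (i : ι) (ω : ι → Y) :
    Integrable (fun q => f (Function.update ω i q)) (ν i) := by
  obtain ⟨M, hM⟩ := hf.2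
  exact Integrable.of_bound (hf.1.comp (measurable_update ω)).aestronglyMeasurable M
    (Eventually.of_forall fun q => hM _)

omit hh in
theorem BddMeas.mul {f g : (ι → Y) → ℝ} (hf : BddMeas f) (hg : BddMeas g) :
    BddMeas fun ω => f ω * g ω := by
  obtain ⟨M, hM⟩ := hf.2
  obtain ⟨M', hM'⟩ := hg.2
  refine ⟨hf.1.mul hg.1, M * M', fun ω => ?_⟩
  rw [abs_mul]
  exact mul_le_mul (hM ω) (hM' ω) (abs_nonneg _) ((abs_nonneg _).trans (hM ω))

theorem integral_gibbs_congr (i : ι) {A B : (ι → Y) → ℝ} (hA : BddMeas A) (hB : BddMeas B)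
    (hAB : ∀ ω, ∫ q, h (Function.update ω i q) * A (Function.update ω i q) ∂(ν i)
      = ∫ q, h (Function.update ω i q) * B (Function.update ω i q) ∂(ν i)) :
    ∫ ω, A ω ∂(gibbs ν h) = ∫ ω, B ω ∂(gibbs ν h) := by
  have := hh.isProbabilityMeasure ν
  obtain ⟨M₁, hM₁⟩ := hA.2
  obtain ⟨M₂, hM₂⟩ := hB.2
  -- Comparison one coordinate at a time is available for integrals of nonnegative functions, so
  -- both functions are shifted by a common bound.
  set M := max M₁ M₂
  have hA0 : ∀ ω, 0 ≤ A ω + M := fun ω => by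
    linarith [(abs_le.1 (hM₁ ω)).1, le_max_left M₁ M₂]
  have hB0 : ∀ ω, 0 ≤ B ω + M := fun ω => by
    linarith [(abs_le.1 (hM₂ ω)).1, le_max_right M₁ M₂]
  have hc : BddMeas fun _ : ι → Y => M := ⟨measurable_const, |M|, fun _ => le_rfl⟩
  have key : ∫ ω, (A ω + M) ∂(gibbs ν h) = ∫ ω, (B ω + M) ∂(gibbs ν h) := by
    rw [integral_eq_lintegral_of_nonneg_ae (Eventually.of_forall hA0)
      (hA.add hc).1.aestronglyMeasurable,
      integral_eq_lintegral_of_nonneg_ae (Eventually.of_forall hB0)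
      (hB.add hc).1.aestronglyMeasurable]
    congr 1
    refine hh.lintegral_gibbs_congr ν i (hA.add hc).1.ennreal_ofReal (hB.add hc).1.ennreal_ofReal
      fun ω => ?_
    simp_rw [← ENNReal.ofReal_mul (hh.nonneg _)]
    rw [← ofReal_integral_eq_lintegral_ofReal, ← ofReal_integral_eq_lintegral_ofReal]
    · congr 1
      simp_rw [mul_add]
      rw [integral_add, integral_add, hAB]
      exacts [integrable_update ν (BddMeas.mul hh.bddMeas hB) i ω,
        integrable_update ν (BddMeas.mul hh.bddMeas hc) i ω,
        integrable_update ν (BddMeas.mul hh.bddMeas hA) i ω,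
        integrable_update ν (BddMeas.mul hh.bddMeas hc) i ω]
    · exact integrable_update ν (BddMeas.mul hh.bddMeas (hB.add hc)) i ω
    · exact Eventually.of_forall fun q => mul_nonneg (hh.nonneg _) (hB0 _)
    · exact integrable_update ν (BddMeas.mul hh.bddMeas (hA.add hc)) i ω
    · exact Eventually.of_forall fun q => mul_nonneg (hh.nonneg _) (hA0 _)
  have hAi := (hA.memLp (π := gibbs ν h) 1).integrable le_rfl
  have hBi := (hB.memLp (π := gibbs ν h) 1).integrable le_rfl
  rw [integral_add hAi (integrable_const _), integral_add hBi (integrable_const _)] at key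
  linarith

theorem condMass_pos (i : ι) (ω : ι → Y) : 0 < ∫ q, h (Function.update ω i q) ∂(ν i) := by
  have h1 : ∫ _q, a ∂(ν i) ≤ ∫ q, h (Function.update ω i q) ∂(ν i) :=
    integral_mono (integrable_const _) (integrable_update ν hh.bddMeas i ω) fun q => hh.lower _
  refine lt_of_lt_of_le ?_ h1
  rw [integral_const, smul_eq_mul]
  exact mul_pos (measureReal_univ_pos) hh.pos

omit hh [∀ i, NeZero (ν i)] in
theorem siteAvg_update (i : ι) (f : (ι → Y) → ℝ) (ω : ι → Y) (q : Y) :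
    siteAvg ν h i f (Function.update ω i q) = siteAvg ν h i f ω := by
  simp [siteAvg]

theorem integral_mul_eq_siteAvg_mul (i : ι) (f : (ι → Y) → ℝ) (ω : ι → Y) :
    ∫ q, h (Function.update ω i q) * f (Function.update ω i q) ∂(ν i) =
      siteAvg ν h i f ω * ∫ q, h (Function.update ω i q) ∂(ν i) := by
  rw [siteAvg, div_mul_cancel₀ _ (hh.condMass_pos ν i ω).ne']

omit hh [∀ i, NeZero (ν i)] in
theorem measurable_integral_update {F : (ι → Y) → ℝ} (hF : Measurable F) (i : ι) :
    Measurable fun ω => ∫ q, F (Function.update ω i q) ∂(ν i) := by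
  have h1 : Measurable fun p : (ι → Y) × Y => F (Function.update p.1 i p.2) :=
    hF.comp measurable_update'
  exact (StronglyMeasurable.integral_prod_right (f := fun ω q => F (Function.update ω i q))
    h1.stronglyMeasurable).measurable

theorem bddMeas_siteAvg (i : ι) {f : (ι → Y) → ℝ} (hf : BddMeas f) :
    BddMeas (siteAvg ν h i f) := by
  obtain ⟨M, hM⟩ := hf.2
  refine ⟨(measurable_integral_update ν (hh.measurable.mul hf.1) i).div
    (measurable_integral_update ν hh.measurable i), M, fun ω => ?_⟩
  rw [siteAvg, abs_div, abs_of_pos (hh.condMass_pos ν i ω), div_le_iff₀ (hh.condMass_pos ν i ω),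
    ← integral_const_mul, ← Real.norm_eq_abs]
  refine norm_integral_le_of_norm_le ((integrable_update ν hh.bddMeas i ω).const_mul M)
    (Eventually.of_forall fun q => ?_)
  rw [norm_mul, Real.norm_of_nonneg (hh.nonneg _), mul_comm]
  exact mul_le_mul_of_nonneg_right (hM _) (hh.nonneg _)

/-- The average does not depend on coordinate `i`, so it factors out of the inner integral. The
right side is symmetric in `f` and `g`, which makes `siteAvg` a symmetric operator. -/
theorem integral_siteAvg_mul (i : ι) {f g : (ι → Y) → ℝ} (hf : BddMeas f) (hg : BddMeas g) :
    ∫ ω, siteAvg ν h i f ω * g ω ∂(gibbs ν h) =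
      ∫ ω, siteAvg ν h i f ω * siteAvg ν h i g ω ∂(gibbs ν h) := by
  refine hh.integral_gibbs_congr ν i (BddMeas.mul (hh.bddMeas_siteAvg ν i hf) hg)
    (BddMeas.mul (hh.bddMeas_siteAvg ν i hf) (hh.bddMeas_siteAvg ν i hg)) fun ω => ?_
  simp_rw [siteAvg_update, mul_left_comm (h _)]
  rw [integral_const_mul, integral_const_mul, hh.integral_mul_eq_siteAvg_mul, integral_mul_const,
    mul_comm (siteAvg ν h i g ω)]

theorem integral_siteAvg (i : ι) {f : (ι → Y) → ℝ} (hf : BddMeas f) :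
    ∫ ω, siteAvg ν h i f ω ∂(gibbs ν h) = ∫ ω, f ω ∂(gibbs ν h) := by
  refine hh.integral_gibbs_congr ν i (hh.bddMeas_siteAvg ν i hf) hf fun ω => ?_
  simp_rw [siteAvg_update]
  rw [hh.integral_mul_eq_siteAvg_mul, integral_mul_const, mul_comm]

/-- The variance over one coordinate in terms of the conditional average. -/
theorem integral_sub_siteAvg_sq (i : ι) {f : (ι → Y) → ℝ} (hf : BddMeas f) :
    ∫ ω, (f ω - siteAvg ν h i f ω) ^ 2 ∂(gibbs ν h) =
      ∫ ω, f ω ^ 2 ∂(gibbs ν h) - ∫ ω, f ω * siteAvg ν h i f ω ∂(gibbs ν h) := by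
  have := hh.isProbabilityMeasure ν
  have hE := hh.bddMeas_siteAvg ν i hf
  have e : ∀ ω, (f ω - siteAvg ν h i f ω) ^ 2 = (f ω ^ 2 - f ω * siteAvg ν h i f ω) -
      (siteAvg ν h i f ω * f ω - siteAvg ν h i f ω * siteAvg ν h i f ω) := fun ω => by ring
  simp_rw [e]
  have i1 : Integrable (fun ω => f ω ^ 2) (gibbs ν h) := (hf.memLp 2).integrable_sq
  have i2 : Integrable (fun ω => f ω * siteAvg ν h i f ω) (gibbs ν h) :=
    MemLp.integrable_mul (hf.memLp 2) (hE.memLp 2)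
  have i3 : Integrable (fun ω => siteAvg ν h i f ω * f ω) (gibbs ν h) :=
    MemLp.integrable_mul (hE.memLp 2) (hf.memLp 2)
  have i4 : Integrable (fun ω => siteAvg ν h i f ω * siteAvg ν h i f ω) (gibbs ν h) :=
    MemLp.integrable_mul (hE.memLp 2) (hE.memLp 2)
  have i12 : Integrable (fun ω => f ω ^ 2 - f ω * siteAvg ν h i f ω) (gibbs ν h) := i1.sub i2
  have i34 : Integrable (fun ω => siteAvg ν h i f ω * f ω -
    siteAvg ν h i f ω * siteAvg ν h i f ω) (gibbs ν h) := i3.sub i4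
  rw [integral_sub i12 i34, integral_sub i1 i2, integral_sub i3 i4,
    hh.integral_siteAvg_mul ν i hf hf]
  ring

omit hh in
/-- A function with oscillation at most `δ` lies within `δ / 2` of a constant. -/
theorem exists_abs_sub_le_half [Nonempty Y] {F : Y → ℝ} {δ : ℝ} (hF : ∀ q q', |F q - F q'| ≤ δ) :
    ∃ m, ∀ q, |F q - m| ≤ δ / 2 := by
  obtain ⟨q₀⟩ := ‹Nonempty Y›
  have hub : BddAbove (Set.range F) := ⟨F q₀ + δ, by
    rintro _ ⟨q, rfl⟩; linarith [(abs_le.1 (hF q q₀)).2]⟩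
  have hlb : BddBelow (Set.range F) := ⟨F q₀ - δ, by
    rintro _ ⟨q, rfl⟩; linarith [(abs_le.1 (hF q q₀)).1]⟩
  have : Nonempty Y := ⟨q₀⟩
  have h1 : (⨆ q, F q) ≤ (⨅ q, F q) + δ := by
    refine ciSup_le fun q => ?_
    have : F q - δ ≤ ⨅ q, F q := le_ciInf fun q' => by linarith [(abs_le.1 (hF q q')).2]
    linarith
  refine ⟨((⨆ q, F q) + ⨅ q, F q) / 2, fun q => ?_⟩
  have h2 := le_ciSup hub q
  have h3 := ciInf_le hlb q
  rw [abs_le]; constructor <;> linarith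

/-- The influence of the density on averages over one coordinate. -/
theorem abs_weighted_avg_sub_le {μ : Measure Y} [IsFiniteMeasure μ] {g g' F : Y → ℝ} {κ δ : ℝ}
    (hg : Integrable g μ) (hg' : Integrable g' μ) (hgF : Integrable (fun q => g q * F q) μ)
    (hgF' : Integrable (fun q => g' q * F q) μ)
    (hZ : 0 < ∫ q, g q ∂μ) (hZ' : 0 < ∫ q, g' q ∂μ) (hg0 : ∀ q, 0 ≤ g q)
    (hκ : ∀ q q', g' q * g q' ≤ κ * (g q * g' q')) (hκ' : 1 ≤ κ)
    (hF : ∀ q q', |F q - F q'| ≤ δ) :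
    |(∫ q, g' q * F q ∂μ) / (∫ q, g' q ∂μ) - (∫ q, g q * F q ∂μ) / ∫ q, g q ∂μ| ≤
      (κ - 1) / 2 * δ := by
  set Z := ∫ q, g q ∂μ
  set Z' := ∫ q, g' q ∂μ
  rcases isEmpty_or_nonempty Y with hY | hY
  · have : Z = 0 := by
      have hμ : μ = 0 := Measure.eq_zero_of_isEmpty μ
      simp [Z, hμ]
    linarith
  obtain ⟨m, hm⟩ := exists_abs_sub_le_half hF
  have up : ∀ q, g' q * Z ≤ κ * (g q * Z') := by
    intro q
    have := integral_mono (hg.const_mul (g' q)) ((hg'.const_mul (κ * g q)))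
      (fun q' => by have := hκ q q'; simp only; linarith)
    rw [integral_const_mul, integral_const_mul] at this
    linarith
  have low : ∀ q, Z' * g q ≤ κ * (Z * g' q) := by
    intro q
    have := integral_mono (hg'.mul_const (g q)) ((hg.mul_const (κ * g' q)))
      (fun q' => by have := hκ q' q; simp only; linarith)
    rw [integral_mul_const, integral_mul_const] at this
    linarith
  -- The two normalized densities are within a factor `κ` of each other in both directions. The
  -- lower bound `1/κ - 1` is absorbed because `1 - 1/κ ≤ κ - 1`.
  have hρ : ∀ q, |g' q / Z' - g q / Z| ≤ (κ - 1) * (g q / Z) := by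
    intro q
    have e1 : g' q / Z' ≤ κ * (g q / Z) := by
      rw [← mul_div_assoc, div_le_div_iff₀ hZ' hZ]; linarith [up q]
    have e2 : g q / Z ≤ κ * (g' q / Z') := by
      rw [← mul_div_assoc, div_le_div_iff₀ hZ hZ']; linarith [low q]
    have e3 : 0 ≤ g q / Z := div_nonneg (hg0 q) hZ.le
    rw [abs_le]
    constructor
    · nlinarith [mul_nonneg (sub_nonneg.2 hκ') e3]
    · linarith
  have i1 : Integrable (fun q => g' q / Z' - g q / Z) μ := (hg'.div_const _).sub (hg.div_const _)
  have i2 : Integrable (fun q => g' q * F q / Z' - g q * F q / Z) μ :=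
    (hgF'.div_const _).sub (hgF.div_const _)
  have e0 : ∫ q, (g' q / Z' - g q / Z) ∂μ = 0 := by
    rw [integral_sub (hg'.div_const _) (hg.div_const _), integral_div, integral_div,
      div_self hZ'.ne', div_self hZ.ne', sub_self]
  -- Both normalized densities have mass one, so `m` may be subtracted from `F` at no cost. Choosing
  -- the midpoint of the range of `F` produces the factor `1/2`.
  have e1 : (∫ q, g' q * F q ∂μ) / Z' - (∫ q, g q * F q ∂μ) / Z =
      ∫ q, (g' q / Z' - g q / Z) * (F q - m) ∂μ := by
    have e2 : ∀ q, (g' q / Z' - g q / Z) * (F q - m) =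
        (g' q * F q / Z' - g q * F q / Z) - (g' q / Z' - g q / Z) * m := fun q => by ring
    simp_rw [e2]
    rw [integral_sub i2 (i1.mul_const m), integral_mul_const, e0,
      integral_sub (hgF'.div_const _) (hgF.div_const _), integral_div, integral_div]
    ring
  rw [e1, ← Real.norm_eq_abs]
  calc _ ≤ ∫ q, (κ - 1) * (δ / 2) / Z * g q ∂μ := by
        refine norm_integral_le_of_norm_le (hg.const_mul _) (Eventually.of_forall fun q => ?_)
        rw [norm_mul]
        calc _ ≤ ((κ - 1) * (g q / Z)) * (δ / 2) :=
              mul_le_mul (hρ q) (hm q) (abs_nonneg _)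
                (mul_nonneg (sub_nonneg.2 hκ') (div_nonneg (hg0 q) hZ.le))
          _ = _ := by ring
    _ = (κ - 1) / 2 * δ := by
        rw [integral_const_mul]
        change (κ - 1) * (δ / 2) / Z * Z = _
        field_simp

/-- Conditional averages of a Gibbs measure form a Dobrushin system. -/
theorem dobrushinSystem {κ : ι → ι → ℝ} (hκ1 : ∀ i j, 1 ≤ κ i j)
    (hκ : ∀ i j, j ≠ i → ∀ ω y q q',
      h (Function.update (Function.update ω j y) i q) * h (Function.update ω i q') ≤
        κ i j * (h (Function.update ω i q) * h (Function.update (Function.update ω j y) i q'))) :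
    DobrushinSystem (gibbs ν h) (siteAvg ν h) fun i j => (κ i j - 1) / 2 where
  bddMeas i f hf := hh.bddMeas_siteAvg ν i hf
  symm i f g hf hg := by
    rw [hh.integral_siteAvg_mul ν i hf hg]
    simp_rw [mul_comm (f _), hh.integral_siteAvg_mul ν i hg hf, mul_comm]
  mean i f hf := hh.integral_siteAvg ν i hf
  coeff_nonneg i j := by linarith [hκ1 i j]
  osc i f δ hf hδ := by
    intro j ω y
    simp only
    split_ifs with hij
    · subst hij
      rw [siteAvg_update, sub_self, abs_zero]
    · set ω' := Function.update ω j y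
      have hb : ∀ ω, Integrable (fun q => h (Function.update ω i q) * f (Function.update ω i q))
          (ν i) := fun ω => integrable_update ν (BddMeas.mul hh.bddMeas hf) i ω
      have hF : ∀ q, |f (Function.update ω' i q) - f (Function.update ω i q)| ≤ δ j := by
        intro q
        have := hδ j (Function.update ω i q) y
        rwa [Function.update_comm (Ne.symm hij)] at this
      -- Changing coordinate `j` affects both the integrand and the weights. The intermediate
      -- average has the weights of `ω'` and the integrand of `ω`: the first replacement costs `δ
      -- j`, the second the influence of the weights times `δ i`.
      have hmix : Integrable (fun q => h (Function.update ω' i q) * f (Function.update ω i q))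
          (ν i) := by
        obtain ⟨M, hM⟩ := hf.2
        obtain ⟨M', hM'⟩ := hh.bddMeas.2
        refine Integrable.of_bound ((hh.measurable.comp (measurable_update ω')).mul
          (hf.1.comp (measurable_update ω))).aestronglyMeasurable (M' * M)
          (Eventually.of_forall fun q => ?_)
        rw [norm_mul]
        exact mul_le_mul (hM' _) (hM _) (norm_nonneg _) ((abs_nonneg _).trans (hM' ω))
      have hZ' := hh.condMass_pos ν i ω'
      have t1 : |siteAvg ν h i f ω' - (∫ q, h (Function.update ω' i q) *
          f (Function.update ω i q) ∂(ν i)) / ∫ q, h (Function.update ω' i q) ∂(ν i)| ≤ δ j := by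
        rw [siteAvg, ← sub_div, abs_div, abs_of_pos hZ', div_le_iff₀ hZ', ← integral_sub (hb ω') hmix,
          ← Real.norm_eq_abs, ← integral_const_mul]
        refine norm_integral_le_of_norm_le ((integrable_update ν hh.bddMeas i ω').const_mul _)
          (Eventually.of_forall fun q => ?_)
        rw [← mul_sub, norm_mul, Real.norm_of_nonneg (hh.nonneg _), mul_comm]
        exact mul_le_mul_of_nonneg_right (hF q) (hh.nonneg _)
      have t2 := hh.abs_weighted_avg_sub_le (μ := ν i) (g := fun q => h (Function.update ω i q))
        (g' := fun q => h (Function.update ω' i q)) (F := fun q => f (Function.update ω i q))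
        (κ := κ i j) (δ := δ i)
        (integrable_update ν hh.bddMeas i ω) (integrable_update ν hh.bddMeas i ω') (hb ω) hmix
        (hh.condMass_pos ν i ω) hZ' (fun q => hh.nonneg _) (fun q q' => hκ i j hij ω y q q')
        (hκ1 i j) (fun q q' => by
          have := hδ i (Function.update ω i q') q
          rwa [Function.update_idem] at this)
      exact (_root_.abs_sub_le _ _ _).trans (add_le_add t1 t2)

end GibbsDensity
end Tensorization

/-! ### Measurability on configuration space and the Poisson law -/

namespace TransverseField

variable {β : ℝ}

theorem measurable_ncard_inter {B : Set (Set.Ico (0 : ℝ) β)} (hB : MeasurableSet B) :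
    Measurable fun v : Config β => ((v.pts : Set (Set.Ico (0 : ℝ) β)) ∩ B).ncard := by
  rw [measurable_iff_comap_le]
  exact le_iSup (fun B : {B : Set (Set.Ico (0 : ℝ) β) // MeasurableSet B} =>
    MeasurableSpace.comap (fun v : Config β => ((v.pts : Set (Set.Ico (0 : ℝ) β)) ∩ B.1).ncard) ⊤)
    ⟨B, hB⟩

/-- The sum of the unit masses at the points of a configuration. -/
def ptsMeasure (v : Config β) : Measure (Set.Ico (0 : ℝ) β) := ∑ x ∈ v.pts, Measure.dirac x

theorem lintegral_ptsMeasure (v : Config β) {F : Set.Ico (0 : ℝ) β → ℝ≥0∞} (hF : Measurable F) :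
    ∫⁻ x, F x ∂(ptsMeasure v) = ∑ x ∈ v.pts, F x := by
  rw [ptsMeasure, lintegral_finsetSum_measure]
  simp [lintegral_dirac' _ hF]

theorem ptsMeasure_apply (v : Config β) {B : Set (Set.Ico (0 : ℝ) β)} (hB : MeasurableSet B) :
    ptsMeasure v B = ∑ x ∈ v.pts, B.indicator 1 x := by
  rw [← lintegral_indicator_one hB, lintegral_ptsMeasure v (measurable_one.indicator hB)]

theorem ptsMeasure_apply_eq_ncard (v : Config β) {B : Set (Set.Ico (0 : ℝ) β)}
    (hB : MeasurableSet B) :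
    ptsMeasure v B = (((v.pts : Set (Set.Ico (0 : ℝ) β)) ∩ B).ncard : ℝ≥0∞) := by
  classical
  have h : (v.pts : Set (Set.Ico (0 : ℝ) β)) ∩ B = ((v.pts.filter (· ∈ B) : Finset _) : Set _) := by
    ext x; simp
  rw [ptsMeasure_apply v hB, h, Set.ncard_coe_finset, Finset.card_filter]
  push_cast
  refine Finset.sum_congr rfl fun x _ => ?_
  simp [Set.indicator_apply]

theorem measurable_ptsMeasure : Measurable (ptsMeasure (β := β)) := by
  refine Measure.measurable_of_measurable_coe _ fun B hB => ?_
  simp_rw [ptsMeasure_apply_eq_ncard _ hB]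
  exact (measurable_of_countable (fun n : ℕ => (n : ℝ≥0∞))).comp (measurable_ncard_inter hB)

/-- The points of a configuration, as a kernel. -/
def ptsKernel (β : ℝ) : Kernel (Config β) (Set.Ico (0 : ℝ) β) := ⟨ptsMeasure, measurable_ptsMeasure⟩

instance : IsSFiniteKernel (ptsKernel β) :=
  isSFiniteKernel_of_forall_isFiniteMeasure _ fun v => by
    change ptsMeasure v Set.univ < ∞
    rw [ptsMeasure_apply v .univ]
    simp

/-- A sum over the points is an integral against the s-finite kernel `ptsKernel`, so no measurable
enumeration of the points is needed. -/
theorem measurable_sum_pts {A : Type*} [MeasurableSpace A] {ξ : A → Config β} (hξ : Measurable ξ)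
    {F : A × Set.Ico (0 : ℝ) β → ℝ≥0∞} (hF : Measurable F) :
    Measurable fun a => ∑ x ∈ (ξ a).pts, F (a, x) := by
  have h := Measurable.lintegral_kernel_prod_right (κ := (ptsKernel β).comap ξ hξ)
    (f := fun a x => F (a, x)) hF
  convert h using 2 with a
  rw [Kernel.comap_apply]
  exact (lintegral_ptsMeasure _ (hF.comp measurable_prodMk_left)).symm

theorem measurable_config {A : Type*} [MeasurableSpace A] {ξ : A → Config β}
    (h : ∀ B, MeasurableSet B → Measurable fun a => ptsMeasure (ξ a) B) : Measurable ξ := by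
  rw [measurable_iff_comap_le]
  change MeasurableSpace.comap ξ (⨆ B : {B : Set (Set.Ico (0 : ℝ) β) // MeasurableSet B}, _) ≤ _
  rw [MeasurableSpace.comap_iSup]
  refine iSup_le fun B => ?_
  rw [MeasurableSpace.comap_comp, ← measurable_iff_comap_le]
  refine measurable_to_countable' fun n => ?_
  have : ((fun v : Config β => ((v.pts : Set (Set.Ico (0 : ℝ) β)) ∩ B.1).ncard) ∘ ξ) ⁻¹' {n} =
      (fun a => ptsMeasure (ξ a) B.1) ⁻¹' {(n : ℝ≥0∞)} := by
    ext a
    simp [ptsMeasure_apply_eq_ncard _ B.2]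
  rw [this]
  exact h B.1 B.2 (measurableSet_singleton _)

/-- The count in `B` is that of the points other than `x`, plus that of `x`. This is right whether
or not `x` was already present. -/
theorem measurable_insert {A : Type*} [MeasurableSpace A] {ξ : A → Config β} (hξ : Measurable ξ)
    {x : A → Set.Ico (0 : ℝ) β} (hx : Measurable x) :
    Measurable fun a => (⟨insert (x a) (ξ a).pts⟩ : Config β) := by
  classical
  refine measurable_config fun B hB => ?_
  have h1 := measurable_sum_pts hξ (F := fun p => {p : A × Set.Ico (0 : ℝ) β | p.2 ≠ x p.1 ∧
    p.2 ∈ B}.indicator 1 p) (measurable_one.indicator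
      ((measurableSet_eq_fun measurable_snd (hx.comp measurable_fst)).compl.inter
        (measurable_snd hB)))
  have h2 : Measurable fun a => B.indicator (1 : Set.Ico (0 : ℝ) β → ℝ≥0∞) (x a) :=
    (measurable_one.indicator hB).comp hx
  convert h1.add h2 using 2 with a
  rw [ptsMeasure_apply _ hB]
  rw [← Finset.insert_erase (Finset.mem_insert_self (x a) (ξ a).pts),
    Finset.sum_insert (Finset.notMem_erase _ _), add_comm]
  congr 1
  rw [Finset.erase_insert_eq_erase, ← Finset.filter_ne', Finset.sum_filter]
  refine Finset.sum_congr rfl fun y _ => ?_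
  by_cases hy : y = x a <;> simp [Set.indicator_apply, hy]

theorem measurable_erase {A : Type*} [MeasurableSpace A] {ξ : A → Config β} (hξ : Measurable ξ)
    {x : A → Set.Ico (0 : ℝ) β} (hx : Measurable x) :
    Measurable fun a => (⟨(ξ a).pts.erase (x a)⟩ : Config β) := by
  classical
  refine measurable_config fun B hB => ?_
  have h1 := measurable_sum_pts hξ (F := fun p => {p : A × Set.Ico (0 : ℝ) β | p.2 ≠ x p.1 ∧
    p.2 ∈ B}.indicator 1 p) (measurable_one.indicator
      ((measurableSet_eq_fun measurable_snd (hx.comp measurable_fst)).compl.inter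
        (measurable_snd hB)))
  convert h1 using 2 with a
  rw [ptsMeasure_apply _ hB]
  rw [← Finset.filter_ne', Finset.sum_filter]
  refine Finset.sum_congr rfl fun y _ => ?_
  by_cases hy : y = x a <;> simp [Set.indicator_apply, hy]

theorem measurable_image {ι : Type*} (s : Finset ι) :
    Measurable fun z : ι → Set.Ico (0 : ℝ) β => (⟨s.image z⟩ : Config β) := by
  classical
  induction s using Finset.induction with
  | empty => simp only [Finset.image_empty]; exact measurable_const
  | insert i s _ ih =>
    simp only [Finset.image_insert]
    exact measurable_insert ih (measurable_pi_apply i)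

theorem leb_apply {B : Set (Set.Ico (0 : ℝ) β)} :
    leb β B = volume ((fun x : Set.Ico (0 : ℝ) β => (x : ℝ)) '' B) :=
  (MeasurableEmbedding.subtype_coe measurableSet_Ico).comap_apply _ _

theorem leb_univ (β : ℝ) : leb β Set.univ = ENNReal.ofReal β := by
  rw [leb_apply, Set.image_univ, Subtype.range_coe, Real.volume_Ico, sub_zero]

instance : IsFiniteMeasure (leb β) :=
  ⟨by rw [leb_univ]; exact ENNReal.ofReal_lt_top⟩

instance : NullSingletonClass (leb β) := ⟨fun x => by rw [leb_apply]; simp⟩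

theorem lintegral_poisson (a : ℝ) {F : Config β → ℝ≥0∞} (hF : Measurable F) :
    ∫⁻ ξ, F ξ ∂(poisson β a) = ENNReal.ofReal (Real.exp (-(a * β))) *
      ∑' n : ℕ, ENNReal.ofReal (a ^ n / n.factorial) *
        ∫⁻ x : Fin n → Set.Ico (0 : ℝ) β, F ⟨Finset.univ.image x⟩ ∂(Measure.pi fun _ => leb β) := by
  rw [poisson, lintegral_smul_measure, lintegral_sum_measure, smul_eq_mul]
  congr 2; ext n
  rw [lintegral_smul_measure, smul_eq_mul, lintegral_map hF (measurable_image _)]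

theorem poisson_univ (hβ : 0 ≤ β) {a : ℝ} (ha : 0 ≤ a) : poisson β a Set.univ = 1 := by
  rw [← lintegral_one, lintegral_poisson a measurable_const]
  have h : ∀ n : ℕ, ENNReal.ofReal (a ^ n / n.factorial) * ∫⁻ _ : Fin n → Set.Ico (0 : ℝ) β,
      1 ∂(Measure.pi fun _ => leb β) =
      ENNReal.ofReal ((a * β) ^ n / n.factorial) := by
    intro n
    simp only [lintegral_one, Measure.pi_univ, leb_univ, Finset.prod_const,
      Finset.card_univ, Fintype.card_fin]
    rw [← ENNReal.ofReal_pow hβ, ← ENNReal.ofReal_mul (by positivity)]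
    congr 1; rw [mul_pow]; ring
  simp_rw [h]
  rw [← ENNReal.ofReal_tsum_of_nonneg (fun n => by positivity)
    (Real.summable_pow_div_factorial _), ← ENNReal.ofReal_mul (Real.exp_nonneg _)]
  have := congrFun (Real.exp_eq_exp_ℝ) (a * β)
  rw [NormedSpace.exp_eq_tsum_div] at this
  beta_reduce at this
  rw [← this, ← Real.exp_add]
  simp

theorem isProbabilityMeasure_poisson (hβ : 0 ≤ β) {a : ℝ} (ha : 0 ≤ a) :
    IsProbabilityMeasure (poisson β a) := ⟨poisson_univ hβ ha⟩

/-- A configuration is a set and forgets multiplicities. This ensures that `n` sampled points almost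
surely give `n` distinct points. -/
theorem ae_injective_pi (ι : Type*) [Fintype ι] :
    ∀ᵐ z ∂(Measure.pi fun _ : ι => leb β), Function.Injective z := by
  classical
  have h : ∀ i j : ι, i ≠ j → ∀ᵐ z ∂(Measure.pi fun _ : ι => leb β),
      z i ≠ z j := by
    intro i j hij
    have hm : MeasurableSet {z : ι → Set.Ico (0 : ℝ) β | z i = z j} :=
      measurableSet_eq_fun (measurable_pi_apply i) (measurable_pi_apply j)
    rw [ae_iff]
    simp only [not_not]
    rw [← lintegral_indicator_one hm, ← lintegral_zero (μ := Measure.pi fun _ : ι => leb β)]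
    refine lintegral_eq_of_lmarginal_eq {i} (measurable_one.indicator hm) measurable_const ?_
    rw [lmarginal_singleton, lmarginal_singleton]
    ext z
    have e : ∀ q, {z : ι → Set.Ico (0 : ℝ) β | z i = z j}.indicator (1 : (ι → Set.Ico (0 : ℝ) β) → ℝ≥0∞)
        (Function.update z i q) = ({z j} : Set (Set.Ico (0 : ℝ) β)).indicator 1 q := by
      intro q
      simp [Set.indicator_apply, Function.update_of_ne hij.symm]
    simp_rw [e]
    rw [lintegral_indicator_one (measurableSet_singleton _)]
    simp
  have h2 : ∀ᵐ z ∂(Measure.pi fun _ : ι => leb β),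
      ∀ i j, i ≠ j → z i ≠ z j := by
    rw [ae_all_iff]; intro i
    rw [ae_all_iff]; intro j
    by_cases hij : i = j
    · simp [hij]
    · filter_upwards [h i j hij] with z hz _ using hz
  filter_upwards [h2] with z hz i j hij
  by_contra hne
  exact hz i j hne hij

end TransverseField

/-! ### The Mecke formula and the superposition of Poisson processes -/

namespace TransverseField

variable {β : ℝ}

theorem sum_image_erase {n : ℕ} {x : Fin (n + 1) → Set.Ico (0 : ℝ) β} (hx : Function.Injective x)
    (F : Config β × Set.Ico (0 : ℝ) β → ℝ≥0∞) :
    ∑ y ∈ Finset.univ.image x, F (⟨(Finset.univ.image x).erase y⟩, y) =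
      ∑ i, F (⟨Finset.univ.image fun j => x (i.succAbove j)⟩, x i) := by
  rw [Finset.sum_image fun i _ j _ h => hx h]
  refine Finset.sum_congr rfl fun i _ => ?_
  congr 3
  ext y
  simp only [Finset.mem_erase, Finset.mem_image, Finset.mem_univ, true_and]
  constructor
  · rintro ⟨h1, j, rfl⟩
    obtain ⟨k, rfl⟩ := Fin.exists_succAbove_eq (x := j) (y := i) fun h => h1 (by rw [h])
    exact ⟨k, rfl⟩
  · rintro ⟨k, rfl⟩
    exact ⟨fun h => Fin.succAbove_ne i k (hx h), _, rfl⟩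

/-- The Mecke formula. -/
theorem lintegral_poisson_sum (a : ℝ) (ha : 0 ≤ a) {F : Config β × Set.Ico (0 : ℝ) β → ℝ≥0∞}
    (hF : Measurable F) :
    ∫⁻ ξ, ∑ x ∈ ξ.pts, F (⟨ξ.pts.erase x⟩, x) ∂(poisson β a) =
      ENNReal.ofReal a * ∫⁻ ξ, ∫⁻ x, F (ξ, x) ∂(leb β) ∂(poisson β a) := by
  have hm : Measurable fun ξ : Config β => ∑ x ∈ ξ.pts, F (⟨ξ.pts.erase x⟩, x) :=
    measurable_sum_pts measurable_id
      (F := fun p : Config β × Set.Ico (0 : ℝ) β => F (⟨p.1.pts.erase p.2⟩, p.2))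
      (hF.comp ((measurable_erase measurable_fst measurable_snd).prodMk measurable_snd))
  have hm2 : Measurable fun ξ : Config β => ∫⁻ x, F (ξ, x) ∂(leb β) :=
    Measurable.lintegral_prod_right' hF
  rw [lintegral_poisson a hm, lintegral_poisson a hm2, ← mul_assoc,
    mul_comm (ENNReal.ofReal a), mul_assoc]
  congr 1
  rw [← ENNReal.tsum_mul_left, tsum_eq_zero_add' ENNReal.summable]
  have h0 : ∫⁻ x : Fin 0 → Set.Ico (0 : ℝ) β, ∑ y ∈ Finset.univ.image x,
      F (⟨(Finset.univ.image x).erase y⟩, y) ∂(Measure.pi fun _ => leb β) = 0 := by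
    simp
  rw [h0, mul_zero, zero_add]
  congr 1; ext n
  -- By exchangeability the `n + 1` choices of the distinguished point contribute equally. The
  -- factor `n + 1` turns `aⁿ⁺¹/(n+1)!` into `a · aⁿ/n!`.
  have h1 : ∫⁻ x : Fin (n + 1) → Set.Ico (0 : ℝ) β, ∑ y ∈ Finset.univ.image x,
      F (⟨(Finset.univ.image x).erase y⟩, y) ∂(Measure.pi fun _ => leb β) =
      (n + 1 : ℕ) * ∫⁻ x : Fin n → Set.Ico (0 : ℝ) β, ∫⁻ y, F (⟨Finset.univ.image x⟩, y) ∂(leb β)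
        ∂(Measure.pi fun _ => leb β) := by
    calc _ = ∫⁻ x : Fin (n + 1) → Set.Ico (0 : ℝ) β,
          ∑ i, F (⟨Finset.univ.image fun j => x (i.succAbove j)⟩, x i)
            ∂(Measure.pi fun _ => leb β) := by
          refine lintegral_congr_ae ?_
          filter_upwards [ae_injective_pi (Fin (n + 1))] with x hx
          exact sum_image_erase hx F
      _ = ∑ i : Fin (n + 1), ∫⁻ x : Fin (n + 1) → Set.Ico (0 : ℝ) β,
            F (⟨Finset.univ.image fun j => x (i.succAbove j)⟩, x i)
              ∂(Measure.pi fun _ => leb β) := by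
          refine lintegral_finsetSum _ fun i _ => hF.comp (Measurable.prodMk ?_
            (measurable_pi_apply i))
          exact (measurable_image Finset.univ).comp (measurable_pi_lambda _ fun j =>
            measurable_pi_apply _)
      _ = ∑ i : Fin (n + 1), ∫⁻ x : Fin n → Set.Ico (0 : ℝ) β,
            ∫⁻ y, F (⟨Finset.univ.image x⟩, y) ∂(leb β) ∂(Measure.pi fun _ => leb β) := by
          refine Finset.sum_congr rfl fun i _ => ?_
          have hG : Measurable fun p : Set.Ico (0 : ℝ) β × (Fin n → Set.Ico (0 : ℝ) β) =>
              F (⟨Finset.univ.image p.2⟩, p.1) :=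
            hF.comp (((measurable_image Finset.univ).comp measurable_snd).prodMk measurable_fst)
          have hp := (measurePreserving_piFinSuccAbove
            (fun _ : Fin (n + 1) => leb β) i).lintegral_comp hG
          rw [← lintegral_prod_symm' _ hG]
          exact hp
      _ = _ := by rw [Finset.sum_const, Finset.card_univ, Fintype.card_fin, nsmul_eq_mul]
  rw [h1, ← mul_assoc, ← mul_assoc]
  congr 1
  rw [← ENNReal.ofReal_natCast, ← ENNReal.ofReal_mul (by positivity), ← ENNReal.ofReal_mul ha]
  congr 1
  rw [Nat.factorial_succ]
  push_cast
  have : (n : ℝ) + 1 ≠ 0 := by positivity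
  field_simp
  ring

theorem lintegral_pi_image_eq {κ : Type*} [Fintype κ] (F : Config β → ℝ≥0∞) (n : ℕ)
    (hn : Fintype.card κ = n) :
    ∫⁻ z : κ → Set.Ico (0 : ℝ) β, F ⟨Finset.univ.image z⟩ ∂(Measure.pi fun _ => leb β) =
      ∫⁻ x : Fin n → Set.Ico (0 : ℝ) β, F ⟨Finset.univ.image x⟩ ∂(Measure.pi fun _ => leb β) := by
  let e : Fin n ≃ κ := (Fintype.equivFinOfCardEq hn).symm
  have hp := (measurePreserving_piCongrLeft (fun _ : κ => leb β) e).lintegral_comp_emb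
    (MeasurableEquiv.measurableEmbedding _)
    (fun z : κ → Set.Ico (0 : ℝ) β => F ⟨Finset.univ.image z⟩)
  rw [← hp]
  congr 1; ext x
  congr 2
  ext y
  simp only [Finset.mem_image, Finset.mem_univ, true_and]
  have hx : ∀ i, (MeasurableEquiv.piCongrLeft (fun _ : κ => Set.Ico (0 : ℝ) β) e) x (e i) = x i :=
    fun i => MeasurableEquiv.piCongrLeft_apply_apply (β := fun _ : κ => Set.Ico (0 : ℝ) β) e x i
  constructor
  · rintro ⟨k, rfl⟩
    exact ⟨e.symm k, by rw [← hx, e.apply_symm_apply]⟩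
  · rintro ⟨i, rfl⟩
    exact ⟨e i, hx i⟩

/-- Integrals over the points with indices in `S` and those with indices outside `S`. -/
theorem lintegral_pi_image_compl {N : ℕ} (S : Finset (Fin N)) {F : Config β × Config β → ℝ≥0∞}
    (hF : Measurable F) :
    ∫⁻ z : Fin N → Set.Ico (0 : ℝ) β, F (⟨S.image z⟩, ⟨Sᶜ.image z⟩) ∂(Measure.pi fun _ => leb β) =
      ∫⁻ x : Fin S.card → Set.Ico (0 : ℝ) β, ∫⁻ y : Fin (N - S.card) → Set.Ico (0 : ℝ) β,
        F (⟨Finset.univ.image x⟩, ⟨Finset.univ.image y⟩)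
          ∂(Measure.pi fun _ => leb β) ∂(Measure.pi fun _ => leb β) := by
  have hp := (measurePreserving_piEquivPiSubtypeProd (fun _ : Fin N => leb β)
    (· ∈ S)).lintegral_comp_emb (MeasurableEquiv.measurableEmbedding _)
    (fun p => F (⟨Finset.univ.image p.1⟩, ⟨Finset.univ.image p.2⟩))
  have e : ∀ z : Fin N → Set.Ico (0 : ℝ) β, F (⟨S.image z⟩, ⟨Sᶜ.image z⟩) =
      (fun p : (∀ _ : {i // i ∈ S}, Set.Ico (0 : ℝ) β) × (∀ _ : {i // i ∉ S}, Set.Ico (0 : ℝ) β) =>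
        F (⟨Finset.univ.image p.1⟩, ⟨Finset.univ.image p.2⟩))
        (MeasurableEquiv.piEquivPiSubtypeProd (fun _ : Fin N => Set.Ico (0 : ℝ) β) (· ∈ S) z) := by
    intro z
    simp only [MeasurableEquiv.piEquivPiSubtypeProd, MeasurableEquiv.coe_mk,
      Equiv.piEquivPiSubtypeProd_apply]
    congr 3
    · ext y; simp
    · ext y; simp
  simp_rw [e]
  rw [hp, lintegral_prod]
  · have h1 : ∀ x : Config β, ∫⁻ y : {i // i ∉ S} → Set.Ico (0 : ℝ) β,
        F (x, ⟨Finset.univ.image y⟩) ∂(Measure.pi fun _ => leb β) =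
        ∫⁻ y : Fin (N - S.card) → Set.Ico (0 : ℝ) β,
        F (x, ⟨Finset.univ.image y⟩) ∂(Measure.pi fun _ => leb β) := fun x =>
      lintegral_pi_image_eq (fun ξ => F (x, ξ)) _ (by
        rw [Fintype.card_of_subtype Sᶜ (by simp), Finset.card_compl, Fintype.card_fin])
    refine (lintegral_congr fun x => h1 ⟨Finset.univ.image x⟩).trans ?_
    convert lintegral_pi_image_eq (fun ξ => ∫⁻ y : Fin (N - S.card) → Set.Ico (0 : ℝ) β,
        F (ξ, ⟨Finset.univ.image y⟩) ∂(Measure.pi fun _ => leb β)) _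
      (Fintype.card_coe S)
  · refine (hF.comp ?_).aemeasurable
    exact ((measurable_image Finset.univ).comp measurable_fst).prodMk
      ((measurable_image Finset.univ).comp measurable_snd)

/-- The superposition of two independent Poisson processes of the same intensity, in which every
point belongs to either of them according to a fair coin. -/
theorem lintegral_poisson_poisson (a : ℝ) (ha : 0 ≤ a) {F : Config β × Config β → ℝ≥0∞}
    (hF : Measurable F) :
    ∫⁻ ξ, ∫⁻ ξ', F (ξ, ξ') ∂(poisson β a) ∂(poisson β a) =
      ENNReal.ofReal (Real.exp (-(a * β))) ^ 2 * ∑' N : ℕ, ENNReal.ofReal (a ^ N / N.factorial) *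
        ∫⁻ z : Fin N → Set.Ico (0 : ℝ) β, ∑ S ∈ (Finset.univ : Finset (Fin N)).powerset,
          F (⟨S.image z⟩, ⟨Sᶜ.image z⟩) ∂(Measure.pi fun _ => leb β) := by
  set G : ℕ → ℕ → ℝ≥0∞ := fun n m =>
    ∫⁻ x : Fin n → Set.Ico (0 : ℝ) β, ∫⁻ y : Fin m → Set.Ico (0 : ℝ) β,
      F (⟨Finset.univ.image x⟩, ⟨Finset.univ.image y⟩)
        ∂(Measure.pi fun _ => leb β) ∂(Measure.pi fun _ => leb β) with hG
  set p : ℕ → ℝ≥0∞ := fun n => ENNReal.ofReal (a ^ n / n.factorial) with hp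
  set E := ENNReal.ofReal (Real.exp (-(a * β))) with hE
  -- The binomial coefficient counts the ways to choose which `n` of the `n + m` points belong to
  -- the first process. It becomes the sum over the subsets `S`.
  have hpp : ∀ n m, p n * p m = p (n + m) * ((n + m).choose n : ℝ≥0∞) := by
    intro n m
    rw [hp]; simp only
    rw [← ENNReal.ofReal_natCast, ← ENNReal.ofReal_mul (by positivity),
      ← ENNReal.ofReal_mul (by positivity)]
    congr 1
    rw [Nat.cast_choose ℝ (Nat.le_add_right n m), Nat.add_sub_cancel_left]
    field_simp
    ring
  have hinner : ∀ ξ, ∫⁻ ξ', F (ξ, ξ') ∂(poisson β a) = E * ∑' m, p m *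
      ∫⁻ y : Fin m → Set.Ico (0 : ℝ) β, F (ξ, ⟨Finset.univ.image y⟩)
        ∂(Measure.pi fun _ => leb β) := fun ξ =>
    lintegral_poisson a (hF.comp measurable_prodMk_left)
  have hmi : ∀ m, Measurable fun ξ : Config β => ∫⁻ y : Fin m → Set.Ico (0 : ℝ) β,
      F (ξ, ⟨Finset.univ.image y⟩) ∂(Measure.pi fun _ => leb β) := fun m =>
    Measurable.lintegral_prod_right' (f := fun q : Config β × (Fin m → Set.Ico (0 : ℝ) β) =>
      F (q.1, ⟨Finset.univ.image q.2⟩))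
      (hF.comp (measurable_fst.prodMk ((measurable_image Finset.univ).comp measurable_snd)))
  have hLHS : ∫⁻ ξ, ∫⁻ ξ', F (ξ, ξ') ∂(poisson β a) ∂(poisson β a) =
      E ^ 2 * ∑' n, ∑' m, p n * p m * G n m := by
    simp_rw [hinner]
    rw [lintegral_const_mul _ (Measurable.tsum fun m => (hmi m).const_mul _),
      lintegral_tsum fun m => ((hmi m).const_mul _).aemeasurable, sq, mul_assoc]
    congr 1
    have : ∀ m, ∫⁻ ξ, p m * ∫⁻ y : Fin m → Set.Ico (0 : ℝ) β, F (ξ, ⟨Finset.univ.image y⟩)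
        ∂(Measure.pi fun _ => leb β) ∂(poisson β a) = E * ∑' n, p n * p m * G n m := by
      intro m
      rw [lintegral_const_mul _ (hmi m), lintegral_poisson a (hmi m), mul_left_comm,
        ← ENNReal.tsum_mul_left]
      congr 2; ext n
      rw [← mul_assoc, mul_comm (p m)]
    simp_rw [this]
    rw [ENNReal.tsum_mul_left, ENNReal.tsum_comm]
  rw [hLHS]
  congr 1
  -- The double series is regrouped by the total number `N = n + m` of points.
  rw [← ENNReal.tsum_prod (f := fun n m => p n * p m * G n m),
    ← (Finset.HasAntidiagonal.sigmaAntidiagonalEquivProd (A := ℕ)).tsum_eq, ENNReal.tsum_sigma']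
  congr 1; ext N
  have hS : ∫⁻ z : Fin N → Set.Ico (0 : ℝ) β, ∑ S ∈ (Finset.univ : Finset (Fin N)).powerset,
      F (⟨S.image z⟩, ⟨Sᶜ.image z⟩) ∂(Measure.pi fun _ => leb β) =
      ∑ S ∈ (Finset.univ : Finset (Fin N)).powerset, G S.card (N - S.card) := by
    rw [lintegral_finsetSum]
    · exact Finset.sum_congr rfl fun S _ => lintegral_pi_image_compl S hF
    · intro S _
      exact hF.comp ((measurable_image S).prodMk (measurable_image Sᶜ))
  rw [hS, Finset.sum_powerset_apply_card (fun k => G k (N - k)), Finset.mul_sum,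
    Finset.card_univ, Fintype.card_fin, tsum_fintype,
    Finset.univ_eq_attach]
  refine (Finset.sum_attach (Finset.HasAntidiagonal.antidiagonal N)
    (fun x => p x.1 * p x.2 * G x.1 x.2)).trans ?_
  rw [Finset.Nat.sum_antidiagonal_eq_sum_range_succ (fun n m => p n * p m * G n m)]
  refine Finset.sum_congr rfl fun n hn => ?_
  have hn' : n + (N - n) = N := by
    have := Finset.mem_range.1 hn
    omega
  rw [hpp, hn', nsmul_eq_mul, mul_assoc]

end TransverseField

/-! ### Variance inequalities on the cube of subsets -/

/-- The Poincaré inequality on the discrete cube of subsets of `s`. -/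
theorem Finset.sum_powerset_sq_le {α : Type*} [DecidableEq α] (s : Finset α) (h : Finset α → ℝ) :
    ∑ S ∈ s.powerset, h S ^ 2 - (∑ S ∈ s.powerset, h S) ^ 2 / 2 ^ s.card ≤
      1 / 2 * ∑ S ∈ s.powerset, ∑ i ∈ S, (h S - h (S.erase i)) ^ 2 := by
  induction s using Finset.induction generalizing h with
  | empty => simp
  | insert a s ha ih =>
    have ih1 := ih h
    have ih2 := ih fun S => h (insert a S)
    rw [Finset.sum_powerset_insert ha, Finset.sum_powerset_insert ha,
      Finset.sum_powerset_insert ha, Finset.card_insert_of_notMem ha]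
    have e1 : ∀ S ∈ s.powerset, ∑ i ∈ insert a S, (h (insert a S) - h ((insert a S).erase i)) ^ 2 =
        (h (insert a S) - h S) ^ 2 +
          ∑ i ∈ S, (h (insert a S) - h (insert a (S.erase i))) ^ 2 := by
      intro S hS
      have haS : a ∉ S := fun h' => ha (Finset.mem_powerset.1 hS h')
      rw [Finset.sum_insert haS, Finset.erase_insert haS]
      congr 1
      refine Finset.sum_congr rfl fun i hi => ?_
      rw [Finset.erase_insert_of_ne]
      rintro rfl; exact haS hi
    rw [Finset.sum_congr rfl e1, Finset.sum_add_distrib]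
    -- The two half-cubes `a ∉ S` and `a ∈ S` are covered by induction. What is missing is the
    -- difference of their means, which Cauchy–Schwarz bounds by the edges in direction `a`.
    have cs : (∑ S ∈ s.powerset, (h (insert a S) - h S)) ^ 2 ≤
        2 ^ s.card * ∑ S ∈ s.powerset, (h (insert a S) - h S) ^ 2 := by
      have := sq_sum_le_card_mul_sum_sq (s := s.powerset) (f := fun S => h (insert a S) - h S)
      rwa [Finset.card_powerset, Nat.cast_pow, Nat.cast_ofNat] at this
    rw [Finset.sum_sub_distrib] at cs
    set X := ∑ S ∈ s.powerset, h S
    set Y := ∑ S ∈ s.powerset, h (insert a S)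
    have hp : (0 : ℝ) < 2 ^ s.card := by positivity
    have cs' : (Y - X) ^ 2 / 2 ^ s.card ≤ ∑ S ∈ s.powerset, (h (insert a S) - h S) ^ 2 := by
      rw [div_le_iff₀ hp]; linarith
    have e2 : (X + Y) ^ 2 / 2 ^ (s.card + 1) =
        X ^ 2 / 2 ^ s.card + Y ^ 2 / 2 ^ s.card - 1 / 2 * ((Y - X) ^ 2 / 2 ^ s.card) := by
      rw [pow_succ]; field_simp; ring
    rw [e2]
    linarith

/-- `g S - g Sᶜ` has mean zero over the cube, so the Poincaré inequality bounds its whole square.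
Its gradient splits into those of `g` and of `g` after complementation, which have equal energy; the
constant is `1/2 · (2 + 2) = 2`. In the Poisson setting `S` and `Sᶜ` index the points of two
independent copies. -/
theorem Finset.sum_powerset_sub_compl_sq_le {α : Type*} [Fintype α] [DecidableEq α]
    (g : Finset α → ℝ) :
    ∑ S ∈ (Finset.univ : Finset α).powerset, (g S - g Sᶜ) ^ 2 ≤
      2 * ∑ S ∈ (Finset.univ : Finset α).powerset, ∑ i ∈ S, (g S - g (S.erase i)) ^ 2 := by
  have h := Finset.sum_powerset_sq_le (Finset.univ : Finset α) fun S => g S - g Sᶜ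
  have hinv : ∀ k : Finset α → ℝ, ∑ S ∈ (Finset.univ : Finset α).powerset, k Sᶜ =
      ∑ S ∈ (Finset.univ : Finset α).powerset, k S := by
    intro k
    rw [Finset.powerset_univ]
    exact Equiv.sum_comp (Function.Involutive.toPerm _ compl_involutive) k
  rw [Finset.sum_sub_distrib, hinv g, sub_self] at h
  have e1 : ∑ S ∈ (Finset.univ : Finset α).powerset,
      ∑ i ∈ S, (g S - g Sᶜ - (g (S.erase i) - g (S.erase i)ᶜ)) ^ 2 ≤
      ∑ S ∈ (Finset.univ : Finset α).powerset, ∑ i ∈ S, 2 * (g S - g (S.erase i)) ^ 2 +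
      ∑ S ∈ (Finset.univ : Finset α).powerset, ∑ i ∈ S, 2 * (g Sᶜ - g (S.erase i)ᶜ) ^ 2 := by
    rw [← Finset.sum_add_distrib]
    refine Finset.sum_le_sum fun S _ => ?_
    rw [← Finset.sum_add_distrib]
    refine Finset.sum_le_sum fun i _ => ?_
    nlinarith [sq_nonneg (g S - g (S.erase i) + (g Sᶜ - g (S.erase i)ᶜ))]
  have e2 : ∑ S ∈ (Finset.univ : Finset α).powerset, ∑ i ∈ S, 2 * (g Sᶜ - g (S.erase i)ᶜ) ^ 2 =
      ∑ S ∈ (Finset.univ : Finset α).powerset, ∑ i ∈ S, 2 * (g S - g (S.erase i)) ^ 2 := by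
    have swap : ∀ F : Finset α → α → ℝ, ∑ S ∈ (Finset.univ : Finset α).powerset, ∑ i ∈ S, F S i =
        ∑ i, ∑ S ∈ (Finset.univ : Finset α).powerset, if i ∈ S then F S i else 0 := by
      intro F
      rw [Finset.sum_comm]
      refine Finset.sum_congr rfl fun S _ => ?_
      rw [← Finset.sum_filter]
      congr 1; ext; simp
    rw [swap, swap]
    refine Finset.sum_congr rfl fun i _ => ?_
    rw [Finset.powerset_univ]
    -- Complementation sends the edge from `S.erase i` to `S` to the edge from `Sᶜ` to `(S.erase
    -- i)ᶜ`, so for `i ∈ S` the upper end of the image is `(S.erase i)ᶜ`. The value for `i ∉ S` only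
    -- makes the map an involution, since those terms vanish.
    let φ : Equiv.Perm (Finset α) := Function.Involutive.toPerm
      (fun S => if i ∈ S then (S.erase i)ᶜ else (insert i S)ᶜ) (by
        intro S
        by_cases hi : i ∈ S <;> simp [hi])
    rw [← Equiv.sum_comp φ]
    refine Finset.sum_congr rfl fun S _ => ?_
    have hφ : φ S = if i ∈ S then (S.erase i)ᶜ else (insert i S)ᶜ := rfl
    by_cases hi : i ∈ S
    · have h1 : ((S.erase i)ᶜ).erase i = Sᶜ := by
        ext x; by_cases hx : x = i <;> simp [hx, hi]
      simp only [hφ, hi, if_true]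
      rw [h1]
      simp
      ring
    · simp [hφ, hi]
  rw [e2] at e1
  simp_rw [← Finset.mul_sum] at e1
  simp only [ne_eq, OfNat.ofNat_ne_zero, not_false_eq_true, zero_pow, zero_div, sub_zero] at h
  linarith

/-! ### The Poincaré inequality for the Poisson process -/

namespace TransverseField

variable {β : ℝ}

/-- The Poincaré inequality for a Poisson process, with the variance written as an integral over
two independent copies. -/
theorem lintegral_poisson_sub_sq_le (hβ : 0 ≤ β) {a : ℝ} (ha : 0 ≤ a) {f : Config β → ℝ}
    (hf : Measurable f) :
    ∫⁻ ξ, ∫⁻ ξ', ENNReal.ofReal ((f ξ - f ξ') ^ 2) ∂(poisson β a) ∂(poisson β a) ≤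
      2 * ∫⁻ ξ, ∑ x ∈ ξ.pts, ENNReal.ofReal ((f ξ - f ⟨ξ.pts.erase x⟩) ^ 2) ∂(poisson β a) := by
  have := isProbabilityMeasure_poisson hβ ha
  have hm1 : Measurable fun p : Config β × Config β => ENNReal.ofReal ((f p.1 - f p.2) ^ 2) :=
    (((hf.comp measurable_fst).sub (hf.comp measurable_snd)).pow_const 2).ennreal_ofReal
  have hm2 : Measurable fun ξ : Config β =>
      ∑ x ∈ ξ.pts, ENNReal.ofReal ((f ξ - f ⟨ξ.pts.erase x⟩) ^ 2) :=
    measurable_sum_pts measurable_id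
      (F := fun p : Config β × Set.Ico (0 : ℝ) β =>
        ENNReal.ofReal ((f p.1 - f ⟨p.1.pts.erase p.2⟩) ^ 2))
      ((((hf.comp measurable_fst).sub
        (hf.comp (measurable_erase measurable_fst measurable_snd))).pow_const 2).ennreal_ofReal)
  -- A dummy second copy is inserted so that both sides expand over the same `N` labelled points and
  -- can be compared termwise.
  have hR : ∫⁻ ξ, ∑ x ∈ ξ.pts, ENNReal.ofReal ((f ξ - f ⟨ξ.pts.erase x⟩) ^ 2) ∂(poisson β a) =
      ∫⁻ ξ, ∫⁻ _ξ', ∑ x ∈ ξ.pts, ENNReal.ofReal ((f ξ - f ⟨ξ.pts.erase x⟩) ^ 2)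
        ∂(poisson β a) ∂(poisson β a) := by
    simp
  have hm3 : Measurable fun p : Config β × Config β => ∑ x ∈ p.1.pts,
      ENNReal.ofReal ((f p.1 - f ⟨p.1.pts.erase x⟩) ^ 2) := hm2.comp measurable_fst
  rw [hR, lintegral_poisson_poisson a ha hm1, lintegral_poisson_poisson a ha hm3, mul_left_comm,
    ← ENNReal.tsum_mul_left (a := 2)]
  refine mul_le_mul' le_rfl (ENNReal.tsum_le_tsum fun N => ?_)
  rw [mul_left_comm]
  refine mul_le_mul' le_rfl ?_
  rw [← lintegral_const_mul]
  · refine lintegral_mono_ae ?_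
    filter_upwards [ae_injective_pi (Fin N)] with z hz
    have key := Finset.sum_powerset_sub_compl_sq_le
      fun S : Finset (Fin N) => f ⟨S.image z⟩
    have e : ∀ S : Finset (Fin N), ∑ x ∈ S.image z,
        ENNReal.ofReal ((f ⟨S.image z⟩ - f ⟨(S.image z).erase x⟩) ^ 2) =
        ENNReal.ofReal (∑ i ∈ S, (f ⟨S.image z⟩ - f ⟨(S.erase i).image z⟩) ^ 2) := by
      intro S
      rw [Finset.sum_image fun i _ j _ h => hz h, ENNReal.ofReal_sum_of_nonneg
        fun i _ => sq_nonneg _]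
      refine Finset.sum_congr rfl fun i _ => ?_
      rw [Finset.image_erase hz]
    simp only [e]
    rw [← ENNReal.ofReal_sum_of_nonneg fun _ _ => sq_nonneg _,
      ← ENNReal.ofReal_sum_of_nonneg fun _ _ => Finset.sum_nonneg fun _ _ => sq_nonneg _]
    rw [show (2 : ℝ≥0∞) = ENNReal.ofReal 2 by simp, ← ENNReal.ofReal_mul (by norm_num)]
    exact ENNReal.ofReal_le_ofReal key
  · exact Finset.measurable_sum _ fun S _ => hm2.comp (measurable_image S)

end TransverseField

/-! ### Variances as lower integrals, and their subadditivity over two independent variables -/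

open JumpGen

section Variance

variable {X Y : Type*} [MeasurableSpace X] [MeasurableSpace Y]

theorem lintegral_sub_const_sq (μ : Measure X) [IsProbabilityMeasure μ] {f : X → ℝ}
    (hf : BddMeas f) (c : ℝ) :
    ∫⁻ x, ENNReal.ofReal ((f x - c) ^ 2) ∂μ =
      ∫⁻ x, ENNReal.ofReal ((f x - ∫ y, f y ∂μ) ^ 2) ∂μ +
        ENNReal.ofReal ((∫ y, f y ∂μ - c) ^ 2) := by
  have hi : Integrable f μ := (hf.memLp 1).integrable le_rfl
  have key : ∀ c, Integrable (fun x => (f x - c) ^ 2) μ := fun c =>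
    ((hf.memLp 2).sub (memLp_const c)).integrable_sq
  rw [← ofReal_integral_eq_lintegral_ofReal (key c) (Eventually.of_forall fun _ => sq_nonneg _),
    ← ofReal_integral_eq_lintegral_ofReal (key _) (Eventually.of_forall fun _ => sq_nonneg _),
    ← ENNReal.ofReal_add (integral_nonneg fun _ => sq_nonneg _) (sq_nonneg _)]
  congr 1
  set m := ∫ y, f y ∂μ with hm
  have e : ∀ x, (f x - c) ^ 2 = (f x - m) ^ 2 + (2 * (m - c) * (f x - m) + (m - c) ^ 2) :=
    fun x => by ring
  have h1 : Integrable (fun x => f x - m) μ := hi.sub (integrable_const m)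
  have h2 : Integrable (fun x => 2 * (m - c) * (f x - m) + (m - c) ^ 2) μ :=
    (h1.const_mul _).add (integrable_const _)
  simp_rw [e]
  rw [integral_add (key m) h2, integral_add (h1.const_mul _) (integrable_const _),
    integral_const_mul, integral_sub hi (integrable_const m), ← hm]
  simp

theorem lintegral_lintegral_sub_sq (μ : Measure X) [IsProbabilityMeasure μ] {f : X → ℝ}
    (hf : BddMeas f) :
    ∫⁻ y, ∫⁻ x, ENNReal.ofReal ((f y - f x) ^ 2) ∂μ ∂μ =
      2 * ∫⁻ x, ENNReal.ofReal ((f x - ∫ y, f y ∂μ) ^ 2) ∂μ := by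
  have e : ∀ y, ∫⁻ x, ENNReal.ofReal ((f y - f x) ^ 2) ∂μ =
      ∫⁻ x, ENNReal.ofReal ((f x - ∫ y, f y ∂μ) ^ 2) ∂μ +
        ENNReal.ofReal ((f y - ∫ y, f y ∂μ) ^ 2) := by
    intro y
    rw [sub_sq_comm (f y) (∫ y, f y ∂μ), ← lintegral_sub_const_sq μ hf]
    simp_rw [sub_sq_comm (f y)]
  simp_rw [e]
  rw [lintegral_add_left measurable_const, lintegral_const, measure_univ, mul_one, two_mul]

theorem ofReal_sq_integral_le (μ : Measure X) [IsProbabilityMeasure μ] {f : X → ℝ}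
    (hf : BddMeas f) :
    ENNReal.ofReal ((∫ x, f x ∂μ) ^ 2) ≤ ∫⁻ x, ENNReal.ofReal (f x ^ 2) ∂μ := by
  have := lintegral_sub_const_sq μ hf 0
  simp only [sub_zero] at this
  rw [this]
  exact le_add_self

theorem JumpGen.BddMeas.integral_right {ν : Measure Y} [IsProbabilityMeasure ν] {g : X × Y → ℝ}
    (hg : BddMeas g) : BddMeas fun x => ∫ y, g (x, y) ∂ν := by
  obtain ⟨M, hM⟩ := hg.2
  refine ⟨(StronglyMeasurable.integral_prod_right (f := fun x y => g (x, y))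
    hg.1.stronglyMeasurable).measurable, M, fun x => ?_⟩
  have := norm_integral_le_of_norm_le_const (μ := ν) (f := fun y => g (x, y)) (C := M)
    (Eventually.of_forall fun y => hM (x, y))
  simpa using this

theorem JumpGen.BddMeas.comp {g : X → ℝ} (hg : BddMeas g) {φ : Y → X} (hφ : Measurable φ) :
    BddMeas fun y => g (φ y) := by
  obtain ⟨M, hM⟩ := hg.2
  exact ⟨hg.1.comp hφ, M, fun y => hM _⟩

theorem JumpGen.BddMeas.sub {f g : X → ℝ} (hf : BddMeas f) (hg : BddMeas g) :
    BddMeas fun x => f x - g x := by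
  have := hf.add (hg.const_smul (-1))
  refine ⟨hf.1.sub hg.1, ?_⟩
  obtain ⟨M, hM⟩ := this.2
  exact ⟨M, fun x => by simpa [sub_eq_add_neg] using hM x⟩

/-- The variance of a function of two independent variables is at most the sum of the expected
variances in each of them. -/
theorem lintegral_prod_variance_le (μ : Measure X) (ν : Measure Y) [IsProbabilityMeasure μ]
    [IsProbabilityMeasure ν] {g : X × Y → ℝ} (hg : BddMeas g) :
    ∃ m : ℝ, ∫⁻ x, ∫⁻ y, ENNReal.ofReal ((g (x, y) - m) ^ 2) ∂ν ∂μ ≤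
      ∫⁻ x, ∫⁻ y, ENNReal.ofReal ((g (x, y) - ∫ z, g (x, z) ∂ν) ^ 2) ∂ν ∂μ +
      ∫⁻ y, ∫⁻ x, ENNReal.ofReal ((g (x, y) - ∫ z, g (z, y) ∂μ) ^ 2) ∂μ ∂ν := by
  have hk : BddMeas fun x => ∫ y, g (x, y) ∂ν := hg.integral_right
  have hl : BddMeas fun y => ∫ x, g (x, y) ∂μ :=
    BddMeas.integral_right (g := fun p : Y × X => g (p.2, p.1)) (hg.comp measurable_swap)
  have hx : ∀ x, BddMeas fun y => g (x, y) := fun x => hg.comp measurable_prodMk_left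
  have hy : ∀ y, BddMeas fun x => g (x, y) := fun y => hg.comp measurable_prodMk_right
  set m := ∫ y, ∫ x, g (x, y) ∂μ ∂ν with hm
  refine ⟨m, ?_⟩
  simp_rw [fun x => lintegral_sub_const_sq ν (hx x) m]
  have hmeas : Measurable fun x => ENNReal.ofReal ((∫ y, g (x, y) ∂ν - m) ^ 2) :=
    ((hk.1.sub_const m).pow_const 2).ennreal_ofReal
  rw [lintegral_add_right _ hmeas]
  refine add_le_add le_rfl ?_
  -- By Jensen's inequality in `y`, the variance of the `y`-average of `g` is at most the
  -- `y`-average of its variances in `x`.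
  calc ∫⁻ x, ENNReal.ofReal ((∫ y, g (x, y) ∂ν - m) ^ 2) ∂μ
      ≤ ∫⁻ x, ∫⁻ y, ENNReal.ofReal ((g (x, y) - ∫ z, g (z, y) ∂μ) ^ 2) ∂ν ∂μ := by
        refine lintegral_mono fun x => ?_
        rw [hm, ← integral_sub ((hx x).memLp 1 |>.integrable le_rfl)
          (hl.memLp 1 |>.integrable le_rfl)]
        exact ofReal_sq_integral_le ν ((hx x).sub hl)
    _ = _ := by
        refine lintegral_lintegral_swap ?_
        exact ((hg.1.sub (hl.1.comp measurable_snd)).pow_const 2).ennreal_ofReal.aemeasurable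

end Variance

/-! ### The Poincaré inequality for the free one-site dynamics -/

namespace TransverseField

variable {β : ℝ}

/-- Two independent copies give twice the variance, which cancels the factor `2` and leaves the
constant `1`, whatever the intensity. -/
theorem poisson_variance_le (hβ : 0 ≤ β) {a : ℝ} (ha : 0 ≤ a) {f : Config β → ℝ}
    (hf : BddMeas f) :
    ∫⁻ ξ, ENNReal.ofReal ((f ξ - ∫ ζ, f ζ ∂(poisson β a)) ^ 2) ∂(poisson β a) ≤
      ∫⁻ ξ, ∑ x ∈ ξ.pts, ENNReal.ofReal ((f ⟨ξ.pts.erase x⟩ - f ξ) ^ 2) ∂(poisson β a) := by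
  have := isProbabilityMeasure_poisson hβ ha
  have h := lintegral_poisson_sub_sq_le hβ ha hf.1
  rw [lintegral_lintegral_sub_sq _ hf, ENNReal.mul_le_mul_iff_right (by simp) (by simp)] at h
  refine h.trans_eq (lintegral_congr fun ξ => Finset.sum_congr rfl fun x _ => ?_)
  rw [sub_sq_comm]

/-- The reference measure on one-site states. -/
def siteRef (β a : ℝ) : Measure (Site β) :=
  (poisson β a).prod ((poisson β a).prod (Measure.count : Measure ℤˣ))

instance : MeasurableSingletonClass ℤˣ :=
  ⟨fun u => ⟨{(u : ℤ)}, measurableSet_singleton _, by ext v; simp [Units.ext_iff]⟩⟩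

theorem lintegral_siteRef (hβ : 0 ≤ β) {a : ℝ} (ha : 0 ≤ a) {F : Site β → ℝ≥0∞}
    (hF : Measurable F) :
    ∫⁻ q, F q ∂(siteRef β a) =
      ∫⁻ p, (F (p.1, p.2, 1) + F (p.1, p.2, -1)) ∂((poisson β a).prod (poisson β a)) := by
  have := isProbabilityMeasure_poisson hβ ha
  have hs : ∀ s : ℤˣ, Measurable fun p : Config β × Config β => F (p.1, p.2, s) :=
    fun s => hF.comp (measurable_fst.prodMk (measurable_snd.prodMk measurable_const))
  have hs' : Measurable fun p : Config β × Config β => F (p.1, p.2, 1) + F (p.1, p.2, -1) :=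
    (hs 1).add (hs (-1))
  rw [siteRef, lintegral_prod _ hF.aemeasurable, lintegral_prod _ hs'.aemeasurable]
  refine lintegral_congr fun v => ?_
  have hv : Measurable fun p : Config β × ℤˣ => F (v, p) := hF.comp measurable_prodMk_left
  rw [lintegral_prod _ hv.aemeasurable]
  refine lintegral_congr fun w => ?_
  rw [lintegral_count, tsum_fintype, UnitsInt.univ, Finset.sum_pair (by decide)]

/-- The squared gradient of the free one-site dynamics: removal of points and half of the spin
flip. -/
def siteGradSq (f : Site β → ℝ) (q : Site β) : ℝ≥0∞ :=
  ∑ k : Fin 2, ∑ x ∈ sitePts k q,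
    ENNReal.ofReal ((f (setPts k q ((sitePts k q).erase x)) - f q) ^ 2) +
  2⁻¹ * ENNReal.ofReal ((f (q.1, q.2.1, -q.2.2) - f q) ^ 2)

theorem measurable_sq_sub {A : Type*} [MeasurableSpace A] {F F' : A → ℝ} (h : Measurable F)
    (h' : Measurable F') : Measurable fun a => ENNReal.ofReal ((F a - F' a) ^ 2) :=
  ((h.sub h').pow_const 2).ennreal_ofReal

theorem measurable_siteGradSq {f : Site β → ℝ} (hf : Measurable f) :
    Measurable (siteGradSq f) := by
  unfold siteGradSq
  simp only [Fin.sum_univ_two, sitePts, setPts, if_true, one_ne_zero, if_false]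
  refine Measurable.add (Measurable.add ?_ ?_) (Measurable.const_mul ?_ _)
  · exact measurable_sum_pts measurable_fst (F := fun p : Site β × Set.Ico (0 : ℝ) β =>
      ENNReal.ofReal ((f (⟨p.1.1.pts.erase p.2⟩, p.1.2.1, p.1.2.2) - f p.1) ^ 2))
      (measurable_sq_sub (hf.comp ((measurable_erase (measurable_fst.comp measurable_fst)
        measurable_snd).prodMk ((measurable_fst.comp (measurable_snd.comp measurable_fst)).prodMk
          (measurable_snd.comp (measurable_snd.comp measurable_fst)))))
        (hf.comp measurable_fst))
  · exact measurable_sum_pts (measurable_fst.comp measurable_snd)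
      (F := fun p : Site β × Set.Ico (0 : ℝ) β =>
      ENNReal.ofReal ((f (p.1.1, ⟨p.1.2.1.pts.erase p.2⟩, p.1.2.2) - f p.1) ^ 2))
      (measurable_sq_sub (hf.comp ((measurable_fst.comp measurable_fst).prodMk
        ((measurable_erase (measurable_fst.comp (measurable_snd.comp measurable_fst))
          measurable_snd).prodMk (measurable_snd.comp (measurable_snd.comp measurable_fst)))))
        (hf.comp measurable_fst))
  · exact measurable_sq_sub (hf.comp (measurable_fst.prodMk
      ((measurable_fst.comp measurable_snd).prodMk
        ((measurable_of_countable _).comp (measurable_snd.comp measurable_snd))))) hf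

/-- The Poincaré inequality for the free one-site dynamics, with constant `1`. -/
theorem siteRef_poincare (hβ : 0 ≤ β) {a : ℝ} (ha : 0 ≤ a) {f : Site β → ℝ} (hf : BddMeas f) :
    ∃ m : ℝ, ∫⁻ q, ENNReal.ofReal ((f q - m) ^ 2) ∂(siteRef β a) ≤
      ∫⁻ q, siteGradSq f q ∂(siteRef β a) := by
  have := isProbabilityMeasure_poisson hβ ha
  set P := poisson β a
  have hs : ∀ s : ℤˣ, Measurable fun p : Config β × Config β => ((p.1, p.2, s) : Site β) :=
    fun s => measurable_fst.prodMk (measurable_snd.prodMk measurable_const)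
  set g : Config β × Config β → ℝ := fun p => (f (p.1, p.2, 1) + f (p.1, p.2, -1)) / 2 with hgdef
  have hg : BddMeas g := by
    obtain ⟨M, hM⟩ := hf.2
    refine ⟨((hf.1.comp (hs 1)).add (hf.1.comp (hs (-1)))).div_const 2, M, fun p => ?_⟩
    have h1 := abs_le.1 (hM (p.1, p.2, 1))
    have h2 := abs_le.1 (hM (p.1, p.2, -1))
    rw [abs_le]
    constructor <;> simp only [hgdef] <;> linarith [h1.1, h1.2, h2.1, h2.2]
  obtain ⟨m, hm⟩ := lintegral_prod_variance_le P P hg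
  refine ⟨m, ?_⟩
  have m1 : Measurable fun p : Config β × Config β =>
      ∑ x ∈ p.1.pts, ENNReal.ofReal ((g (⟨p.1.pts.erase x⟩, p.2) - g p) ^ 2) :=
    measurable_sum_pts measurable_fst
      (F := fun p : (Config β × Config β) × Set.Ico (0 : ℝ) β =>
        ENNReal.ofReal ((g (⟨p.1.1.pts.erase p.2⟩, p.1.2) - g p.1) ^ 2))
      (measurable_sq_sub (hg.1.comp ((measurable_erase (measurable_fst.comp measurable_fst)
        measurable_snd).prodMk (measurable_snd.comp measurable_fst))) (hg.1.comp measurable_fst))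
  have m2 : Measurable fun p : Config β × Config β =>
      ∑ x ∈ p.2.pts, ENNReal.ofReal ((g (p.1, ⟨p.2.pts.erase x⟩) - g p) ^ 2) :=
    measurable_sum_pts measurable_snd
      (F := fun p : (Config β × Config β) × Set.Ico (0 : ℝ) β =>
        ENNReal.ofReal ((g (p.1.1, ⟨p.1.2.pts.erase p.2⟩) - g p.1) ^ 2))
      (measurable_sq_sub (hg.1.comp ((measurable_fst.comp measurable_fst).prodMk
        (measurable_erase (measurable_snd.comp measurable_fst) measurable_snd)))
        (hg.1.comp measurable_fst))
  have m3 : Measurable fun p : Config β × Config β =>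
      ENNReal.ofReal ((f (p.1, p.2, 1) - f (p.1, p.2, -1)) ^ 2) :=
    measurable_sq_sub (hf.1.comp (hs 1)) (hf.1.comp (hs (-1)))
  set A : Config β × Config β → ℝ≥0∞ := fun p =>
    ∑ x ∈ p.1.pts, ENNReal.ofReal ((g (⟨p.1.pts.erase x⟩, p.2) - g p) ^ 2) with hA
  set B : Config β × Config β → ℝ≥0∞ := fun p =>
    ∑ x ∈ p.2.pts, ENNReal.ofReal ((g (p.1, ⟨p.2.pts.erase x⟩) - g p) ^ 2) with hB
  set D : Config β × Config β → ℝ≥0∞ := fun p =>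
    ENNReal.ofReal ((f (p.1, p.2, 1) - f (p.1, p.2, -1)) ^ 2) with hD
  have m4 : Measurable fun p => ENNReal.ofReal ((g p - m) ^ 2) :=
    measurable_sq_sub hg.1 measurable_const
  have hvar : ∫⁻ p, ENNReal.ofReal ((g p - m) ^ 2) ∂(P.prod P) ≤
      ∫⁻ p, (A p + B p) ∂(P.prod P) := by
    rw [lintegral_add_left m1, lintegral_prod _ m4.aemeasurable, lintegral_prod _ m2.aemeasurable,
      lintegral_prod_symm _ m1.aemeasurable, add_comm]
    refine hm.trans (add_le_add ?_ ?_)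
    · exact lintegral_mono fun v => poisson_variance_le hβ ha (hg.comp measurable_prodMk_left)
    · exact lintegral_mono fun w => poisson_variance_le hβ ha (hg.comp measurable_prodMk_right)
  rw [lintegral_siteRef hβ ha (measurable_sq_sub hf.1 measurable_const),
    lintegral_siteRef hβ ha (measurable_siteGradSq hf.1)]
  have half : (2⁻¹ : ℝ≥0∞) = ENNReal.ofReal (1 / 2) := by
    rw [one_div, ENNReal.ofReal_inv_of_pos (by norm_num)]; simp
  -- With `g` the mean of `f` over the spin, `∑ₛ (fₛ - m)² = (f₁ - f₋₁)²/2 + 2(g - m)²`. The first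
  -- term is a flip term. The second is handled by the Poisson inequality in each of the two point
  -- sets, and `conv` returns from `g` to `f` by convexity of the square.
  calc ∫⁻ p, (ENNReal.ofReal ((f (p.1, p.2, 1) - m) ^ 2) +
        ENNReal.ofReal ((f (p.1, p.2, -1) - m) ^ 2)) ∂(P.prod P)
      = ∫⁻ p, (2⁻¹ * D p + 2 * ENNReal.ofReal ((g p - m) ^ 2)) ∂(P.prod P) := by
        refine lintegral_congr fun p => ?_
        rw [hD, half, show (2 : ℝ≥0∞) = ENNReal.ofReal 2 by simp,
          ← ENNReal.ofReal_mul (by norm_num), ← ENNReal.ofReal_mul (by norm_num),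
          ← ENNReal.ofReal_add (by positivity) (by positivity),
          ← ENNReal.ofReal_add (by positivity) (by positivity)]
        congr 1
        simp only [hgdef]; ring
    _ = ∫⁻ p, 2⁻¹ * D p ∂(P.prod P) + 2 * ∫⁻ p, ENNReal.ofReal ((g p - m) ^ 2) ∂(P.prod P) := by
        rw [lintegral_add_left (m3.const_mul _), lintegral_const_mul _ m4]
    _ ≤ ∫⁻ p, 2⁻¹ * D p ∂(P.prod P) + 2 * ∫⁻ p, (A p + B p) ∂(P.prod P) := by
        gcongr
    _ = ∫⁻ p, (2⁻¹ * D p + 2 * (A p + B p)) ∂(P.prod P) := by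
        rw [lintegral_add_left (m3.const_mul _)]
        exact congrArg _ (lintegral_const_mul 2 (m1.add m2)).symm
    _ ≤ _ := by
        refine lintegral_mono fun p => ?_
        obtain ⟨v, w⟩ := p
        have conv : ∀ a b c d : ℝ, 2 * ENNReal.ofReal (((a + b) / 2 - (c + d) / 2) ^ 2) ≤
            ENNReal.ofReal ((a - c) ^ 2) + ENNReal.ofReal ((b - d) ^ 2) := by
          intro a b c d
          rw [show (2 : ℝ≥0∞) = ENNReal.ofReal 2 by simp, ← ENNReal.ofReal_mul (by norm_num),
            ← ENNReal.ofReal_add (by positivity) (by positivity)]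
          refine ENNReal.ofReal_le_ofReal ?_
          nlinarith [sq_nonneg ((a - c) - (b - d))]
        simp only [hA, hB, hD, siteGradSq, Fin.sum_univ_two, sitePts, setPts, if_true, one_ne_zero, if_false,
          neg_neg]
        calc _ ≤ 2⁻¹ * ENNReal.ofReal ((f (v, w, 1) - f (v, w, -1)) ^ 2) +
              ((∑ x ∈ v.pts, (ENNReal.ofReal ((f (⟨v.pts.erase x⟩, w, 1) - f (v, w, 1)) ^ 2) +
                ENNReal.ofReal ((f (⟨v.pts.erase x⟩, w, -1) - f (v, w, -1)) ^ 2))) +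
              ∑ x ∈ w.pts, (ENNReal.ofReal ((f (v, ⟨w.pts.erase x⟩, 1) - f (v, w, 1)) ^ 2) +
                ENNReal.ofReal ((f (v, ⟨w.pts.erase x⟩, -1) - f (v, w, -1)) ^ 2))) := by
              rw [mul_add, Finset.mul_sum, Finset.mul_sum]
              gcongr with x hx x hx
              · exact conv _ _ _ _
              · exact conv _ _ _ _
          _ ≤ _ := by
              rw [Finset.sum_add_distrib, Finset.sum_add_distrib]
              generalize (∑ x ∈ v.pts,
                ENNReal.ofReal ((f (⟨v.pts.erase x⟩, w, 1) - f (v, w, 1)) ^ 2)) = s1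
              generalize (∑ x ∈ v.pts,
                ENNReal.ofReal ((f (⟨v.pts.erase x⟩, w, -1) - f (v, w, -1)) ^ 2)) = s2
              generalize (∑ x ∈ w.pts,
                ENNReal.ofReal ((f (v, ⟨w.pts.erase x⟩, 1) - f (v, w, 1)) ^ 2)) = s3
              generalize (∑ x ∈ w.pts,
                ENNReal.ofReal ((f (v, ⟨w.pts.erase x⟩, -1) - f (v, w, -1)) ^ 2)) = s4
              generalize 2⁻¹ * ENNReal.ofReal ((f (v, w, 1) - f (v, w, -1)) ^ 2) = s5
              generalize 2⁻¹ * ENNReal.ofReal ((f (v, w, -1) - f (v, w, 1)) ^ 2) = s6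
              -- Each of the two spin values contributes half a flip term to the gradient, and only
              -- one of them is needed.
              calc s5 + (s1 + s2 + (s3 + s4)) ≤ s5 + (s1 + s2 + (s3 + s4)) + s6 := le_self_add
                _ = _ := by ring

end TransverseField

/-! ### Measurability of the coloring, and oscillation bounds for the energy -/

namespace TransverseField

open JumpGen

variable {β : ℝ}

/-- Existence of a point is nonvanishing of a sum of indicators, so it is covered by
`measurable_sum_pts`. -/
theorem measurableSet_exists_pts {A : Type*} [MeasurableSpace A] {ξ : A → Config β}
    (hξ : Measurable ξ) {T : Set (A × Set.Ico (0 : ℝ) β)} (hT : MeasurableSet T) :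
    MeasurableSet {a | ∃ x ∈ (ξ a).pts, (a, x) ∈ T} := by
  classical
  have h := measurable_sum_pts hξ (F := T.indicator 1) (measurable_one.indicator hT)
  have : {a | ∃ x ∈ (ξ a).pts, (a, x) ∈ T} =
      (fun a => ∑ x ∈ (ξ a).pts, T.indicator (1 : A × Set.Ico (0 : ℝ) β → ℝ≥0∞) (a, x)) ⁻¹'
        {0}ᶜ := by
    ext a
    simp only [Set.mem_ofPred_eq, Set.mem_preimage, Set.mem_compl_iff, Set.mem_singleton_iff,
      Finset.sum_eq_zero_iff, Set.indicator_apply_eq_zero, Pi.one_apply, one_ne_zero, imp_false,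
      not_forall, not_not, exists_prop]
  rw [this]
  exact h (measurableSet_singleton _).compl

/-- The first point after `t` belongs to `w` and not to `v`. -/
def NextIsDown (q : Site β) (t : ℝ) : Prop :=
  ∃ r : ℚ, (∃ y ∈ q.2.1.pts, t < (y : ℝ) ∧ (y : ℝ) ≤ r) ∧
    ¬∃ x ∈ q.1.pts, t < (x : ℝ) ∧ (x : ℝ) ≤ r

theorem min'_mem_iff_not_nextIsDown (q : Site β) (t : ℝ)
    (h : ((q.1.pts ∪ q.2.1.pts).filter fun x : Set.Ico (0 : ℝ) β => t < (x : ℝ)).Nonempty) :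
    ((q.1.pts ∪ q.2.1.pts).filter fun x : Set.Ico (0 : ℝ) β => t < (x : ℝ)).min' h ∈ q.1.pts ↔
      ¬NextIsDown q t := by
  set A := (q.1.pts ∪ q.2.1.pts).filter fun x : Set.Ico (0 : ℝ) β => t < (x : ℝ) with hA
  set x₀ := A.min' h with hx₀
  have hx₀A : x₀ ∈ A := Finset.min'_mem A h
  have hmin : ∀ x ∈ A, x₀ ≤ x := fun x hx => Finset.min'_le A x hx
  have hA' : ∀ x, x ∈ A ↔ (x ∈ q.1.pts ∨ x ∈ q.2.1.pts) ∧ t < (x : ℝ) := by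
    intro x; simp [hA]
  obtain ⟨hx₀1, hx₀t⟩ := (hA' _).1 hx₀A
  constructor
  · rintro hv ⟨r, ⟨y, hy, hty, hyr⟩, hno⟩
    have : (x₀ : ℝ) ≤ y := hmin y ((hA' y).2 ⟨Or.inr hy, hty⟩)
    exact hno ⟨x₀, hv, hx₀t, this.trans hyr⟩
  · intro hno
    by_contra hv
    have hw : x₀ ∈ q.2.1.pts := hx₀1.resolve_left hv
    have hev : ∀ᶠ r : ℝ in 𝓝 (x₀ : ℝ), ∀ x ∈ q.1.pts, t < (x : ℝ) → r < (x : ℝ) := by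
      rw [Finset.eventually_all]
      intro x hx
      by_cases htx : t < (x : ℝ)
      · have hlt : (x₀ : ℝ) < x := by
          refine lt_of_le_of_ne (hmin x ((hA' x).2 ⟨Or.inl hx, htx⟩)) fun h => hv ?_
          rw [Subtype.ext h]; exact hx
        filter_upwards [eventually_lt_nhds hlt] with r hr _ using hr
      · exact Eventually.of_forall fun r h => absurd h htx
    -- The rational `r` is chosen just after the first point `x₀`, before any later point of `v`.
    obtain ⟨ε, hε, hball⟩ := Metric.eventually_nhds_iff.1 hev
    obtain ⟨r, hr1, hr2⟩ := exists_rat_btwn (show (x₀ : ℝ) < x₀ + ε by linarith)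
    refine hno ⟨r, ⟨x₀, hw, hx₀t, hr1.le⟩, ?_⟩
    rintro ⟨x, hx, htx, hxr⟩
    have := hball (y := (r : ℝ)) (by rw [Real.dist_eq, abs_lt]; constructor <;> linarith) x hx htx
    linarith

theorem measurableSet_nextIsDown {A : Type*} [MeasurableSpace A] {q : A → Site β}
    (hq : Measurable q) {t : A → ℝ} (ht : Measurable t) :
    MeasurableSet {a | NextIsDown (q a) (t a)} := by
  unfold NextIsDown
  have hx : Measurable fun p : A × Set.Ico (0 : ℝ) β => (p.2 : ℝ) :=
    measurable_subtype_coe.comp measurable_snd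
  have hT : ∀ r : ℚ, MeasurableSet {p : A × Set.Ico (0 : ℝ) β | t p.1 < (p.2 : ℝ) ∧ (p.2 : ℝ) ≤ r} :=
    fun r => (measurableSet_lt (ht.comp measurable_fst) hx).inter
      (measurableSet_le hx measurable_const)
  -- Because `r` ranges over the rationals, the event is a countable union of events of the form
  -- "some point lies in a given measurable set".
  have e : {a | ∃ r : ℚ, (∃ y ∈ (q a).2.1.pts, t a < (y : ℝ) ∧ (y : ℝ) ≤ r) ∧
      ¬∃ x ∈ (q a).1.pts, t a < (x : ℝ) ∧ (x : ℝ) ≤ r} =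
      ⋃ r : ℚ, ({a | ∃ y ∈ (q a).2.1.pts, (a, y) ∈ {p : A × Set.Ico (0 : ℝ) β |
        t p.1 < (p.2 : ℝ) ∧ (p.2 : ℝ) ≤ r}} ∩ {a | ∃ y ∈ (q a).1.pts, (a, y) ∈
          {p : A × Set.Ico (0 : ℝ) β | t p.1 < (p.2 : ℝ) ∧ (p.2 : ℝ) ≤ r}}ᶜ) := by
    ext a; simp
  rw [e]
  exact MeasurableSet.iUnion fun r =>
    (measurableSet_exists_pts (measurable_fst.comp (measurable_snd.comp hq)) (hT r)).inter
      (measurableSet_exists_pts (measurable_fst.comp hq) (hT r)).compl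

-- The minimum over a varying finite set is traded for events whose measurability is known. The time
-- `-1` precedes all points, so `NextIsDown q (-1)` describes the label of the first point on the
-- whole circle, which is the value after wrapping around.
open Classical in
theorem coloring_eq (q : Site β) (t : ℝ) :
    coloring q t =
      if (∃ x ∈ q.1.pts, -1 < (x : ℝ)) ∨ (∃ x ∈ q.2.1.pts, -1 < (x : ℝ)) then
        if (∃ x ∈ q.1.pts, t < (x : ℝ)) ∨ (∃ x ∈ q.2.1.pts, t < (x : ℝ)) then
          if NextIsDown q t then -1 else 1
        else if NextIsDown q (-1) then -1 else 1
      else q.2.2 := by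
  have hpos : ∀ x : Set.Ico (0 : ℝ) β, -1 < (x : ℝ) := fun x => by linarith [x.2.1]
  have hne : ∀ t : ℝ, ((q.1.pts ∪ q.2.1.pts).filter
      fun x : Set.Ico (0 : ℝ) β => t < (x : ℝ)).Nonempty ↔
      (∃ x ∈ q.1.pts, t < (x : ℝ)) ∨ (∃ x ∈ q.2.1.pts, t < (x : ℝ)) := by
    intro t
    simp only [Finset.Nonempty, Finset.mem_filter, Finset.mem_union]
    constructor
    · rintro ⟨x, hx | hx, h⟩
      exacts [Or.inl ⟨x, hx, h⟩, Or.inr ⟨x, hx, h⟩]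
    · rintro (⟨x, hx, h⟩ | ⟨x, hx, h⟩)
      exacts [⟨x, Or.inl hx, h⟩, ⟨x, Or.inr hx, h⟩]
  have hall : (q.1.pts ∪ q.2.1.pts).filter (fun x : Set.Ico (0 : ℝ) β => -1 < (x : ℝ)) =
      q.1.pts ∪ q.2.1.pts := Finset.filter_true_of_mem fun x _ => hpos x
  have hU := hne (-1)
  rw [hall] at hU
  unfold coloring
  by_cases h : (q.1.pts ∪ q.2.1.pts).Nonempty
  · rw [dif_pos h, if_pos (hU.1 h)]
    by_cases h' : ((q.1.pts ∪ q.2.1.pts).filter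
        fun x : Set.Ico (0 : ℝ) β => t < (x : ℝ)).Nonempty
    · rw [if_pos ((hne t).1 h')]
      simp only [dif_pos h']
      by_cases hd : NextIsDown q t
      · rw [if_pos hd, if_neg (fun hm => (min'_mem_iff_not_nextIsDown q t h').1 hm hd)]
      · rw [if_neg hd, if_pos ((min'_mem_iff_not_nextIsDown q t h').2 hd)]
    · rw [if_neg (fun hc => h' ((hne t).2 hc))]
      simp only [dif_neg h']
      have key := min'_mem_iff_not_nextIsDown q (-1) (by rwa [hall])
      simp only [hall] at key
      by_cases hd : NextIsDown q (-1)
      · rw [if_pos hd, if_neg (fun hm => key.1 hm hd)]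
      · rw [if_neg hd, if_pos (key.2 hd)]
  · rw [dif_neg h, if_neg (fun hc => h (hU.2 hc))]

theorem measurable_coloring : Measurable fun p : Site β × ℝ => coloring p.1 p.2 := by
  classical
  simp_rw [coloring_eq]
  have hex : ∀ {t : Site β × ℝ → ℝ}, Measurable t → MeasurableSet {p : Site β × ℝ |
      (∃ x ∈ p.1.1.pts, t p < (x : ℝ)) ∨ (∃ x ∈ p.1.2.1.pts, t p < (x : ℝ))} := by
    intro t ht
    have hT : MeasurableSet {p : (Site β × ℝ) × Set.Ico (0 : ℝ) β | t p.1 < (p.2 : ℝ)} :=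
      measurableSet_lt (ht.comp measurable_fst) (measurable_subtype_coe.comp measurable_snd)
    exact (measurableSet_exists_pts (measurable_fst.comp measurable_fst) hT).union
      (measurableSet_exists_pts (measurable_fst.comp (measurable_snd.comp measurable_fst)) hT)
  refine Measurable.ite (hex measurable_const) (Measurable.ite (hex measurable_snd)
    (Measurable.ite (measurableSet_nextIsDown measurable_fst measurable_snd) measurable_const
      measurable_const)
    (Measurable.ite (measurableSet_nextIsDown measurable_fst measurable_const) measurable_const
      measurable_const)) (measurable_snd.comp (measurable_snd.comp measurable_fst))

variable {d : ℕ} {Λ : Finset (Fin d → ℤ)} (H : (Λ → ℤˣ) → ℝ)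

theorem measurable_energy_integrand :
    Measurable fun p : State Λ β × ℝ => H fun i => coloring (p.1 i) p.2 := by
  have hH : Measurable H := measurable_of_countable H
  have hc : Measurable fun (p : State Λ β × ℝ) (i : Λ) => coloring (p.1 i) p.2 := by
    refine measurable_pi_lambda _ fun i => ?_
    have hp : Measurable fun p : State Λ β × ℝ => (p.1 i, p.2) :=
      ((measurable_pi_apply i).comp measurable_fst).prodMk measurable_snd
    exact measurable_coloring.comp hp
  exact hH.comp hc

theorem exists_abs_le_of_spins : ∃ M : ℝ, 0 ≤ M ∧ ∀ σ : Λ → ℤˣ, |H σ| ≤ M :=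
  ⟨∑ σ, |H σ|, Finset.sum_nonneg fun _ _ => abs_nonneg _, fun σ =>
    Finset.single_le_sum (f := fun σ => |H σ|) (fun _ _ => abs_nonneg _) (Finset.mem_univ σ)⟩

theorem intervalIntegrable_energy (ω : State Λ β) (a b : ℝ) :
    IntervalIntegrable (fun t => H fun i => coloring (ω i) t) volume a b := by
  obtain ⟨M, hM0, hM⟩ := exists_abs_le_of_spins H
  have hm : Measurable fun t => H fun i => coloring (ω i) t :=
    (measurable_energy_integrand H).comp measurable_prodMk_left
  rw [intervalIntegrable_iff]
  exact Measure.integrableOn_of_bounded (by simp [Set.uIoc]) hm.aestronglyMeasurable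
    (Eventually.of_forall fun t => hM _)

theorem bddMeas_energy (hβ : 0 ≤ β) : BddMeas (energy (Λ := Λ) (β := β) H) := by
  obtain ⟨M, hM0, hM⟩ := exists_abs_le_of_spins H
  refine ⟨?_, M * β, fun ω => ?_⟩
  · unfold energy
    simp_rw [intervalIntegral.integral_of_le hβ]
    exact (StronglyMeasurable.integral_prod_right
      (f := fun (ω : State Λ β) t => H fun i => coloring (ω i) t)
      (measurable_energy_integrand H).stronglyMeasurable).measurable
  · have := intervalIntegral.norm_integral_le_of_norm_le_const (a := 0) (b := β)
      (f := fun t => H fun i => coloring (ω i) t) (C := M) fun t _ => hM _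
    simpa [energy, abs_of_nonneg hβ] using this

theorem coloring_update (ω : State Λ β) (i : Λ) (q : Site β) (t : ℝ) :
    (fun k => coloring (Function.update ω i q k) t) =
      Function.update (fun k => coloring (ω k) t) i (coloring q t) := by
  ext k
  by_cases h : k = i
  · subst h; simp
  · simp [h]

variable {H} {C : ℝ} (hBD : ∀ (i : Λ) (σ : Λ → ℤˣ), |spinGrad H i σ| ≤ C)

include hBD in
theorem abs_spin_update_sub_le (hC : 0 ≤ C) (i : Λ) (σ : Λ → ℤˣ) (s s' : ℤˣ) :
    |H (Function.update σ i s) - H (Function.update σ i s')| ≤ C := by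
  by_cases h : s = s'
  · subst h; simpa using hC
  · have hs : s = -s' := Int.units_ne_iff_eq_neg.1 h
    have := hBD i (Function.update σ i s')
    rw [spinGrad] at this
    simpa [hs] using this

theorem spin_update_sub_eq {R : ℝ}
    (hLOC : ∀ (i : Λ) (σ τ : Λ → ℤˣ), (∀ j : Λ, latticeDist j.1 i.1 ≤ R → σ j = τ j) →
      spinGrad H i σ = spinGrad H i τ) {i j : Λ} (hij : ¬latticeDist j.1 i.1 ≤ R)
    (σ : Λ → ℤˣ) (u s s' : ℤˣ) :
    H (Function.update (Function.update σ j u) i s) -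
      H (Function.update (Function.update σ j u) i s') =
    H (Function.update σ i s) - H (Function.update σ i s') := by
  by_cases h : s = s'
  · subst h; simp
  · have hs : s = -s' := Int.units_ne_iff_eq_neg.1 h
    have := hLOC i (Function.update (Function.update σ j u) i s') (Function.update σ i s') ?_
    · simpa [spinGrad, hs] using this
    · intro k hk
      by_cases hki : k = i
      · subst hki; simp
      · have hkj : k ≠ j := by rintro rfl; exact hij hk
        simp [hki, hkj]

-- An arbitrary change of the state at one site, not only a single move, alters at most one spin at
-- each time. It costs at most `C` per unit of time. Both the one-site comparison and the influence
-- estimate rest on this.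
include hBD in
theorem abs_energy_update_sub_le (hβ : 0 ≤ β) (hC : 0 ≤ C) (ω : State Λ β) (i : Λ)
    (q q' : Site β) :
    |energy H (Function.update ω i q) - energy H (Function.update ω i q')| ≤ β * C := by
  unfold energy
  rw [← intervalIntegral.integral_sub (intervalIntegrable_energy H _ _ _)
    (intervalIntegrable_energy H _ _ _)]
  have := intervalIntegral.norm_integral_le_of_norm_le_const (a := 0) (b := β) (C := C)
    (f := fun t => (H fun k => coloring (Function.update ω i q k) t) -
      H fun k => coloring (Function.update ω i q' k) t) (fun t _ => by
      rw [coloring_update, coloring_update]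
      exact abs_spin_update_sub_le hBD hC i _ _ _)
  rw [sub_zero, abs_of_nonneg hβ, mul_comm] at this
  exact this

include hBD in
theorem energy_mixed_le (hβ : 0 ≤ β) (hC : 0 ≤ C) (ω : State Λ β) (i j : Λ) (y q q' : Site β) :
    (energy H (Function.update (Function.update ω j y) i q) -
      energy H (Function.update (Function.update ω j y) i q')) -
    (energy H (Function.update ω i q) - energy H (Function.update ω i q')) ≤ 2 * (β * C) := by
  have h1 := abs_le.1 (abs_energy_update_sub_le hBD hβ hC (Function.update ω j y) i q q')
  have h2 := abs_le.1 (abs_energy_update_sub_le hBD hβ hC ω i q q')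
  linarith [h1.2, h2.1]

theorem energy_mixed_eq {R : ℝ}
    (hLOC : ∀ (i : Λ) (σ τ : Λ → ℤˣ), (∀ j : Λ, latticeDist j.1 i.1 ≤ R → σ j = τ j) →
      spinGrad H i σ = spinGrad H i τ) {i j : Λ} (hij : ¬latticeDist j.1 i.1 ≤ R)
    (ω : State Λ β) (y q q' : Site β) :
    energy H (Function.update (Function.update ω j y) i q) -
      energy H (Function.update (Function.update ω j y) i q') =
    energy H (Function.update ω i q) - energy H (Function.update ω i q') := by
  unfold energy
  rw [← intervalIntegral.integral_sub (intervalIntegrable_energy H _ _ _)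
    (intervalIntegrable_energy H _ _ _),
    ← intervalIntegral.integral_sub (intervalIntegrable_energy H _ _ _)
    (intervalIntegrable_energy H _ _ _)]
  congr 1; ext t
  simp_rw [coloring_update]
  exact spin_update_sub_eq hLOC hij _ _ _ _

end TransverseField

/-! ### The space of moves and the one-site operations -/

namespace TransverseField

open JumpGen

variable {β : ℝ} {d : ℕ} {Λ : Finset (Fin d → ℤ)}

namespace Move

theorem measurableSet_iff {B : Set (Move Λ β)} :
    MeasurableSet B ↔ ∀ (k : Fin 2) (i : Λ),
      MeasurableSet (add k i ⁻¹' B) ∧ MeasurableSet (rem k i ⁻¹' B) := by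
  change MeasurableSet[⨅ (k : Fin 2) (i : Λ), MeasurableSpace.map (Move.add k i) inferInstance ⊓
      MeasurableSpace.map (Move.rem k i) inferInstance] B ↔ _
  simp only [MeasurableSpace.measurableSet_iInf]
  rfl

theorem measurable_of_comp {Z : Type*} [MeasurableSpace Z] {F : Move Λ β → Z}
    (hadd : ∀ k i, Measurable fun x => F (add k i x))
    (hrem : ∀ k i, Measurable fun x => F (rem k i x)) : Measurable F :=
  fun _ hT => measurableSet_iff.2 fun k i => ⟨hadd k i hT, hrem k i hT⟩

theorem measurable_add (k : Fin 2) (i : Λ) : Measurable (add k i : Set.Ico (0 : ℝ) β → Move Λ β) :=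
  fun _ hB => (measurableSet_iff.1 hB k i).1

theorem measurable_rem (k : Fin 2) (i : Λ) : Measurable (rem k i : Set.Ico (0 : ℝ) β → Move Λ β) :=
  fun _ hB => (measurableSet_iff.1 hB k i).2

theorem measurable_inv : Measurable (inv : Move Λ β → Move Λ β) :=
  measurable_of_comp measurable_rem measurable_add

theorem inv_involutive : Function.Involutive (inv : Move Λ β → Move Λ β) := by
  rintro (_ | _ | _) <;> rfl

/-- The kind of a move, which forgets its position. -/
def label : Move Λ β → (Fin 2 × Λ) ⊕ (Fin 2 × Λ) ⊕ Λ
  | add k i _ => .inl (k, i)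
  | rem k i _ => .inr (.inl (k, i))
  | flip i => .inr (.inr i)

/-- The position of a move. -/
def pos (x₀ : Set.Ico (0 : ℝ) β) : Move Λ β → Set.Ico (0 : ℝ) β
  | add _ _ x => x
  | rem _ _ x => x
  | flip _ => x₀

/-- The move with given kind and position. -/
def mk (x : Set.Ico (0 : ℝ) β) : (Fin 2 × Λ) ⊕ (Fin 2 × Λ) ⊕ Λ → Move Λ β
  | .inl (k, i) => add k i x
  | .inr (.inl (k, i)) => rem k i x
  | .inr (.inr i) => flip i

/-- The σ-algebra on moves is a final one, and final σ-algebras need not be compatible with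
products. Splitting a move measurably into a finite label and a position avoids the issue; `0 < β`
supplies a dummy position for flips. -/
theorem measurable_prod_of_comp (hβ : 0 < β) {A Z : Type*} [MeasurableSpace A] [MeasurableSpace Z]
    {F : A × Move Λ β → Z}
    (hadd : ∀ k i, Measurable fun p : A × Set.Ico (0 : ℝ) β => F (p.1, add k i p.2))
    (hrem : ∀ k i, Measurable fun p : A × Set.Ico (0 : ℝ) β => F (p.1, rem k i p.2))
    (hflip : ∀ i, Measurable fun a => F (a, flip i)) : Measurable F := by
  let x₀ : Set.Ico (0 : ℝ) β := ⟨0, le_rfl, hβ⟩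
  let _ : MeasurableSpace ((Fin 2 × Λ) ⊕ (Fin 2 × Λ) ⊕ Λ) := ⊤
  have hl : Measurable (label : Move Λ β → _) :=
    measurable_of_comp (fun _ _ => measurable_const) fun _ _ => measurable_const
  have hp : Measurable (pos x₀ : Move Λ β → _) :=
    measurable_of_comp (fun _ _ => measurable_id) fun _ _ => measurable_id
  have hG : Measurable fun p : ((Fin 2 × Λ) ⊕ (Fin 2 × Λ) ⊕ Λ) × (A × Set.Ico (0 : ℝ) β) =>
      F (p.2.1, mk p.2.2 p.1) := by
    refine measurable_from_prod_countable_right ?_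
    rintro (⟨k, i⟩ | ⟨k, i⟩ | i)
    exacts [hadd k i, hrem k i, (hflip i).comp measurable_fst]
  have hF : F = (fun p : ((Fin 2 × Λ) ⊕ (Fin 2 × Λ) ⊕ Λ) × (A × Set.Ico (0 : ℝ) β) =>
      F (p.2.1, mk p.2.2 p.1)) ∘ fun p : A × Move Λ β => (label p.2, (p.1, pos x₀ p.2)) := by
    ext ⟨a, (⟨k, i, x⟩ | ⟨k, i, x⟩ | i)⟩ <;> rfl
  rw [hF]
  exact hG.comp ((hl.comp measurable_snd).prodMk (measurable_fst.prodMk (hp.comp measurable_snd)))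

end Move

theorem sitePts_setPts (k : Fin 2) (q : Site β) (A : Finset (Set.Ico (0 : ℝ) β)) :
    sitePts k (setPts k q A) = A := by
  unfold sitePts setPts
  split_ifs <;> rfl

theorem sitePts_setPts_of_ne {k l : Fin 2} (h : l ≠ k) (q : Site β)
    (A : Finset (Set.Ico (0 : ℝ) β)) : sitePts l (setPts k q A) = sitePts l q := by
  fin_cases k <;> fin_cases l <;> simp_all [sitePts, setPts]

theorem setPts_setPts (k : Fin 2) (q : Site β) (A B : Finset (Set.Ico (0 : ℝ) β)) :
    setPts k (setPts k q A) B = setPts k q B := by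
  unfold setPts
  split_ifs <;> rfl

theorem setPts_sitePts (k : Fin 2) (q : Site β) : setPts k q (sitePts k q) = q := by
  unfold setPts sitePts
  split_ifs <;> rfl

theorem measurable_mk_sitePts (k : Fin 2) :
    Measurable fun q : Site β => (⟨sitePts k q⟩ : Config β) := by
  unfold sitePts
  split_ifs
  · exact measurable_fst
  · exact measurable_fst.comp measurable_snd

theorem measurable_setPts {A : Type*} [MeasurableSpace A] (k : Fin 2) {q : A → Site β}
    (hq : Measurable q) {ξ : A → Config β} (hξ : Measurable ξ) :
    Measurable fun a => setPts k (q a) (ξ a).pts := by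
  unfold setPts
  split_ifs
  · exact hξ.prodMk ((measurable_fst.comp (measurable_snd.comp hq)).prodMk
      (measurable_snd.comp (measurable_snd.comp hq)))
  · exact (measurable_fst.comp hq).prodMk (hξ.prodMk
      (measurable_snd.comp (measurable_snd.comp hq)))

theorem measurable_sum_sitePts {A : Type*} [MeasurableSpace A] (k : Fin 2) {q : A → Site β}
    (hq : Measurable q) {F : A × Set.Ico (0 : ℝ) β → ℝ≥0∞} (hF : Measurable F) :
    Measurable fun a => ∑ x ∈ sitePts k (q a), F (a, x) :=
  measurable_sum_pts ((measurable_mk_sitePts k).comp hq) hF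

/-- Add a point of kind `k` to a one-site state. -/
def addPt (k : Fin 2) (q : Site β) (x : Set.Ico (0 : ℝ) β) : Site β :=
  setPts k q (insert x (sitePts k q))

/-- Remove a point of kind `k` from a one-site state. -/
def remPt (k : Fin 2) (q : Site β) (x : Set.Ico (0 : ℝ) β) : Site β :=
  setPts k q ((sitePts k q).erase x)

/-- Flip the spin of a one-site state. -/
def flipSite (q : Site β) : Site β := (q.1, q.2.1, -q.2.2)

theorem measurable_addPt (k : Fin 2) {A : Type*} [MeasurableSpace A] {q : A → Site β}
    (hq : Measurable q) {x : A → Set.Ico (0 : ℝ) β} (hx : Measurable x) :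
    Measurable fun a => addPt k (q a) (x a) :=
  measurable_setPts k hq (measurable_insert ((measurable_mk_sitePts k).comp hq) hx)

theorem measurable_remPt (k : Fin 2) {A : Type*} [MeasurableSpace A] {q : A → Site β}
    (hq : Measurable q) {x : A → Set.Ico (0 : ℝ) β} (hx : Measurable x) :
    Measurable fun a => remPt k (q a) (x a) :=
  measurable_setPts k hq (measurable_erase ((measurable_mk_sitePts k).comp hq) hx)

theorem measurable_flipSite : Measurable (flipSite : Site β → Site β) :=
  measurable_fst.prodMk ((measurable_fst.comp measurable_snd).prodMk
    ((measurable_of_countable _).comp (measurable_snd.comp measurable_snd)))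

theorem remPt_addPt {k : Fin 2} {q : Site β} {x : Set.Ico (0 : ℝ) β} (h : x ∉ sitePts k q) :
    remPt k (addPt k q x) x = q := by
  rw [remPt, addPt, sitePts_setPts, setPts_setPts, Finset.erase_insert h, setPts_sitePts]

theorem addPt_remPt {k : Fin 2} {q : Site β} {x : Set.Ico (0 : ℝ) β} (h : x ∈ sitePts k q) :
    addPt k (remPt k q x) x = q := by
  rw [remPt, addPt, sitePts_setPts, setPts_setPts, Finset.insert_erase h, setPts_sitePts]

theorem flipSite_flipSite (q : Site β) : flipSite (flipSite q) = q := by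
  simp [flipSite]

/-- The Mecke formula for one-site states. -/
theorem lintegral_siteRef_sum (hβ : 0 ≤ β) {a : ℝ} (ha : 0 ≤ a) (k : Fin 2)
    {F : Site β × Set.Ico (0 : ℝ) β → ℝ≥0∞} (hF : Measurable F) :
    ∫⁻ q, ∑ x ∈ sitePts k q, F (q, x) ∂(siteRef β a) =
      ENNReal.ofReal a * ∫⁻ q, ∫⁻ x, F (addPt k q x, x) ∂(leb β) ∂(siteRef β a) := by
  have := isProbabilityMeasure_poisson hβ ha
  have hadd : Measurable fun p : Site β × Set.Ico (0 : ℝ) β => F (addPt k p.1 p.2, p.2) :=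
    hF.comp ((measurable_addPt k measurable_fst measurable_snd).prodMk measurable_snd)
  have h1 : Measurable fun q : Site β => ∑ x ∈ sitePts k q, F (q, x) :=
    measurable_sum_sitePts k measurable_id hF
  have h2 : Measurable fun q : Site β => ∫⁻ x, F (addPt k q x, x) ∂(leb β) :=
    Measurable.lintegral_prod_right' hadd
  have hs : ∀ s : ℤˣ, Measurable fun p : Config β × Config β => ((p.1, p.2, s) : Site β) :=
    fun s => measurable_fst.prodMk (measurable_snd.prodMk measurable_const)
  have mecke : ∀ {G : Config β × Set.Ico (0 : ℝ) β → ℝ≥0∞}, Measurable G →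
      ∫⁻ ξ, ∑ x ∈ ξ.pts, G (ξ, x) ∂(poisson β a) =
      ENNReal.ofReal a * ∫⁻ ξ, ∫⁻ x, G (⟨insert x ξ.pts⟩, x) ∂(leb β) ∂(poisson β a) := by
    intro G hG
    rw [← lintegral_poisson_sum a ha (F := fun p => G (⟨insert p.2 p.1.pts⟩, p.2))
      (hG.comp ((measurable_insert measurable_fst measurable_snd).prodMk measurable_snd))]
    refine lintegral_congr fun ξ => Finset.sum_congr rfl fun x hx => ?_
    simp only [Finset.insert_erase hx]
  rw [lintegral_siteRef hβ ha h1, lintegral_siteRef hβ ha h2]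
  have hsum : ∀ p : Config β × Config β, (∫⁻ x, F (addPt k (p.1, p.2, 1) x, x) ∂(leb β)) +
      ∫⁻ x, F (addPt k (p.1, p.2, -1) x, x) ∂(leb β) =
      ∫⁻ x, (F (addPt k (p.1, p.2, 1) x, x) + F (addPt k (p.1, p.2, -1) x, x)) ∂(leb β) := by
    intro p
    rw [lintegral_add_left]
    exact hadd.comp measurable_prodMk_left
  simp_rw [hsum]
  have m1 : Measurable fun p : Config β × Config β =>
      (∑ x ∈ sitePts k (p.1, p.2, 1), F ((p.1, p.2, 1), x)) +
        ∑ x ∈ sitePts k (p.1, p.2, -1), F ((p.1, p.2, -1), x) :=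
    (h1.comp (hs 1)).add (h1.comp (hs (-1)))
  have m2 : Measurable fun p : Config β × Config β =>
      ∫⁻ x, (F (addPt k (p.1, p.2, 1) x, x) + F (addPt k (p.1, p.2, -1) x, x)) ∂(leb β) := by
    simp_rw [← hsum]
    exact (h2.comp (hs 1)).add (h2.comp (hs (-1)))
  fin_cases k
  · rw [lintegral_prod_symm _ m1.aemeasurable, lintegral_prod_symm _ m2.aemeasurable]
    rw [← lintegral_const_mul _ m2.lintegral_prod_left']
    refine lintegral_congr fun w => ?_
    have hw : ∀ s : ℤˣ, Measurable fun p : Config β × Set.Ico (0 : ℝ) β =>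
        F ((p.1, w, s), p.2) := fun s => hF.comp
      ((measurable_fst.prodMk measurable_const).prodMk measurable_snd)
    have := mecke (G := fun p => F ((p.1, w, 1), p.2) + F ((p.1, w, -1), p.2))
      ((hw 1).add (hw (-1)))
    simpa [sitePts, setPts, addPt, Finset.sum_add_distrib] using this
  · rw [lintegral_prod _ m1.aemeasurable, lintegral_prod _ m2.aemeasurable]
    rw [← lintegral_const_mul _ m2.lintegral_prod_right']
    refine lintegral_congr fun w => ?_
    have hw : ∀ s : ℤˣ, Measurable fun p : Config β × Set.Ico (0 : ℝ) β =>
        F ((w, p.1, s), p.2) := fun s => hF.comp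
      ((measurable_const.prodMk (measurable_fst.prodMk measurable_const)).prodMk measurable_snd)
    have := mecke (G := fun p => F ((w, p.1, 1), p.2) + F ((w, p.1, -1), p.2))
      ((hw 1).add (hw (-1)))
    simpa [sitePts, setPts, addPt, Finset.sum_add_distrib] using this

theorem lintegral_siteRef_flip (hβ : 0 ≤ β) {a : ℝ} (ha : 0 ≤ a) {F : Site β → ℝ≥0∞}
    (hF : Measurable F) :
    ∫⁻ q, F (flipSite q) ∂(siteRef β a) = ∫⁻ q, F q ∂(siteRef β a) := by
  rw [lintegral_siteRef hβ ha hF, 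
    lintegral_siteRef hβ ha (F := fun q => F (flipSite q)) (hF.comp measurable_flipSite)]
  refine lintegral_congr fun p => ?_
  simp [flipSite, add_comm]

theorem isFiniteMeasure_siteRef (hβ : 0 ≤ β) {a : ℝ} (ha : 0 ≤ a) :
    IsFiniteMeasure (siteRef β a) := by
  have := isProbabilityMeasure_poisson hβ ha
  unfold siteRef
  infer_instance

theorem neZero_siteRef (hβ : 0 ≤ β) {a : ℝ} (ha : 0 ≤ a) : NeZero (siteRef β a) := by
  refine ⟨fun h => ?_⟩
  have := isProbabilityMeasure_poisson hβ ha
  have h1 := lintegral_siteRef hβ ha (F := fun _ => 1) measurable_const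
  rw [h, lintegral_zero_measure, lintegral_const, measure_univ] at h1
  norm_num at h1

end TransverseField

/-! ### Integration against the rates, and detailed balance -/

namespace TransverseField

open JumpGen Tensorization

variable {β : ℝ} {d : ℕ} {Λ : Finset (Fin d → ℤ)} (H : (Λ → ℤˣ) → ℝ) (lam : Λ → ℝ)

theorem exists_gibbsDensity (hβ : 0 ≤ β) : ∃ M : ℝ, (∀ ω : State Λ β, |energy H ω| ≤ M) ∧
    GibbsDensity (fun ω : State Λ β => Real.exp (energy H ω)) (Real.exp (-M)) (Real.exp M) := by
  obtain ⟨hm, M, hM⟩ := bddMeas_energy (Λ := Λ) H hβ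
  exact ⟨M, hM, Real.measurable_exp.comp hm, Real.exp_pos _,
    fun ω => Real.exp_le_exp.2 (abs_le.1 (hM ω)).1, fun ω => Real.exp_le_exp.2 (abs_le.1 (hM ω)).2⟩

theorem measurable_update_apply {A : Type*} [MeasurableSpace A] {ω : A → State Λ β}
    (hω : Measurable ω) (i : Λ) {q : A → Site β} (hq : Measurable q) :
    Measurable fun a => Function.update (ω a) i (q a) :=
  measurable_update'.comp (hω.prodMk hq)

theorem measurable_add_act (k : Fin 2) (i : Λ) :
    Measurable fun p : State Λ β × Set.Ico (0 : ℝ) β => (Move.add k i p.2).act p.1 :=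
  measurable_update_apply measurable_fst i
    (measurable_addPt k ((measurable_pi_apply i).comp measurable_fst) measurable_snd)

theorem measurable_rem_act (k : Fin 2) (i : Λ) :
    Measurable fun p : State Λ β × Set.Ico (0 : ℝ) β => (Move.rem k i p.2).act p.1 :=
  measurable_update_apply measurable_fst i
    (measurable_remPt k ((measurable_pi_apply i).comp measurable_fst) measurable_snd)

theorem measurable_flip_act (i : Λ) :
    Measurable fun ω : State Λ β => (Move.flip i).act ω :=
  measurable_update_apply measurable_id i (measurable_flipSite.comp (measurable_pi_apply i))

theorem measurable_act (hβ : 0 < β) :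
    Measurable fun p : State Λ β × Move Λ β => p.2.act p.1 :=
  Move.measurable_prod_of_comp hβ measurable_add_act measurable_rem_act measurable_flip_act

/-- The rate density of adding a point. -/
def addRate (k : Fin 2) (i : Λ) (ω : State Λ β) (x : Set.Ico (0 : ℝ) β) : ℝ≥0∞ :=
  ENNReal.ofReal (Real.exp (energy H ((Move.add k i x).act ω) - energy H ω))

/-- The rate of flipping a spin. -/
def flipRate (i : Λ) (ω : State Λ β) : ℝ≥0∞ :=
  ENNReal.ofReal (Real.exp ((energy H ((Move.flip i).act ω) - energy H ω) / 2))

theorem measurable_addRate (hβ : 0 ≤ β) (k : Fin 2) (i : Λ) :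
    Measurable fun p : State Λ β × Set.Ico (0 : ℝ) β => addRate H k i p.1 p.2 := by
  have hE := (bddMeas_energy (Λ := Λ) H hβ).1
  exact (Real.measurable_exp.comp ((hE.comp (measurable_add_act k i)).sub
    (hE.comp measurable_fst))).ennreal_ofReal

theorem measurable_addRate_left (hβ : 0 ≤ β) (k : Fin 2) (i : Λ) (ω : State Λ β) :
    Measurable fun x => addRate H k i ω x :=
  (measurable_addRate H hβ k i).of_uncurry_left

theorem measurable_flipRate (hβ : 0 ≤ β) (i : Λ) :
    Measurable fun ω : State Λ β => flipRate H i ω := by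
  have hE := (bddMeas_energy (Λ := Λ) H hβ).1
  exact (Real.measurable_exp.comp (((hE.comp (measurable_flip_act i)).sub hE).div_const
    2)).ennreal_ofReal

theorem lintegral_rates (hβ : 0 ≤ β) (ω : State Λ β) {F : Move Λ β → ℝ≥0∞} (hF : Measurable F) :
    ∫⁻ γ, F γ ∂(rates β H lam ω) =
      (∑ i : Λ, ∑ k : Fin 2, ENNReal.ofReal (lam i / 2) *
        ∫⁻ x, addRate H k i ω x * F (Move.add k i x) ∂(leb β)) +
      (∑ i : Λ, ∑ k : Fin 2, ∑ x ∈ sitePts k (ω i), F (Move.rem k i x)) +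
      ∑ i : Λ, flipRate H i ω * F (Move.flip i) := by
  have hadd : ∀ k i, ∫⁻ γ, F γ ∂(((leb β).withDensity (addRate H k i ω)).map (Move.add k i)) =
      ∫⁻ x, addRate H k i ω x * F (Move.add k i x) ∂(leb β) := by
    intro k i
    have hFk : Measurable fun x => F (Move.add k i x) := hF.comp (Move.measurable_add k i)
    rw [lintegral_map hF (Move.measurable_add k i),
      lintegral_withDensity_eq_lintegral_mul (leb β) (measurable_addRate_left H hβ k i ω) hFk]
    simp only [Pi.mul_apply]
  have hr : rates β H lam ω =
      (∑ i : Λ, ∑ k : Fin 2, ENNReal.ofReal (lam i / 2) •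
        ((leb β).withDensity (addRate H k i ω)).map (Move.add k i)) +
      (∑ i : Λ, ∑ k : Fin 2, ∑ x ∈ sitePts k (ω i), Measure.dirac (Move.rem k i x)) +
      ∑ i : Λ, flipRate H i ω • Measure.dirac (Move.flip i) := rfl
  rw [hr]
  simp only [lintegral_add_measure, lintegral_finsetSum_measure, lintegral_smul_measure,
    lintegral_dirac' _ hF, smul_eq_mul, hadd]

/-- The contribution of adding points to an integral with respect to the rates. -/
def addTerm (F : State Λ β × Set.Ico (0 : ℝ) β → ℝ≥0∞) (k : Fin 2) (i : Λ) (ω : State Λ β) :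
    ℝ≥0∞ :=
  ENNReal.ofReal (lam i / 2) * ∫⁻ x, addRate H k i ω x * F (ω, x) ∂(leb β)

theorem measurable_addTerm (hβ : 0 ≤ β) {F : State Λ β × Set.Ico (0 : ℝ) β → ℝ≥0∞}
    (hF : Measurable F) (k : Fin 2) (i : Λ) : Measurable (addTerm H lam F k i) :=
  (Measurable.lintegral_prod_right' ((measurable_addRate H hβ k i).mul hF)).const_mul _

theorem measurable_remTerm {F : State Λ β × Set.Ico (0 : ℝ) β → ℝ≥0∞} (hF : Measurable F)
    (k : Fin 2) (i : Λ) : Measurable fun ω : State Λ β => ∑ x ∈ sitePts k (ω i), F (ω, x) :=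
  measurable_sum_sitePts k (measurable_pi_apply i) hF

section Measurability

variable {Ψ : State Λ β × Move Λ β → ℝ≥0∞} (hΨ : Measurable Ψ)

include hΨ

theorem measurable_apply_add (k : Fin 2) (i : Λ) :
    Measurable fun p : State Λ β × Set.Ico (0 : ℝ) β => Ψ (p.1, Move.add k i p.2) :=
  hΨ.comp (measurable_fst.prodMk ((Move.measurable_add k i).comp measurable_snd))

theorem measurable_apply_rem (k : Fin 2) (i : Λ) :
    Measurable fun p : State Λ β × Set.Ico (0 : ℝ) β => Ψ (p.1, Move.rem k i p.2) :=
  hΨ.comp (measurable_fst.prodMk ((Move.measurable_rem k i).comp measurable_snd))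

theorem measurable_apply_flip (i : Λ) : Measurable fun ω : State Λ β => Ψ (ω, Move.flip i) :=
  hΨ.comp (measurable_id.prodMk measurable_const)

theorem measurable_lintegral_rates (hβ : 0 ≤ β) :
    Measurable fun ω => ∫⁻ γ, Ψ (ω, γ) ∂(rates β H lam ω) := by
  have h : ∀ ω, ∫⁻ γ, Ψ (ω, γ) ∂(rates β H lam ω) = _ := fun ω =>
    lintegral_rates H lam hβ ω (hΨ.comp measurable_prodMk_left)
  simp_rw [h]
  refine ((Finset.measurable_fun_sum _ fun i _ => Finset.measurable_fun_sum _ fun k _ => ?_).add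
    (Finset.measurable_fun_sum _ fun i _ => Finset.measurable_fun_sum _ fun k _ => ?_)).add
    (Finset.measurable_fun_sum _ fun i _ => ?_)
  · exact measurable_addTerm H lam hβ (measurable_apply_add hΨ k i) k i
  · exact measurable_remTerm (measurable_apply_rem hΨ k i) k i
  · exact (measurable_flipRate H hβ i).mul (measurable_apply_flip hΨ i)

end Measurability

theorem measurable_rates (hβ : 0 ≤ β) : Measurable (rates (Λ := Λ) β H lam) := by
  refine Measure.measurable_of_measurable_coe _ fun B hB => ?_
  simp_rw [← lintegral_indicator_one hB]
  exact measurable_lintegral_rates H lam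
    (Ψ := fun p => B.indicator 1 p.2) ((measurable_one.indicator hB).comp measurable_snd) hβ

theorem lintegral_lintegral_rates (hβ : 0 ≤ β) {Φ : State Λ β × Move Λ β → ℝ≥0∞}
    (hΦ : Measurable Φ) :
    ∫⁻ ω, ∫⁻ γ, Φ (ω, γ) ∂(rates β H lam ω) ∂(liftedMeasure β H lam) =
      (∑ i : Λ, ∑ k : Fin 2, ∫⁻ ω, addTerm H lam (fun p => Φ (p.1, Move.add k i p.2)) k i ω
        ∂(liftedMeasure β H lam)) +
      (∑ i : Λ, ∑ k : Fin 2, ∫⁻ ω, ∑ x ∈ sitePts k (ω i), Φ (ω, Move.rem k i x)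
        ∂(liftedMeasure β H lam)) +
      ∑ i : Λ, ∫⁻ ω, flipRate H i ω * Φ (ω, Move.flip i) ∂(liftedMeasure β H lam) := by
  have h : ∀ ω, ∫⁻ γ, Φ (ω, γ) ∂(rates β H lam ω) =
      (∑ i : Λ, ∑ k : Fin 2, addTerm H lam (fun p => Φ (p.1, Move.add k i p.2)) k i ω) +
      (∑ i : Λ, ∑ k : Fin 2, ∑ x ∈ sitePts k (ω i), Φ (ω, Move.rem k i x)) +
      ∑ i : Λ, flipRate H i ω * Φ (ω, Move.flip i) := fun ω =>
    lintegral_rates H lam hβ ω (hΦ.comp measurable_prodMk_left)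
  have h1 := fun k i => measurable_addTerm H lam hβ (measurable_apply_add hΦ k i) k i
  have h2 := fun k i => measurable_remTerm (measurable_apply_rem hΦ k i) k i
  have h3 : ∀ i, Measurable fun ω : State Λ β => flipRate H i ω * Φ (ω, Move.flip i) :=
    fun i => (measurable_flipRate H hβ i).mul (measurable_apply_flip hΦ i)
  simp_rw [h]
  rw [lintegral_add_right _ (Finset.measurable_fun_sum _ fun i _ => h3 i), lintegral_add_right _
    (Finset.measurable_fun_sum _ fun i _ => Finset.measurable_fun_sum _ fun k _ => h2 k i),
    lintegral_finsetSum _ (fun i _ => h3 i),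
    lintegral_finsetSum _ (fun i _ => Finset.measurable_fun_sum _ fun k _ => h2 k i),
    lintegral_finsetSum _ (fun i _ => Finset.measurable_fun_sum _ fun k _ => h1 k i)]
  congr 2
  · exact Finset.sum_congr rfl fun i _ => lintegral_finsetSum _ (fun k _ => h1 k i)
  · exact Finset.sum_congr rfl fun i _ => lintegral_finsetSum _ (fun k _ => h2 k i)

theorem ae_leb_notMem (A : Finset (Set.Ico (0 : ℝ) β)) : ∀ᵐ x ∂(leb β), x ∉ A :=
  measure_eq_zero_iff_ae_notMem.1 (A.finite_toSet.measure_zero _)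

section Balance

variable {H lam} (hβ : 0 ≤ β) (hlam : ∀ i, 0 ≤ lam i)

include hβ hlam

/-- `liftedMeasure` is by definition the `gibbs` measure with reference measures `siteRef` and
density `e^Ĥ`, so identities may be checked in one coordinate with the others frozen. -/
theorem lintegral_liftedMeasure_congr (i : Λ) {A B : State Λ β → ℝ≥0∞} (hA : Measurable A)
    (hB : Measurable B)
    (hAB : ∀ ω, ∫⁻ q, ENNReal.ofReal (Real.exp (energy H (Function.update ω i q))) *
        A (Function.update ω i q) ∂(siteRef β (lam i / 2)) =
      ∫⁻ q, ENNReal.ofReal (Real.exp (energy H (Function.update ω i q))) *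
        B (Function.update ω i q) ∂(siteRef β (lam i / 2))) :
    ∫⁻ ω, A ω ∂(liftedMeasure β H lam) = ∫⁻ ω, B ω ∂(liftedMeasure β H lam) := by
  have h2 : ∀ i, 0 ≤ lam i / 2 := fun i => by linarith [hlam i]
  have := fun i => isFiniteMeasure_siteRef hβ (h2 i)
  have := fun i => neZero_siteRef hβ (h2 i)
  obtain ⟨M, _, hh⟩ := exists_gibbsDensity (β := β) H hβ
  exact hh.lintegral_gibbs_congr (fun i => siteRef β (lam i / 2)) i hA hB hAB

theorem isProbabilityMeasure_liftedMeasure : IsProbabilityMeasure (liftedMeasure β H lam) := by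
  have h2 : ∀ i, 0 ≤ lam i / 2 := fun i => by linarith [hlam i]
  have := fun i => isFiniteMeasure_siteRef hβ (h2 i)
  have := fun i => neZero_siteRef hβ (h2 i)
  obtain ⟨M, _, hh⟩ := exists_gibbsDensity (β := β) H hβ
  exact hh.isProbabilityMeasure (fun i => siteRef β (lam i / 2))

/-- Detailed balance between additions and removals. -/
theorem lintegral_addTerm (k : Fin 2) (i : Λ) {F : State Λ β × Set.Ico (0 : ℝ) β → ℝ≥0∞}
    (hF : Measurable F) :
    ∫⁻ ω, addTerm H lam (fun p => F ((Move.add k i p.2).act p.1, p.2)) k i ω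
        ∂(liftedMeasure β H lam) =
      ∫⁻ ω, ∑ x ∈ sitePts k (ω i), F (ω, x) ∂(liftedMeasure β H lam) := by
  have hE := (bddMeas_energy (Λ := Λ) H hβ).1
  have hF' : Measurable fun p : State Λ β × Set.Ico (0 : ℝ) β =>
      F ((Move.add k i p.2).act p.1, p.2) :=
    hF.comp ((measurable_add_act k i).prodMk measurable_snd)
  refine lintegral_liftedMeasure_congr hβ hlam i (measurable_addTerm H lam hβ hF' k i)
    (measurable_remTerm hF k i) fun ω => ?_
  have hG : Measurable fun p : Site β × Set.Ico (0 : ℝ) β =>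
      ENNReal.ofReal (Real.exp (energy H (Function.update ω i p.1))) *
        F (Function.update ω i p.1, p.2) := by
    have hu : Measurable fun p : Site β × Set.Ico (0 : ℝ) β => Function.update ω i p.1 :=
      measurable_update_apply measurable_const i measurable_fst
    exact (Real.measurable_exp.comp (hE.comp hu)).ennreal_ofReal.mul
      (hF.comp (hu.prodMk measurable_snd))
  have := lintegral_siteRef_sum hβ (by linarith [hlam i] : 0 ≤ lam i / 2) k hG
  simp only [Function.update_self, Finset.mul_sum]
  rw [this, ← lintegral_const_mul]
  · refine lintegral_congr fun q => ?_
    rw [addTerm, mul_left_comm]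
    congr 1
    rw [← lintegral_const_mul']
    swap; · exact ENNReal.ofReal_ne_top
    refine lintegral_congr fun x => ?_
    have ha : (Move.add k i x).act (Function.update ω i q) =
        Function.update ω i (addPt k q x) := by
      simp [Move.act, addPt]
    -- The weight at `ω` times the rate of adding `x` is `e^Ĥ` at the new state, so the Mecke
    -- formula matches it with the removals at rate `1`.
    rw [← mul_assoc, addRate, ← ENNReal.ofReal_mul (Real.exp_nonneg _), ← Real.exp_add, ha,
      add_sub_cancel]
  · exact Measurable.lintegral_prod_right' (hG.comp
      ((measurable_addPt k measurable_fst measurable_snd).prodMk measurable_snd))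

/-- Detailed balance for spin flips. -/
theorem lintegral_flipRate (i : Λ) {F : State Λ β → ℝ≥0∞} (hF : Measurable F) :
    ∫⁻ ω, flipRate H i ω * F ((Move.flip i).act ω) ∂(liftedMeasure β H lam) =
      ∫⁻ ω, flipRate H i ω * F ω ∂(liftedMeasure β H lam) := by
  have hE := (bddMeas_energy (Λ := Λ) H hβ).1
  have hr := measurable_flipRate (β := β) H hβ i
  refine lintegral_liftedMeasure_congr hβ hlam i (hr.mul (hF.comp (measurable_flip_act i)))
    (hr.mul hF) fun ω => ?_
  have ha : ∀ q, (Move.flip i).act (Function.update ω i q) =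
      Function.update ω i (flipSite q) := fun q => by simp [Move.act, flipSite]
  have hu : Measurable fun q : Site β => Function.update ω i q := measurable_update ω
  -- The factor `1/2` in the exponent of the flip rate makes this product symmetric in the two
  -- states, and `siteRef` is invariant under the flip.
  have hw : ∀ q, ENNReal.ofReal (Real.exp (energy H (Function.update ω i q))) *
      flipRate H i (Function.update ω i q) = ENNReal.ofReal (Real.exp
        ((energy H (Function.update ω i q) + energy H (Function.update ω i (flipSite q))) / 2)) := by
    intro q
    rw [flipRate, ← ENNReal.ofReal_mul (Real.exp_nonneg _), ← Real.exp_add, ha]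
    congr 2; ring
  simp_rw [← mul_assoc, hw, ha]
  have hG : Measurable fun q => ENNReal.ofReal (Real.exp
        ((energy H (Function.update ω i q) + energy H (Function.update ω i (flipSite q))) / 2)) *
        F (Function.update ω i q) :=
    ((Real.measurable_exp.comp (((hE.comp hu).add (hE.comp (hu.comp measurable_flipSite))).div_const
      2)).ennreal_ofReal).mul (hF.comp hu)
  rw [← lintegral_siteRef_flip hβ (by linarith [hlam i] : 0 ≤ lam i / 2) hG]
  simp_rw [flipSite_flipSite, add_comm]

/-- The additions on each side match the removals on the other, and the flips match themselves.
Removing an added point restores the state only if the point is new, which holds for Lebesgue almost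
every position. -/
theorem detailed_balance {Ψ : State Λ β × Move Λ β → ℝ≥0∞} (hΨ : Measurable Ψ)
    (hact : Measurable fun p : State Λ β × Move Λ β => p.2.act p.1) :
    ∫⁻ ω, ∫⁻ γ, Ψ (ω, γ) ∂(rates β H lam ω) ∂(liftedMeasure β H lam) =
      ∫⁻ ω, ∫⁻ γ, Ψ (γ.act ω, γ.inv) ∂(rates β H lam ω) ∂(liftedMeasure β H lam) := by
  have hΨ' : Measurable fun p : State Λ β × Move Λ β => Ψ (p.2.act p.1, p.2.inv) :=
    hΨ.comp (hact.prodMk (Move.measurable_inv.comp measurable_snd))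
  rw [lintegral_lintegral_rates H lam hβ hΨ, lintegral_lintegral_rates H lam hβ hΨ',
    add_comm (∑ i : Λ, ∑ k : Fin 2, ∫⁻ ω, addTerm H lam _ k i ω ∂_)]
  congr 1
  · congr 1
    · refine Finset.sum_congr rfl fun i _ => Finset.sum_congr rfl fun k _ => ?_
      exact (lintegral_addTerm hβ hlam k i (measurable_apply_rem hΨ k i)).symm
    · refine Finset.sum_congr rfl fun i _ => Finset.sum_congr rfl fun k _ => ?_
      have := lintegral_addTerm hβ hlam k i (H := H)
        (F := fun p => Ψ ((Move.rem k i p.2).act p.1, Move.add k i p.2))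
        (hΨ.comp ((measurable_rem_act k i).prodMk ((Move.measurable_add k i).comp measurable_snd)))
      refine Eq.trans (lintegral_congr fun ω => ?_) this
      rw [addTerm, addTerm]
      congr 1
      refine lintegral_congr_ae ?_
      filter_upwards [ae_leb_notMem (sitePts k (ω i))] with x hx
      have : (Move.rem k i x).act ((Move.add k i x).act ω) = ω := by
        have := remPt_addPt hx
        simp only [remPt, addPt] at this
        simp [Move.act, this]
      rw [this]
  · refine Finset.sum_congr rfl fun i _ => ?_
    exact (lintegral_flipRate hβ hlam i (measurable_apply_flip hΨ i)).symm

end Balance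

end TransverseField

/-! ### Uniqueness of the inverse move, and linear growth of the rates -/

namespace TransverseField

open JumpGen Tensorization

variable {β : ℝ} {d : ℕ} {Λ : Finset (Fin d → ℤ)}

theorem mem_sitePts_add_act {k l : Fin 2} {i j : Λ} {x y : Set.Ico (0 : ℝ) β} {ω : State Λ β} :
    x ∈ sitePts k ((Move.add l j y).act ω i) ↔ x ∈ sitePts k (ω i) ∨ k = l ∧ i = j ∧ x = y := by
  by_cases hij : i = j
  · subst hij
    by_cases hkl : k = l
    · subst hkl
      simp [Move.act, sitePts_setPts, or_comm]
    · simp [Move.act, sitePts_setPts_of_ne hkl, hkl]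
  · simp [Move.act, hij]

theorem mem_sitePts_rem_act {k l : Fin 2} {i j : Λ} {x y : Set.Ico (0 : ℝ) β} {ω : State Λ β} :
    x ∈ sitePts k ((Move.rem l j y).act ω i) ↔ x ∈ sitePts k (ω i) ∧ ¬(k = l ∧ i = j ∧ x = y) := by
  by_cases hij : i = j
  · subst hij
    by_cases hkl : k = l
    · subst hkl
      simp [Move.act, sitePts_setPts, and_comm]
    · simp [Move.act, sitePts_setPts_of_ne hkl, hkl]
  · simp [Move.act, hij]

theorem sitePts_flip_act (k : Fin 2) (i j : Λ) (ω : State Λ β) :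
    sitePts k ((Move.flip j).act ω i) = sitePts k (ω i) := by
  by_cases hij : i = j
  · subst hij
    simp [Move.act, sitePts]
  · simp [Move.act, hij]

theorem setPts_spin (k : Fin 2) (q : Site β) (A : Finset (Set.Ico (0 : ℝ) β)) :
    (setPts k q A).2.2 = q.2.2 := by
  unfold setPts
  split_ifs <;> rfl

theorem eq_flip_of_spin_ne {δ : Move Λ β} {ω : State Λ β} {i : Λ}
    (h : (δ.act ω i).2.2 ≠ (ω i).2.2) : δ = Move.flip i := by
  rcases δ with ⟨l, j, y⟩ | ⟨l, j, y⟩ | j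
  · exfalso
    by_cases hij : i = j
    · subst hij; simp [Move.act, setPts_spin] at h
    · simp [Move.act, hij] at h
  · exfalso
    by_cases hij : i = j
    · subst hij; simp [Move.act, setPts_spin] at h
    · simp [Move.act, hij] at h
  · by_cases hij : i = j
    · rw [hij]
    · simp [Move.act, hij] at h

/-- A move that creates a new point or removes an old one, or flips a spin. -/
def IsProper (ω : State Λ β) : Move Λ β → Prop
  | .add k i x => x ∉ sitePts k (ω i)
  | .rem k i x => x ∈ sitePts k (ω i)
  | .flip _ => True

/-- A proper move changes the membership of one point or one spin, and only the opposite move at the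
same place changes it back. Adding a present point or removing an absent one does nothing, so
uniqueness needs properness. -/
theorem act_act_eq_iff {ω : State Λ β} {γ : Move Λ β} (hγ : IsProper ω γ) (δ : Move Λ β) :
    δ.act (γ.act ω) = ω ↔ δ = γ.inv := by
  rcases γ with ⟨k, i, x⟩ | ⟨k, i, x⟩ | i
  · have hx : x ∉ sitePts k (ω i) := hγ
    have hx' : x ∈ sitePts k ((Move.add k i x).act ω i) := mem_sitePts_add_act.2 (by simp)
    constructor
    · intro h
      rw [← h] at hx
      rcases δ with ⟨l, j, y⟩ | ⟨l, j, y⟩ | j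
      · exact absurd (mem_sitePts_add_act.2 (Or.inl hx')) hx
      · rw [mem_sitePts_rem_act] at hx
        obtain ⟨rfl, rfl, rfl⟩ : k = l ∧ i = j ∧ x = y := by
          by_contra hne
          exact hx ⟨hx', hne⟩
        rfl
      · rw [sitePts_flip_act] at hx
        exact absurd hx' hx
    · rintro rfl
      have := remPt_addPt hx
      simp only [remPt, addPt] at this
      simp [Move.act, Move.inv, this]
  · have hx : x ∈ sitePts k (ω i) := hγ
    have hx' : x ∉ sitePts k ((Move.rem k i x).act ω i) :=
      fun h => (mem_sitePts_rem_act.1 h).2 ⟨rfl, rfl, rfl⟩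
    constructor
    · intro h
      rw [← h] at hx
      rcases δ with ⟨l, j, y⟩ | ⟨l, j, y⟩ | j
      · rw [mem_sitePts_add_act] at hx
        obtain ⟨rfl, rfl, rfl⟩ := hx.resolve_left hx'
        rfl
      · exact absurd (mem_sitePts_rem_act.1 hx).1 hx'
      · rw [sitePts_flip_act] at hx
        exact absurd hx hx'
    · rintro rfl
      have := addPt_remPt hx
      simp only [remPt, addPt] at this
      simp [Move.act, Move.inv, this]
  · constructor
    · intro h
      refine eq_flip_of_spin_ne (ω := (Move.flip i).act ω) ?_
      rw [h]
      simp [Move.act]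
    · rintro rfl
      simp [Move.act, Move.inv]

theorem measurableSet_isProper (ω : State Λ β) : MeasurableSet {γ | IsProper ω γ} := by
  refine Move.measurableSet_iff.2 fun k i => ⟨?_, ?_⟩
  · exact (sitePts k (ω i)).finite_toSet.measurableSet.compl
  · exact (sitePts k (ω i)).finite_toSet.measurableSet

variable (H : (Λ → ℤˣ) → ℝ) (lam : Λ → ℝ)

theorem ae_rates_isProper (hβ : 0 ≤ β) (ω : State Λ β) : ∀ᵐ γ ∂(rates β H lam ω), IsProper ω γ := by
  rw [ae_iff]
  have hm : MeasurableSet {γ | ¬IsProper ω γ} := (measurableSet_isProper ω).compl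
  rw [← lintegral_indicator_one hm, lintegral_rates H lam hβ ω (measurable_one.indicator hm)]
  have h1 : ∀ i k, ∫⁻ x, addRate H k i ω x * {γ | ¬IsProper ω γ}.indicator 1 (Move.add k i x)
      ∂(leb β) = 0 := by
    intro i k
    rw [lintegral_eq_zero_of_ae_eq_zero]
    filter_upwards [ae_leb_notMem (sitePts k (ω i))] with x hx
    simp [IsProper, hx]
  have h2 : ∀ i k, ∑ x ∈ sitePts k (ω i),
      {γ | ¬IsProper ω γ}.indicator (1 : Move Λ β → ℝ≥0∞) (Move.rem k i x) = 0 := by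
    intro i k
    refine Finset.sum_eq_zero fun x hx => ?_
    simp [IsProper, hx]
  have h3 : ∀ i, {γ | ¬IsProper ω γ}.indicator (1 : Move Λ β → ℝ≥0∞) (Move.flip i) = 0 := by
    intro i
    simp [IsProper]
  simp only [h1, h2, h3, mul_zero, Finset.sum_const_zero, add_zero]

theorem reversible (hβ : 0 < β) (hlam : ∀ i, 0 ≤ lam i) :
    Reversible Move.act Move.inv (rates β H lam) (liftedMeasure β H lam) where
  measurable_act := measurable_act hβ
  measurable_rates := measurable_rates H lam hβ.le
  measurable_inv := Move.measurable_inv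
  bijective_inv := Move.inv_involutive.bijective
  inv_unique := Eventually.of_forall fun ω => by
    filter_upwards [ae_rates_isProper H lam hβ.le ω] with γ hγ δ using act_act_eq_iff hγ δ
  detailed_balance := fun _ hΨ => detailed_balance hβ.le hlam hΨ (measurable_act hβ)

/-- The number of points of a one-site state. -/
def siteSize (q : Site β) : ℕ := ∑ k : Fin 2, (sitePts k q).card

/-- The total number of points. -/
def size (ω : State Λ β) : ℕ := ∑ i, siteSize (ω i)

theorem siteSize_setPts (k : Fin 2) (q : Site β) (A : Finset (Set.Ico (0 : ℝ) β)) :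
    (siteSize (setPts k q A) : ℝ) = siteSize q + (A.card - (sitePts k q).card) := by
  simp only [siteSize, Nat.cast_sum]
  rw [← sub_eq_iff_eq_add', ← Finset.sum_sub_distrib, Finset.sum_eq_single k]
  · rw [sitePts_setPts]
  · intro l _ hl
    rw [sitePts_setPts_of_ne hl, sub_self]
  · simp

theorem size_update (ω : State Λ β) (i : Λ) (q : Site β) :
    (size (Function.update ω i q) : ℝ) = size ω + (siteSize q - siteSize (ω i)) := by
  simp only [size, Nat.cast_sum]
  rw [← sub_eq_iff_eq_add', ← Finset.sum_sub_distrib, Finset.sum_eq_single i]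
  · simp
  · intro j _ hj
    simp [hj]
  · simp

theorem abs_size_act_sub_le (γ : Move Λ β) (ω : State Λ β) :
    |(size (γ.act ω) : ℝ) - size ω| ≤ 1 := by
  rcases γ with ⟨k, i, x⟩ | ⟨k, i, x⟩ | i
  · simp only [Move.act]
    rw [size_update, siteSize_setPts, add_sub_cancel_left, add_sub_cancel_left]
    have h1 : (sitePts k (ω i)).card ≤ (insert x (sitePts k (ω i))).card :=
      Finset.card_le_card (Finset.subset_insert _ _)
    have h2 := Finset.card_insert_le x (sitePts k (ω i))
    rw [abs_le]
    constructor
    · have : ((sitePts k (ω i)).card : ℝ) ≤ (insert x (sitePts k (ω i))).card := by exact_mod_cast h1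
      linarith
    · have : ((insert x (sitePts k (ω i))).card : ℝ) ≤ (sitePts k (ω i)).card + 1 := by
        exact_mod_cast h2
      linarith
  · simp only [Move.act]
    rw [size_update, siteSize_setPts, add_sub_cancel_left, add_sub_cancel_left]
    have h1 := Finset.card_erase_le (s := sitePts k (ω i)) (a := x)
    have h2 : (sitePts k (ω i)).card ≤ ((sitePts k (ω i)).erase x).card + 1 := by
      have := Finset.pred_card_le_card_erase (s := sitePts k (ω i)) (a := x)
      omega
    rw [abs_le]
    constructor
    · have : ((sitePts k (ω i)).card : ℝ) ≤ ((sitePts k (ω i)).erase x).card + 1 := by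
        exact_mod_cast h2
      linarith
    · have : (((sitePts k (ω i)).erase x).card : ℝ) ≤ (sitePts k (ω i)).card := by exact_mod_cast h1
      linarith
  · simp only [Move.act]
    rw [size_update]
    simp [siteSize, sitePts]

theorem measurable_size_ennreal : Measurable fun ω : State Λ β => (size ω : ℝ≥0∞) := by
  have h : ∀ ω : State Λ β, (size ω : ℝ≥0∞) = ∑ i, ∑ k, ∑ _x ∈ sitePts k (ω i), 1 := by
    intro ω
    simp [size, siteSize]
  simp_rw [h]
  exact Finset.measurable_fun_sum _ fun i _ => Finset.measurable_fun_sum _ fun k _ =>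
    measurable_remTerm (F := fun _ => 1) measurable_const k i

theorem measurable_size : Measurable fun ω : State Λ β => (size ω : ℝ) := by
  simpa using (measurable_size_ennreal (Λ := Λ) (β := β)).ennreal_toReal

/-- These crude bounds may depend on `Λ`. They serve integrability and self-adjointness and do not
enter the constant of the gap. -/
theorem exists_rate_bounds (hβ : 0 ≤ β) : ∃ L : ℝ, 0 ≤ L ∧
    (∀ k i (ω : State Λ β) x, addRate H k i ω x ≤ ENNReal.ofReal L) ∧
    ∀ i (ω : State Λ β), flipRate H i ω ≤ ENNReal.ofReal L := by
  obtain ⟨M, hM, -⟩ := exists_gibbsDensity (Λ := Λ) (β := β) H hβ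
  have hd : ∀ ω ω' : State Λ β, energy H ω - energy H ω' ≤ 2 * M := fun ω ω' => by
    linarith [(abs_le.1 (hM ω)).2, (abs_le.1 (hM ω')).1]
  have hM0 : ∀ ω : State Λ β, 0 ≤ M := fun ω => (abs_nonneg _).trans (hM ω)
  refine ⟨Real.exp (2 * M), (Real.exp_pos _).le, fun k i ω x => ?_, fun i ω => ?_⟩
  · exact ENNReal.ofReal_le_ofReal (Real.exp_le_exp.2 (hd _ _))
  · refine ENNReal.ofReal_le_ofReal (Real.exp_le_exp.2 ?_)
    linarith [hd ((Move.flip i).act ω) ω, hM0 ω]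

theorem addTerm_le {L : ℝ} (hL : ∀ k i (ω : State Λ β) x, addRate H k i ω x ≤ ENNReal.ofReal L)
    {F : State Λ β × Set.Ico (0 : ℝ) β → ℝ≥0∞} {k : Fin 2} {i : Λ} {ω : State Λ β} {B : ℝ≥0∞}
    (hF : ∀ x, F (ω, x) ≤ B) :
    addTerm H lam F k i ω ≤
      ENNReal.ofReal (lam i / 2) * (ENNReal.ofReal L * ENNReal.ofReal β) * B := by
  rw [addTerm, mul_assoc]
  refine mul_le_mul' le_rfl ?_
  calc ∫⁻ x, addRate H k i ω x * F (ω, x) ∂(leb β)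
      ≤ ∫⁻ _, ENNReal.ofReal L * B ∂(leb β) :=
        lintegral_mono fun x => mul_le_mul' (hL k i ω x) (hF x)
    _ = ENNReal.ofReal L * ENNReal.ofReal β * B := by
        rw [lintegral_const, leb_univ]; ring

/-- A bound on the total rate of adding points. -/
def addBound (β L : ℝ) : ℝ≥0∞ :=
  ∑ i : Λ, ∑ _k : Fin 2, ENNReal.ofReal (lam i / 2) * (ENNReal.ofReal L * ENNReal.ofReal β)

theorem addBound_lt_top (L : ℝ) : addBound lam β L < ∞ := by
  unfold addBound
  refine ENNReal.sum_lt_top.2 fun i _ => ENNReal.sum_lt_top.2 fun k _ => ?_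
  exact ENNReal.mul_lt_top ENNReal.ofReal_lt_top
    (ENNReal.mul_lt_top ENNReal.ofReal_lt_top ENNReal.ofReal_lt_top)

theorem exists_rates_le (hβ : 0 ≤ β) : ∃ K : ℝ, 0 ≤ K ∧
    ∀ ω : State Λ β, rates β H lam ω Set.univ ≤ ENNReal.ofReal (K * (1 + size ω)) := by
  obtain ⟨L, hL0, hL, hL'⟩ := exists_rate_bounds (Λ := Λ) (β := β) H hβ
  set A : ℝ≥0∞ := addBound lam β L + ∑ _i : Λ, ENNReal.ofReal L with hA
  have hAtop : A ≠ ∞ := ENNReal.add_ne_top.2 ⟨(addBound_lt_top lam L).ne,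
    ENNReal.sum_ne_top.2 fun _ _ => ENNReal.ofReal_ne_top⟩
  refine ⟨A.toReal + 1, by positivity, fun ω => ?_⟩
  have h1 : rates β H lam ω Set.univ ≤ A + size ω := by
    rw [← lintegral_one, lintegral_rates H lam hβ ω measurable_const, hA,
      add_right_comm (addBound lam β L)]
    refine add_le_add (add_le_add ?_ ?_) ?_
    · refine Finset.sum_le_sum fun i _ => Finset.sum_le_sum fun k _ => ?_
      have := addTerm_le H lam hL (F := fun _ => 1) (k := k) (i := i) (ω := ω) (B := 1)
        fun _ => le_rfl
      rwa [mul_one] at this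
    · simp [size, siteSize]
    · exact Finset.sum_le_sum fun i _ => by simpa using hL' i ω
  refine h1.trans ?_
  rw [← ENNReal.ofReal_toReal hAtop, ← ENNReal.ofReal_natCast,
    ← ENNReal.ofReal_add ENNReal.toReal_nonneg (Nat.cast_nonneg _)]
  refine ENNReal.ofReal_le_ofReal ?_
  rw [ENNReal.toReal_ofReal ENNReal.toReal_nonneg]
  nlinarith [mul_nonneg (ENNReal.toReal_nonneg (a := A)) (Nat.cast_nonneg (α := ℝ) (size ω))]

/-- By detailed balance, summing `F` over the points is the same as integrating `F` after an
addition at bounded rate. This bounds a moment of the number of points by the preceding one. -/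
theorem lintegral_size_mul_le (hβ : 0 ≤ β) (hlam : ∀ i, 0 ≤ lam i) :
    ∃ B : ℝ≥0∞, B < ∞ ∧ ∀ F G : State Λ β → ℝ≥0∞, Measurable F → Measurable G →
      (∀ k i x ω, F ((Move.add k i x).act ω) ≤ G ω) →
      ∫⁻ ω, size ω * F ω ∂(liftedMeasure β H lam) ≤ B * ∫⁻ ω, G ω ∂(liftedMeasure β H lam) := by
  obtain ⟨L, hL0, hL, -⟩ := exists_rate_bounds (Λ := Λ) (β := β) H hβ
  refine ⟨addBound lam β L, addBound_lt_top lam L, fun F G hF hG hFG => ?_⟩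
  have hF' : Measurable fun p : State Λ β × Set.Ico (0 : ℝ) β => F p.1 := hF.comp measurable_fst
  have h : ∀ ω : State Λ β, (size ω : ℝ≥0∞) * F ω = ∑ i, ∑ k, ∑ _x ∈ sitePts k (ω i), F ω := by
    intro ω
    simp [size, siteSize, Finset.sum_mul, add_mul]
  simp_rw [h]
  have hm := fun k i => measurable_remTerm hF' k i
  rw [lintegral_finsetSum _ fun i _ => Finset.measurable_fun_sum _ fun k _ => hm k i, addBound,
    Finset.sum_mul]
  refine Finset.sum_le_sum fun i _ => ?_
  rw [lintegral_finsetSum _ fun k _ => hm k i, Finset.sum_mul]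
  refine Finset.sum_le_sum fun k _ => ?_
  rw [← lintegral_addTerm hβ hlam k i hF', ← lintegral_const_mul _ hG]
  exact lintegral_mono fun ω => addTerm_le H lam hL fun x => hFG k i x ω

/-- The preceding estimate with `F = 1` gives a finite mean, and with `F` the number of points a
finite second moment. -/
theorem memLp_size (hβ : 0 ≤ β) (hlam : ∀ i, 0 ≤ lam i) :
    MemLp (fun ω : State Λ β => (size ω : ℝ)) 2 (liftedMeasure β H lam) := by
  have := isProbabilityMeasure_liftedMeasure (H := H) hβ hlam
  obtain ⟨B, hB, hle⟩ := lintegral_size_mul_le H lam hβ hlam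
  have hstep : ∀ k i x (ω : State Λ β), (size ((Move.add k i x).act ω) : ℝ≥0∞) ≤ size ω + 1 := by
    intro k i x ω
    have h := (abs_le.1 (abs_size_act_sub_le (Move.add k i x) ω)).2
    have : size ((Move.add k i x).act ω) ≤ size ω + 1 := by
      have : (size ((Move.add k i x).act ω) : ℝ) ≤ size ω + 1 := by linarith
      exact_mod_cast this
    exact_mod_cast this
  have h1 := hle (fun _ => 1) (fun _ => 1) measurable_const measurable_const fun _ _ _ _ => le_rfl
  have h2 := hle (fun ω => size ω) (fun ω => size ω + 1) measurable_size_ennreal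
    (measurable_size_ennreal.add_const 1) hstep
  simp only [mul_one, lintegral_const, measure_univ] at h1
  rw [lintegral_add_left measurable_size_ennreal, lintegral_one, measure_univ] at h2
  have h3 : ∫⁻ ω, (size ω : ℝ≥0∞) * size ω ∂(liftedMeasure β H lam) < ∞ :=
    h2.trans_lt (ENNReal.mul_lt_top hB (ENNReal.add_lt_top.2 ⟨h1.trans_lt hB, ENNReal.one_lt_top⟩))
  rw [memLp_two_iff_integrable_sq measurable_size.aestronglyMeasurable]
  refine ⟨(measurable_size.pow_const 2).aestronglyMeasurable, ?_⟩
  rw [hasFiniteIntegral_iff_enorm]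
  refine lt_of_eq_of_lt (lintegral_congr fun ω => ?_) h3
  rw [sq, enorm_mul, Real.enorm_natCast]

theorem exists_linearGrowth (hβ : 0 < β) (hlam : ∀ i, 0 ≤ lam i) :
    ∃ K : ℝ, LinearGrowth Move.act Move.inv (rates β H lam) (liftedMeasure β H lam)
      (fun ω => (size ω : ℝ)) K := by
  obtain ⟨K, hK0, hK⟩ := exists_rates_le (Λ := Λ) H lam hβ.le
  exact ⟨K, reversible H lam hβ hlam, measurable_size, fun _ => Nat.cast_nonneg _, hK0, hK,
    abs_size_act_sub_le, memLp_size H lam hβ.le hlam⟩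

end TransverseField

/-! ### Counting lattice points in a Euclidean ball -/

namespace TransverseField

theorem eq_zero_of_sum_sq_lt_one {d : ℕ} {x : Fin d → ℤ} (h : ∑ k, ((x k : ℝ)) ^ 2 < 1) :
    x = 0 := by
  ext k
  have h1 : ((x k : ℝ)) ^ 2 < 1 :=
    (Finset.single_le_sum (f := fun k => ((x k : ℝ)) ^ 2) (fun k _ => sq_nonneg _)
      (Finset.mem_univ k)).trans_lt h
  have h2 : (x k) ^ 2 < 1 := by exact_mod_cast h1
  by_contra hne
  have : 0 < (x k) ^ 2 := by
    rw [Pi.zero_apply] at hne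
    positivity
  omega

/-- The weights are bounds on the relative size of the slices of a ball when their dimension is at
least `6`: `1` near the centre and `27/64 = (3/4)³` beyond half the radius. The bound `2r` is what
one more dimension is allowed to cost. -/
theorem sum_Icc_indicator_le {r : ℝ} (hr : 1 ≤ r) :
    ∑ k ∈ Finset.Icc (-(⌊r⌋₊ : ℤ)) ⌊r⌋₊,
      (if k ∈ Finset.Icc (-(⌊r / 2⌋₊ : ℤ)) ⌊r / 2⌋₊ then (1 : ℝ) else 27 / 64) ≤ 2 * r := by
  set n := ⌊r⌋₊
  set m := ⌊r / 2⌋₊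
  have hn : (n : ℝ) ≤ r := Nat.floor_le (by linarith)
  have hm : (m : ℝ) ≤ r / 2 := Nat.floor_le (by linarith)
  have hmn : m ≤ n := Nat.floor_le_floor (by linarith)
  have hsub : Finset.Icc (-(m : ℤ)) m ⊆ Finset.Icc (-(n : ℤ)) n := by
    intro k hk
    rw [Finset.mem_Icc] at hk ⊢
    omega
  have e : ∀ k : ℤ, (if k ∈ Finset.Icc (-(m : ℤ)) m then (1 : ℝ) else 27 / 64) =
      27 / 64 + if k ∈ Finset.Icc (-(m : ℤ)) m then (37 / 64 : ℝ) else 0 := by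
    intro k; split_ifs <;> norm_num
  have hcard : ∀ m : ℕ, ((Finset.Icc (-(m : ℤ)) m).card : ℝ) = 2 * m + 1 := by
    intro m
    rw [Int.card_Icc, show ((m : ℤ) + 1 - -(m : ℤ)).toNat = 2 * m + 1 by omega]
    push_cast; ring
  simp_rw [e]
  rw [Finset.sum_add_distrib, Finset.sum_const, nsmul_eq_mul, hcard, Finset.sum_ite_mem,
    Finset.inter_eq_right.2 hsub, Finset.sum_const, nsmul_eq_mul, hcard]
  by_cases h2 : r < 2
  · have hm0 : m = 0 := Nat.floor_eq_zero.2 (by linarith)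
    have hn1 : n ≤ 1 := by
      have : n < 2 := (Nat.floor_lt (by linarith)).2 (by exact_mod_cast h2)
      omega
    have hn1' : (n : ℝ) ≤ 1 := by exact_mod_cast hn1
    rw [hm0]; push_cast; linarith
  · push Not at h2
    linarith

/-- A bound for the number of lattice points in a Euclidean ball. -/
theorem card_le_of_sum_sq_le (d : ℕ) {r : ℝ} (hr : 0 ≤ r) (S : Finset (Fin d → ℤ))
    (hS : ∀ x ∈ S, ∑ k, ((x k : ℝ)) ^ 2 ≤ r ^ 2) :
    (S.card : ℝ) ≤ (3 / 2) ^ min d 6 * max 1 (2 * r) ^ d := by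
  induction d generalizing r with
  | zero =>
    have : S.card ≤ 1 := Finset.card_le_one_of_subsingleton S
    simpa using this
  | succ d ih =>
    have hA : ∀ d : ℕ, (1 : ℝ) ≤ (3 / 2) ^ min d 6 := fun d => one_le_pow₀ (by norm_num)
    have hA' : (0 : ℝ) ≤ (3 / 2) ^ min d 6 := by positivity
    by_cases h1 : r < 1
    · have hsub : S ⊆ {0} := fun x hx => by
        rw [Finset.mem_singleton]
        exact eq_zero_of_sum_sq_lt_one ((hS x hx).trans_lt (by nlinarith))
      have hc : (S.card : ℝ) ≤ 1 := by exact_mod_cast Finset.card_le_card hsub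
      exact hc.trans (one_le_mul_of_one_le_of_one_le (hA _) (one_le_pow₀ (le_max_left _ _)))
    push Not at h1
    have hmax : max 1 (2 * r) = 2 * r := max_eq_right (by linarith)
    have hk : ∀ x ∈ S, ((x 0 : ℤ) : ℝ) ^ 2 + ∑ k, ((Fin.tail x k : ℤ) : ℝ) ^ 2 ≤ r ^ 2 := by
      intro x hx
      have := hS x hx
      rwa [Fin.sum_univ_succ] at this
    have hmem : ∀ x ∈ S, x 0 ∈ Finset.Icc (-(⌊r⌋₊ : ℤ)) ⌊r⌋₊ := by
      intro x hx
      have h0 : 0 ≤ ∑ k, ((Fin.tail x k : ℤ) : ℝ) ^ 2 := Finset.sum_nonneg fun k _ => sq_nonneg _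
      have hsq : |((x 0 : ℤ) : ℝ)| ≤ r := abs_le_of_sq_le_sq (by linarith [hk x hx]) hr
      have hle : (x 0).natAbs ≤ ⌊r⌋₊ := Nat.le_floor (by rwa [Nat.cast_natAbs, Int.cast_abs])
      rw [Finset.mem_Icc]
      omega
    have hfiber : ∀ k : ℤ, ((S.filter fun x => x 0 = k).card : ℝ) ≤
        (3 / 2) ^ min d 6 * max 1 (2 * √(r ^ 2 - k ^ 2)) ^ d := by
      intro k
      have hinj : Set.InjOn (Fin.tail : (Fin (d + 1) → ℤ) → Fin d → ℤ)
          (S.filter fun x => x 0 = k : Finset _) := by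
        intro x hx y hy hxy
        have hx0 := (Finset.mem_filter.1 (Finset.mem_coe.1 hx)).2
        have hy0 := (Finset.mem_filter.1 (Finset.mem_coe.1 hy)).2
        rw [← Fin.cons_self_tail x, ← Fin.cons_self_tail y, hxy, hx0, hy0]
      rw [← Finset.card_image_of_injOn hinj]
      refine ih (Real.sqrt_nonneg _) _ fun y hy => ?_
      obtain ⟨x, hx, rfl⟩ := Finset.mem_image.1 hy
      obtain ⟨hxS, rfl⟩ := Finset.mem_filter.1 hx
      have h2 := hk x hxS
      have h0 : 0 ≤ ∑ k, ((Fin.tail x k : ℤ) : ℝ) ^ 2 := Finset.sum_nonneg fun k _ => sq_nonneg _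
      rw [Real.sq_sqrt (by linarith)]
      linarith
    have hle : ∀ k : ℤ, max 1 (2 * √(r ^ 2 - k ^ 2)) ≤ 2 * r := by
      intro k
      refine max_le (by linarith) ?_
      have : √(r ^ 2 - (k : ℝ) ^ 2) ≤ r := by
        rw [Real.sqrt_le_left hr]
        linarith [sq_nonneg (k : ℝ)]
      linarith
    have hcard : (S.card : ℝ) = ∑ k ∈ Finset.Icc (-(⌊r⌋₊ : ℤ)) ⌊r⌋₊,
        ((S.filter fun x => x 0 = k).card : ℝ) := by
      rw [Finset.card_eq_sum_card_fiberwise hmem]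
      push_cast; rfl
    rw [hcard, hmax]
    -- In the first six dimensions the trivial count `2⌊r⌋ + 1 ≤ 3r` of slices costs an extra factor
    -- `3/2` each. From then on the slices with `|k| > r/2` have squared radius at most `3r²/4`,
    -- whose third power is small enough that the constant stops growing.
    by_cases hd : d < 6
    · rw [show min (d + 1) 6 = min d 6 + 1 by omega]
      have hb : ∀ k ∈ Finset.Icc (-(⌊r⌋₊ : ℤ)) ⌊r⌋₊, ((S.filter fun x => x 0 = k).card : ℝ) ≤
          (3 / 2) ^ min d 6 * (2 * r) ^ d := fun k _ => (hfiber k).trans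
        (mul_le_mul_of_nonneg_left (pow_le_pow_left₀ (by positivity) (hle k) d) hA')
      refine (Finset.sum_le_card_nsmul _ _ _ hb).trans ?_
      rw [Int.card_Icc, show ((⌊r⌋₊ : ℤ) + 1 - -(⌊r⌋₊ : ℤ)).toNat = 2 * ⌊r⌋₊ + 1 by omega,
        nsmul_eq_mul, pow_succ, pow_succ]
      have hn : (⌊r⌋₊ : ℝ) ≤ r := Nat.floor_le hr
      push_cast
      calc (2 * (⌊r⌋₊ : ℝ) + 1) * ((3 / 2) ^ min d 6 * (2 * r) ^ d)
          ≤ (3 * r) * ((3 / 2) ^ min d 6 * (2 * r) ^ d) :=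
            mul_le_mul_of_nonneg_right (by linarith) (by positivity)
        _ = _ := by ring
    · push Not at hd
      rw [show min (d + 1) 6 = min d 6 by omega]
      have hb : ∀ k ∈ Finset.Icc (-(⌊r⌋₊ : ℤ)) ⌊r⌋₊, ((S.filter fun x => x 0 = k).card : ℝ) ≤
          (3 / 2) ^ min d 6 * (2 * r) ^ d *
            (if k ∈ Finset.Icc (-(⌊r / 2⌋₊ : ℤ)) ⌊r / 2⌋₊ then (1 : ℝ) else 27 / 64) := by
        intro k _
        refine (hfiber k).trans ?_
        rw [mul_assoc]
        refine mul_le_mul_of_nonneg_left ?_ hA'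
        split_ifs with hkm
        · rw [mul_one]
          exact pow_le_pow_left₀ (by positivity) (hle k) d
        · set s := max 1 (2 * √(r ^ 2 - (k : ℝ) ^ 2)) with hs
          have hs1 : 1 ≤ s := le_max_left _ _
          have habs : r / 2 < |(k : ℝ)| := by
            rw [← Int.cast_abs, ← Nat.cast_natAbs]
            refine (Nat.floor_lt (by linarith)).1 ?_
            rw [Finset.mem_Icc] at hkm
            omega
          have hksq : r ^ 2 / 4 ≤ (k : ℝ) ^ 2 := by
            rw [← sq_abs (k : ℝ)]
            nlinarith
          have hs2 : s ^ 2 ≤ 3 / 4 * (2 * r) ^ 2 := by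
            have : s ≤ √(3 / 4 * (2 * r) ^ 2) := by
              refine max_le ?_ ?_
              · rw [Real.one_le_sqrt]
                nlinarith
              · refine Real.le_sqrt_of_sq_le ?_
                rcases le_total 0 (r ^ 2 - (k : ℝ) ^ 2) with h | h
                · rw [mul_pow, Real.sq_sqrt h]
                  linarith
                · rw [Real.sqrt_eq_zero_of_nonpos h]
                  nlinarith
            calc s ^ 2 ≤ √(3 / 4 * (2 * r) ^ 2) ^ 2 := pow_le_pow_left₀ (by linarith) this 2
              _ = _ := Real.sq_sqrt (by positivity)
          obtain ⟨e, rfl⟩ := Nat.exists_eq_add_of_le hd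
          calc s ^ (6 + e) = (s ^ 2) ^ 3 * s ^ e := by ring
            _ ≤ (3 / 4 * (2 * r) ^ 2) ^ 3 * (2 * r) ^ e :=
              mul_le_mul (pow_le_pow_left₀ (sq_nonneg _) hs2 3)
                (pow_le_pow_left₀ (by linarith) (hle k) e) (by positivity) (by positivity)
            _ = (2 * r) ^ (6 + e) * (27 / 64) := by ring
      refine (Finset.sum_le_sum hb).trans ?_
      rw [← Finset.mul_sum, pow_succ, ← mul_assoc]
      exact mul_le_mul_of_nonneg_left (sum_Icc_indicator_le h1) (by positivity)

/-- Leaving out `i` itself matters for `R < 1`, where `(2R)^d` may be small but no neighbour is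
left. For `R ≥ 1` the constant is `(3/2)⁶ ≤ 15`. -/
theorem card_neighbors_le {d : ℕ} {Λ : Finset (Fin d → ℤ)} (i : Λ) {R : ℝ} (hR : 0 < R) :
    ((Finset.univ.filter fun j : Λ => j ≠ i ∧ latticeDist j.1 i.1 ≤ R).card : ℝ) ≤
      15 * (2 * R) ^ d := by
  set T := Finset.univ.filter fun j : Λ => j ≠ i ∧ latticeDist j.1 i.1 ≤ R with hT
  have hdist : ∀ j ∈ T, ∑ k, (((j.1 - i.1) k : ℤ) : ℝ) ^ 2 ≤ R ^ 2 := by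
    intro j hj
    have := (Finset.mem_filter.1 hj).2.2
    rw [latticeDist, Real.sqrt_le_left hR.le] at this
    simpa using this
  have hinj : Set.InjOn (fun j : Λ => j.1 - i.1) (T : Set Λ) := fun j _ j' _ h =>
    Subtype.ext (sub_left_injective h)
  by_cases h1 : R < 1
  · have : T = ∅ := by
      refine Finset.eq_empty_of_forall_notMem fun j hj => (Finset.mem_filter.1 hj).2.1 ?_
      exact Subtype.ext (sub_eq_zero.1
        (eq_zero_of_sum_sq_lt_one ((hdist j hj).trans_lt (by nlinarith))))
    rw [this]
    simp only [Finset.card_empty, Nat.cast_zero]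
    positivity
  · push Not at h1
    rw [← Finset.card_image_of_injOn hinj]
    refine (card_le_of_sum_sq_le d hR.le _ fun y hy => ?_).trans ?_
    · obtain ⟨j, hj, rfl⟩ := Finset.mem_image.1 hy
      exact hdist j hj
    · rw [max_eq_right (by linarith : (1 : ℝ) ≤ 2 * R)]
      refine mul_le_mul_of_nonneg_right ?_ (by positivity)
      calc ((3 : ℝ) / 2) ^ min d 6 ≤ (3 / 2) ^ 6 :=
            pow_le_pow_right₀ (by norm_num) (min_le_right _ _)
        _ ≤ 15 := by norm_num

end TransverseField

/-! ### Conditional averages as best constants -/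

namespace Tensorization.GibbsDensity

open JumpGen

variable {ι Y : Type*} [Fintype ι] [DecidableEq ι] [MeasurableSpace Y]
  {h : (ι → Y) → ℝ} {a b : ℝ} (hh : GibbsDensity h a b)
  (ν : ι → Measure Y) [∀ i, IsFiniteMeasure (ν i)] [∀ i, NeZero (ν i)]

include hh

/-- The conditional average minimizes the conditional mean square deviation. -/
theorem lintegral_sub_siteAvg_sq_le (i : ι) {f : (ι → Y) → ℝ} (hf : BddMeas f) (ω : ι → Y)
    (m : ℝ) :
    ∫⁻ q, ENNReal.ofReal (h (Function.update ω i q)) *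
        ENNReal.ofReal ((f (Function.update ω i q) - siteAvg ν h i f ω) ^ 2) ∂(ν i) ≤
      ∫⁻ q, ENNReal.ofReal (h (Function.update ω i q)) *
        ENNReal.ofReal ((f (Function.update ω i q) - m) ^ 2) ∂(ν i) := by
  have hc : ∀ c : ℝ, BddMeas fun _ : ι → Y => c :=
    fun c => ⟨measurable_const, |c|, fun _ => le_rfl⟩
  have hsq : ∀ c : ℝ, Integrable (fun q => h (Function.update ω i q) *
      (f (Function.update ω i q) - c) ^ 2) (ν i) := by
    intro c
    have h1 := BddMeas.mul hh.bddMeas (BddMeas.mul (hf.sub (hc c)) (hf.sub (hc c)))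
    simpa only [sq] using integrable_update ν h1 i ω
  have hconv : ∀ c : ℝ, ∫⁻ q, ENNReal.ofReal (h (Function.update ω i q)) *
      ENNReal.ofReal ((f (Function.update ω i q) - c) ^ 2) ∂(ν i) =
      ENNReal.ofReal (∫ q, h (Function.update ω i q) *
        (f (Function.update ω i q) - c) ^ 2 ∂(ν i)) := by
    intro c
    rw [ofReal_integral_eq_lintegral_ofReal (hsq c)
      (Eventually.of_forall fun q => mul_nonneg (hh.nonneg _) (sq_nonneg _))]
    exact lintegral_congr fun q => (ENNReal.ofReal_mul (hh.nonneg _)).symm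
  rw [hconv, hconv]
  refine ENNReal.ofReal_le_ofReal ?_
  set e := siteAvg ν h i f ω with he
  have i1 : Integrable (fun q => h (Function.update ω i q)) (ν i) :=
    integrable_update ν hh.bddMeas i ω
  have i2 : Integrable (fun q => h (Function.update ω i q) * f (Function.update ω i q)) (ν i) :=
    integrable_update ν (BddMeas.mul hh.bddMeas hf) i ω
  have key : ∀ q, h (Function.update ω i q) * (f (Function.update ω i q) - m) ^ 2 =
      h (Function.update ω i q) * (f (Function.update ω i q) - e) ^ 2 +
        (2 * (e - m) * (h (Function.update ω i q) * f (Function.update ω i q)) +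
        (m ^ 2 - e ^ 2) * h (Function.update ω i q)) := fun q => by ring
  have i3 : Integrable (fun q =>
      2 * (e - m) * (h (Function.update ω i q) * f (Function.update ω i q)) +
        (m ^ 2 - e ^ 2) * h (Function.update ω i q)) (ν i) :=
    (i2.const_mul _).add (i1.const_mul _)
  simp_rw [key]
  rw [integral_add (hsq e) i3,
    integral_add (i2.const_mul _) (i1.const_mul _), integral_const_mul, integral_const_mul,
    hh.integral_mul_eq_siteAvg_mul ν i f ω, ← he]
  have hpos := hh.condMass_pos ν i ω
  nlinarith [mul_nonneg (sq_nonneg (e - m)) hpos.le]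

end Tensorization.GibbsDensity

/-! ### The Dirichlet form and the Poincaré inequality for the interacting dynamics -/

namespace TransverseField

open JumpGen Tensorization

variable {β : ℝ} {d : ℕ} {Λ : Finset (Fin d → ℤ)} {H : (Λ → ℤˣ) → ℝ} {lam : Λ → ℝ}

/-- The density of the Dirichlet form at the site `i`. -/
def siteDirichlet (H : (Λ → ℤˣ) → ℝ) (u : State Λ β → ℝ) (i : Λ) (ω : State Λ β) : ℝ≥0∞ :=
  ∑ k : Fin 2, ∑ x ∈ sitePts k (ω i), ENNReal.ofReal ((u ((Move.rem k i x).act ω) - u ω) ^ 2) +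
    2⁻¹ * (flipRate H i ω * ENNReal.ofReal ((u ((Move.flip i).act ω) - u ω) ^ 2))

theorem measurable_gradSq_rem {u : State Λ β → ℝ} (hu : Measurable u) (k : Fin 2) (i : Λ) :
    Measurable fun p : State Λ β × Set.Ico (0 : ℝ) β =>
      ENNReal.ofReal ((u ((Move.rem k i p.2).act p.1) - u p.1) ^ 2) :=
  measurable_sq_sub (hu.comp (measurable_rem_act k i)) (hu.comp measurable_fst)

theorem measurable_gradSq_flip (hβ : 0 ≤ β) {u : State Λ β → ℝ} (hu : Measurable u) (i : Λ) :
    Measurable fun ω : State Λ β =>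
      flipRate H i ω * ENNReal.ofReal ((u ((Move.flip i).act ω) - u ω) ^ 2) :=
  (measurable_flipRate H hβ i).mul (measurable_sq_sub (hu.comp (measurable_flip_act i)) hu)

theorem measurable_siteDirichlet (hβ : 0 ≤ β) {u : State Λ β → ℝ} (hu : Measurable u) (i : Λ) :
    Measurable (siteDirichlet H u i) :=
  (Finset.measurable_fun_sum _ fun k _ => measurable_remTerm (measurable_gradSq_rem hu k i) k i).add
    ((measurable_gradSq_flip hβ hu i).const_mul _)

/-- Additions contribute as much as removals by detailed balance. After factoring out `2`, the
removals have weight `1` and the flips weight `1/2`, as in `siteGradSq`. -/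
theorem lintegral_gradSq (hβ : 0 < β) (hlam : ∀ i, 0 ≤ lam i) {u : State Λ β → ℝ}
    (hu : Measurable u) :
    ∫⁻ ω, ∫⁻ γ, ENNReal.ofReal ((u (Move.act γ ω) - u ω) ^ 2) ∂(rates β H lam ω)
        ∂(liftedMeasure β H lam) =
      2 * ∑ i, ∫⁻ ω, siteDirichlet H u i ω ∂(liftedMeasure β H lam) := by
  have hΦ : Measurable fun p : State Λ β × Move Λ β =>
      ENNReal.ofReal ((u (Move.act p.2 p.1) - u p.1) ^ 2) :=
    measurable_sq_sub (hu.comp (measurable_act hβ)) (hu.comp measurable_fst)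
  have hadd : ∀ k i, ∫⁻ ω, addTerm H lam
      (fun p => ENNReal.ofReal ((u ((Move.add k i p.2).act p.1) - u p.1) ^ 2)) k i ω
        ∂(liftedMeasure β H lam) =
      ∫⁻ ω, ∑ x ∈ sitePts k (ω i), ENNReal.ofReal ((u ((Move.rem k i x).act ω) - u ω) ^ 2)
        ∂(liftedMeasure β H lam) := by
    intro k i
    rw [← lintegral_addTerm hβ.le hlam k i (measurable_gradSq_rem hu k i)]
    refine lintegral_congr fun ω => ?_
    rw [addTerm, addTerm]
    congr 1
    refine lintegral_congr_ae ?_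
    filter_upwards [ae_leb_notMem (sitePts k (ω i))] with x hx
    have : (Move.rem k i x).act ((Move.add k i x).act ω) = ω :=
      (act_act_eq_iff (γ := Move.add k i x) hx _).2 rfl
    rw [this, sub_sq_comm]
  rw [lintegral_lintegral_rates H lam hβ.le hΦ]
  simp only [hadd]
  rw [← two_mul, Finset.mul_sum, Finset.mul_sum, ← Finset.sum_add_distrib]
  refine Finset.sum_congr rfl fun i _ => ?_
  have hr := fun k => measurable_remTerm (measurable_gradSq_rem hu k i) k i
  have hs : ∫⁻ ω, siteDirichlet H u i ω ∂(liftedMeasure β H lam) =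
      (∑ k : Fin 2, ∫⁻ ω, ∑ x ∈ sitePts k (ω i),
        ENNReal.ofReal ((u ((Move.rem k i x).act ω) - u ω) ^ 2) ∂(liftedMeasure β H lam)) +
      2⁻¹ * ∫⁻ ω, flipRate H i ω * ENNReal.ofReal ((u ((Move.flip i).act ω) - u ω) ^ 2)
        ∂(liftedMeasure β H lam) := by
    unfold siteDirichlet
    rw [lintegral_add_left (Finset.measurable_fun_sum _ fun k _ => hr k),
      lintegral_finsetSum _ (fun k _ => hr k),
      lintegral_const_mul _ (measurable_gradSq_flip hβ.le hu i)]
  rw [hs, mul_add, ← mul_assoc 2 2⁻¹, ENNReal.mul_inv_cancel two_ne_zero (by simp), one_mul]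

instance : Nonempty (Site β) := ⟨(⟨∅⟩, ⟨∅⟩, 1)⟩

section Gap

variable {C : ℝ} (hβ : 0 < β) (hC : 0 ≤ C) (hlam : ∀ i, 0 ≤ lam i)
  (hBD : ∀ (i : Λ) (σ : Λ → ℤˣ), |spinGrad H i σ| ≤ C)

-- The window starts at the infimum over the site. Comparing with an arbitrary reference state
-- instead would give a window of length `2βC` and a worse exponent in the gap.
include hβ hC hBD in
theorem exists_energy_window (ω : State Λ β) (i : Λ) : ∃ a : ℝ, ∀ q : Site β,
    a ≤ energy H (Function.update ω i q) ∧ energy H (Function.update ω i q) ≤ a + β * C := by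
  have hd : ∀ q q' : Site β, energy H (Function.update ω i q) - β * C ≤
      energy H (Function.update ω i q') := fun q q' => by
    linarith [(abs_le.1 (abs_energy_update_sub_le hBD hβ.le hC ω i q q')).2]
  refine ⟨⨅ q : Site β, energy H (Function.update ω i q), fun q => ⟨?_, ?_⟩⟩
  · obtain ⟨q₀⟩ := (inferInstance : Nonempty (Site β))
    refine ciInf_le ⟨energy H (Function.update ω i q₀) - β * C, ?_⟩ q
    rintro _ ⟨q', rfl⟩
    exact hd q₀ q'
  · have : energy H (Function.update ω i q) - β * C ≤
        ⨅ q : Site β, energy H (Function.update ω i q) := le_ciInf fun q' => hd q q'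
    linarith

include hβ hC hlam hBD in
/-- The conditional variance at one site is controlled by the Dirichlet form at that site. -/
theorem lintegral_sub_siteAvg_sq_le {u : State Λ β → ℝ} (hu : BddMeas u) (i : Λ) :
    ∫⁻ ω, ENNReal.ofReal ((u ω - siteAvg (fun i => siteRef β (lam i / 2))
        (fun ω => Real.exp (energy H ω)) i u ω) ^ 2) ∂(liftedMeasure β H lam) ≤
      ENNReal.ofReal (Real.exp (β * C)) *
        ∫⁻ ω, siteDirichlet H u i ω ∂(liftedMeasure β H lam) := by
  have h2 : ∀ i, 0 ≤ lam i / 2 := fun i => by linarith [hlam i]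
  have := fun i => isFiniteMeasure_siteRef hβ.le (h2 i)
  have := fun i => neZero_siteRef hβ.le (h2 i)
  obtain ⟨M, _, hh⟩ := exists_gibbsDensity (β := β) H hβ.le
  set ν : Λ → Measure (Site β) := fun i => siteRef β (lam i / 2) with hν
  have hA := (hh.bddMeas_siteAvg ν i hu).1
  have hD := measurable_siteDirichlet (H := H) hβ.le hu.1 i
  rw [← lintegral_const_mul _ hD]
  refine hh.lintegral_gibbs_le ν i (measurable_sq_sub hu.1 hA) (hD.const_mul _) fun ω => ?_
  simp_rw [GibbsDensity.siteAvg_update]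
  obtain ⟨a, ha⟩ := exists_energy_window hβ hC hBD ω i
  have huω : BddMeas fun q : Site β => u (Function.update ω i q) := hu.comp (measurable_update ω)
  obtain ⟨m, hm⟩ := siteRef_poincare hβ.le (h2 i) huω
  refine (hh.lintegral_sub_siteAvg_sq_le ν i hu ω m).trans ?_
  -- Holley–Stroock comparison: the weight is at most `e^{a + βC}` in the variance and at least
  -- `e^a` in the Dirichlet form, so the total loss is `e^{βC}`.
  calc ∫⁻ q, ENNReal.ofReal (Real.exp (energy H (Function.update ω i q))) *
        ENNReal.ofReal ((u (Function.update ω i q) - m) ^ 2) ∂(ν i)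
      ≤ ∫⁻ q, ENNReal.ofReal (Real.exp (a + β * C)) *
          ENNReal.ofReal ((u (Function.update ω i q) - m) ^ 2) ∂(ν i) :=
        lintegral_mono fun q => mul_le_mul' (ENNReal.ofReal_le_ofReal
          (Real.exp_le_exp.2 (ha q).2)) le_rfl
    _ ≤ ENNReal.ofReal (Real.exp (a + β * C)) *
          ∫⁻ q, siteGradSq (fun q => u (Function.update ω i q)) q ∂(ν i) := by
        rw [lintegral_const_mul' _ _ ENNReal.ofReal_ne_top]
        exact mul_le_mul' le_rfl hm
    _ = ∫⁻ q, ENNReal.ofReal (Real.exp (a + β * C)) *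
          siteGradSq (fun q => u (Function.update ω i q)) q ∂(ν i) := by
        rw [lintegral_const_mul' _ _ ENNReal.ofReal_ne_top]
    _ ≤ _ := by
        refine lintegral_mono fun q => ?_
        rw [add_comm a, Real.exp_add, ENNReal.ofReal_mul (Real.exp_nonneg _), mul_assoc,
          mul_left_comm (ENNReal.ofReal (Real.exp (energy H _)))]
        refine mul_le_mul' le_rfl ?_
        have hrem : ∀ k x, (Move.rem k i x).act (Function.update ω i q) =
            Function.update ω i (setPts k q ((sitePts k q).erase x)) := fun k x => by
          simp [Move.act]
        have hflip : (Move.flip i).act (Function.update ω i q) =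
            Function.update ω i (q.1, q.2.1, -q.2.2) := by simp [Move.act]
        -- Weight times flip rate is the exponential of the mean of two energies in the window, so
        -- flips also have weight at least `e^a` and cost nothing extra.
        have hw : ENNReal.ofReal (Real.exp a) ≤
            ENNReal.ofReal (Real.exp (energy H (Function.update ω i q))) *
              flipRate H i (Function.update ω i q) := by
          rw [flipRate, ← ENNReal.ofReal_mul (Real.exp_nonneg _), ← Real.exp_add, hflip]
          refine ENNReal.ofReal_le_ofReal (Real.exp_le_exp.2 ?_)
          linarith [(ha q).1, (ha (q.1, q.2.1, -q.2.2)).1]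
        rw [siteGradSq, siteDirichlet, mul_add, mul_add]
        refine add_le_add ?_ ?_
        · simp only [hrem, Function.update_self]
          exact mul_le_mul' (ENNReal.ofReal_le_ofReal (Real.exp_le_exp.2 (ha q).1)) le_rfl
        · rw [hflip, mul_left_comm, mul_left_comm (ENNReal.ofReal (Real.exp (energy H _))),
            ← mul_assoc (ENNReal.ofReal (Real.exp (energy H _)))]
          exact mul_le_mul' le_rfl (mul_le_mul' hw le_rfl)

include hβ hlam in
/-- The Dirichlet form is the sum of its one-site parts. -/
theorem ofReal_dirichlet {u : State Λ β → ℝ} (hu : BddMeas u) :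
    ENNReal.ofReal (-∫ ω, u ω * generator β H lam u ω ∂(liftedMeasure β H lam)) =
      ∑ i, ∫⁻ ω, siteDirichlet H u i ω ∂(liftedMeasure β H lam) := by
  have := isProbabilityMeasure_liftedMeasure (H := H) hβ.le hlam
  obtain ⟨K, h⟩ := exists_linearGrowth H lam hβ hlam
  have hm := h.measurable_grad hu.1
  have hint : Integrable (fun p : State Λ β × Move Λ β =>
      (u (p.2.act p.1) - u p.1) ^ 2) h.joint := by
    obtain ⟨B, hB⟩ := hu.2
    have hu1 : MemLp (fun _ : State Λ β => (1 : ℝ)) 2 (liftedMeasure β H lam) := memLp_const 1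
    have h1 := (h.integrable_mul_grad measurable_const hu1 hu).bdd_mul (c := 2 * B)
      hm.aestronglyMeasurable (Eventually.of_forall fun p => by
        rw [Real.norm_eq_abs]
        calc |u (p.2.act p.1) - u p.1| ≤ |u (p.2.act p.1)| + |u p.1| := abs_sub _ _
          _ ≤ 2 * B := by linarith [hB (p.2.act p.1), hB p.1])
    refine h1.congr (Eventually.of_forall fun p => ?_)
    simp only [one_mul, sq]
  have hgen : -∫ ω, u ω * generator β H lam u ω ∂(liftedMeasure β H lam) =
      1 / 2 * ∫ p, (u (p.2.act p.1) - u p.1) ^ 2 ∂h.joint := by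
    have := h.integral_mul_gen hu.1 (hu.memLp 2) hu
    rw [generator, this]
    simp only [sq]
    ring
  rw [hgen, ENNReal.ofReal_mul (by norm_num), ofReal_integral_eq_lintegral_ofReal hint
    (Eventually.of_forall fun p => sq_nonneg _),
    h.lintegral_joint (hm.pow_const 2).ennreal_ofReal, lintegral_gradSq hβ hlam hu.1, ← mul_assoc]
  rw [show (2 : ℝ≥0∞) = ENNReal.ofReal 2 by simp, ← ENNReal.ofReal_mul (by norm_num)]
  norm_num

include hβ hC hlam hBD in
theorem sum_integral_sub_siteAvg_sq_le {u : State Λ β → ℝ} (hu : BddMeas u) :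
    ∑ i, ∫ ω, (u ω - siteAvg (fun i => siteRef β (lam i / 2))
        (fun ω => Real.exp (energy H ω)) i u ω) ^ 2 ∂(liftedMeasure β H lam) ≤
      Real.exp (β * C) * -∫ ω, u ω * generator β H lam u ω ∂(liftedMeasure β H lam) := by
  have hπ := isProbabilityMeasure_liftedMeasure (H := H) hβ.le hlam
  have h2 : ∀ i, 0 ≤ lam i / 2 := fun i => by linarith [hlam i]
  have := fun i => isFiniteMeasure_siteRef hβ.le (h2 i)
  have := fun i => neZero_siteRef hβ.le (h2 i)
  obtain ⟨M, _, hh⟩ := exists_gibbsDensity (β := β) H hβ.le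
  obtain ⟨K, h⟩ := exists_linearGrowth H lam hβ hlam
  have hnn : 0 ≤ -∫ ω, u ω * generator β H lam u ω ∂(liftedMeasure β H lam) := by
    have := h.integral_mul_gen_nonpos hu
    rw [generator]
    linarith
  rw [← ENNReal.ofReal_le_ofReal_iff (mul_nonneg (Real.exp_nonneg _) hnn),
    ENNReal.ofReal_mul (Real.exp_nonneg _), ofReal_dirichlet hβ hlam hu, Finset.mul_sum,
    ENNReal.ofReal_sum_of_nonneg fun i _ => integral_nonneg fun ω => sq_nonneg _]
  refine Finset.sum_le_sum fun i _ => ?_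
  have hb := hu.sub (hh.bddMeas_siteAvg (fun i => siteRef β (lam i / 2)) i hu)
  rw [ofReal_integral_eq_lintegral_ofReal (hb.memLp 2).integrable_sq
    (Eventually.of_forall fun p => sq_nonneg _)]
  exact lintegral_sub_siteAvg_sq_le hβ hC hlam hBD hu i

include hβ hC hlam hBD in
/-- The Poincaré inequality for bounded functions. -/
theorem poincare {R : ℝ} (hR : 0 < R)
    (hLOC : ∀ (i : Λ) (σ τ : Λ → ℤˣ), (∀ j : Λ, latticeDist j.1 i.1 ≤ R → σ j = τ j) →
      spinGrad H i σ = spinGrad H i τ) {u : State Λ β → ℝ} (hu : BddMeas u) :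
    (1 - 15 * (2 * R) ^ d * ((Real.exp (2 * (β * C)) - 1) / 2)) *
        variance u (liftedMeasure β H lam) ≤
      Real.exp (β * C) * -∫ ω, u ω * generator β H lam u ω ∂(liftedMeasure β H lam) := by
  have hπ := isProbabilityMeasure_liftedMeasure (H := H) hβ.le hlam
  have h2 : ∀ i, 0 ≤ lam i / 2 := fun i => by linarith [hlam i]
  have := fun i => isFiniteMeasure_siteRef hβ.le (h2 i)
  have := fun i => neZero_siteRef hβ.le (h2 i)
  obtain ⟨M, _, hh⟩ := exists_gibbsDensity (β := β) H hβ.le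
  obtain ⟨K, h⟩ := exists_linearGrowth H lam hβ hlam
  have hx : 0 ≤ β * C := mul_nonneg hβ.le hC
  have hexp : 1 ≤ Real.exp (2 * (β * C)) := Real.one_le_exp (by linarith)
  set ν : Λ → Measure (Site β) := fun i => siteRef β (lam i / 2) with hν
  -- Within range the mixed difference of the energy in `i` and `j` is at most `2βC`. Out of range
  -- locality makes it vanish, so `κ = 1` and the influence is zero.
  set κ : Λ → Λ → ℝ := fun i j =>
    if latticeDist j.1 i.1 ≤ R then Real.exp (2 * (β * C)) else 1 with hκ
  have hsys := hh.dobrushinSystem ν (κ := κ)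
    (fun i j => by simp only [hκ]; split_ifs; exacts [hexp, le_rfl])
    (fun i j _ ω y q q' => by
      simp only [hκ]
      split_ifs with hij
      · rw [← Real.exp_add, ← Real.exp_add, ← Real.exp_add, Real.exp_le_exp]
        linarith [energy_mixed_le hBD hβ.le hC ω i j y q q']
      · rw [one_mul, ← Real.exp_add, ← Real.exp_add, Real.exp_le_exp]
        linarith [energy_mixed_eq hLOC hij ω y q q'])
  set α : ℝ := 15 * (2 * R) ^ d * ((Real.exp (2 * (β * C)) - 1) / 2) with hα
  have hα0 : 0 ≤ α := mul_nonneg (by positivity) (by linarith)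
  have hsum : ∀ i, ∑ j, (if j = i then 0 else (κ i j - 1) / 2) ≤ α := by
    intro i
    have e : ∀ j, (if j = i then 0 else (κ i j - 1) / 2) =
        if j ≠ i ∧ latticeDist j.1 i.1 ≤ R then (Real.exp (2 * (β * C)) - 1) / 2 else 0 := by
      intro j
      simp only [hκ]
      by_cases h1 : j = i <;> by_cases h3 : latticeDist j.1 i.1 ≤ R <;> simp [h1, h3]
    simp_rw [e]
    rw [← Finset.sum_filter, Finset.sum_const, nsmul_eq_mul]
    exact mul_le_mul_of_nonneg_right (card_neighbors_le i hR) (by linarith)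
  -- The Dobrushin bound is for mean-zero functions. Subtracting the mean changes neither the
  -- variance nor the Dirichlet form, which depends only on gradients.
  set c := ∫ ω, u ω ∂(liftedMeasure β H lam) with hc
  have hcb : BddMeas fun _ : State Λ β => c := ⟨measurable_const, |c|, fun _ => le_rfl⟩
  have hf := hu.sub hcb
  have hmean : ∫ ω, (u ω - c) ∂(liftedMeasure β H lam) = 0 := by
    rw [integral_sub ((hu.memLp 1).integrable le_rfl) (integrable_const c), ← hc]
    simp
  have hvar : variance u (liftedMeasure β H lam) = ∫ ω, (u ω - c) ^ 2 ∂(liftedMeasure β H lam) :=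
    variance_eq_integral hu.1.aemeasurable
  have hD : ∫ ω, u ω * generator β H lam u ω ∂(liftedMeasure β H lam) =
      ∫ ω, (u ω - c) * generator β H lam (fun ω => u ω - c) ω ∂(liftedMeasure β H lam) := by
    have e1 := h.integral_mul_gen hu.1 (hu.memLp 2) hu
    have e2 := h.integral_mul_gen hf.1 (hf.memLp 2) hf
    simp only [sub_sub_sub_cancel_right] at e2
    rw [generator, e1, ← e2]
  rw [hvar, hD]
  have hπ' : IsProbabilityMeasure (gibbs ν fun ω => Real.exp (energy H ω)) := hπ
  refine (hsys.variance_le hα0 hsum hf hmean).trans ?_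
  simp_rw [← hh.integral_sub_siteAvg_sq ν _ hf]
  exact sum_integral_sub_siteAvg_sq_le hβ hC hlam hBD hf

end Gap

/-- With `y = e^x`, the stated bound follows from `y⁻² ≤ y⁻¹`, from `3(y² - 1)/y ≤ 2(y³ - 1)` and
from `m ≥ 1`. -/
theorem gap_bound_le {x n m r : ℝ} (hx : 0 ≤ x) (hn : 0 ≤ n) (hm : 1 ≤ m) (hr : r = 15 * n) :
    Real.exp (-2 * x) - 5 * m * n * (Real.exp (3 * x) - 1) ≤
      (1 - r * ((Real.exp (2 * x) - 1) / 2)) * Real.exp (-x) := by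
  set y := Real.exp x with hy
  have hy1 : 1 ≤ y := Real.one_le_exp hx
  have hy0 : 0 < y := Real.exp_pos x
  have e2 : Real.exp (2 * x) = y ^ 2 := by rw [hy, ← Real.exp_nat_mul]; norm_num
  have e3 : Real.exp (3 * x) = y ^ 3 := by rw [hy, ← Real.exp_nat_mul]; norm_num
  have em : Real.exp (-x) = y⁻¹ := Real.exp_neg x
  have hle : Real.exp (-2 * x) ≤ y⁻¹ := by
    rw [← em]
    exact Real.exp_le_exp.2 (by linarith)
  rw [e2, e3, em, hr]
  -- After multiplication by `y`, the difference of the two sides is `(y - 1)²(2y² + 4y + 3)`.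
  have hkey : 3 * (y ^ 2 - 1) * y⁻¹ ≤ 2 * (y ^ 3 - 1) := by
    rw [← div_eq_mul_inv, div_le_iff₀ hy0]
    nlinarith [mul_nonneg (sub_nonneg.2 hy1) (sub_nonneg.2 hy1), mul_nonneg (mul_nonneg
      (sub_nonneg.2 hy1) (sub_nonneg.2 hy1)) (by nlinarith : (0 : ℝ) ≤ 2 * y ^ 2 + 4 * y + 3)]
  have h3 : 0 ≤ y ^ 3 - 1 := sub_nonneg.2 (one_le_pow₀ hy1)
  have h5 : n * (5 * (y ^ 3 - 1)) ≤ m * (n * (5 * (y ^ 3 - 1))) :=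
    le_mul_of_one_le_left (by positivity) hm
  have h6 : n * (5 / 2 * (3 * (y ^ 2 - 1) * y⁻¹)) ≤ n * (5 / 2 * (2 * (y ^ 3 - 1))) :=
    mul_le_mul_of_nonneg_left (by linarith) hn
  nlinarith

end TransverseField

end

/-! ### The main theorem -/

theorem theorem5p4 {d : ℕ} (β C lamMax R : ℝ) (hβ : 0 < β) (hC : 0 < C) (hlamMax : 0 < lamMax)
    (hR : 0 < R) (Λ : Finset (Fin d → ℤ)) (H : (Λ → ℤˣ) → ℝ) (lam : Λ → ℝ)
    (hBD : ∀ (i : Λ) (σ : Λ → ℤˣ), |TransverseField.spinGrad H i σ| ≤ C)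
    (hlam : ∀ i : Λ, 0 ≤ lam i ∧ lam i ≤ lamMax)
    (hLOC : ∀ (i : Λ) (σ τ : Λ → ℤˣ),
      (∀ j : Λ, TransverseField.latticeDist j.1 i.1 ≤ R → σ j = τ j) →
        TransverseField.spinGrad H i σ = TransverseField.spinGrad H i τ) :
    IsProbabilityMeasure (TransverseField.liftedMeasure β H lam) ∧
    JumpGen.Reversible TransverseField.Move.act TransverseField.Move.inv
      (TransverseField.rates β H lam) (TransverseField.liftedMeasure β H lam) ∧
    JumpGen.SelfAdjointClosure (TransverseField.generator β H lam)
      (TransverseField.liftedMeasure β H lam) ∧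
    ((Real.exp (-2 * β * C) -
        5 * max 1 (β * lamMax) * (2 * R) ^ d * (Real.exp (3 * β * C) - 1) : ℝ) : EReal) ≤
      JumpGen.gap (TransverseField.generator β H lam)
        (TransverseField.liftedMeasure β H lam) := by
  have hlam0 : ∀ i, 0 ≤ lam i := fun i => (hlam i).1
  have hπ := TransverseField.isProbabilityMeasure_liftedMeasure (H := H) hβ.le hlam0
  obtain ⟨K, h⟩ := TransverseField.exists_linearGrowth H lam hβ hlam0
  refine ⟨hπ, h.rev, h.selfAdjointClosure, h.le_gap fun u hu => ?_⟩
  have hx : 0 ≤ β * C := (mul_pos hβ hC).le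
  have hnum := TransverseField.gap_bound_le (n := (2 * R) ^ d) (m := max 1 (β * lamMax)) hx
    (by positivity) (le_max_left _ _) rfl
  rw [← mul_assoc, ← mul_assoc] at hnum
  have hp := TransverseField.poincare hβ hC.le hlam0 hBD hR hLOC hu
  have hp' := mul_le_mul_of_nonneg_right hp (Real.exp_nonneg (-(β * C)))
  rw [mul_right_comm, mul_right_comm (Real.exp (β * C)), ← Real.exp_add, add_neg_cancel,
    Real.exp_zero, one_mul] at hp'
  exact (mul_le_mul_of_nonneg_right hnum (variance_nonneg u _)).trans hp'
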